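/- Let $M$ be a $C^\infty$ manifold (finite-dimensional, without boundary), $G$ a Lie group with Lie algebra $\mathfrak g$, and $P\to M$ a $C^\infty$ principal $G$-bundle. Let $q:C\to M$ be the bundle of connections of $P$, an affine bundle modelled on $T^*M\otimes\mathrm{ad}P$, so that the space $\mathcal A$ of connections on $P$ is $\Gamma(M,C)$, an affine space with $T_A\mathcal A=\Omega^1(M,\mathrm{ad}P)$. (The affine structure is that of connection $1$-forms: $A+\xi$ is the connection whose $1$-form on $P$ is the sum of that of $A$ and the tensorial form $\xi$.) Let $F$ be the universal curvature, the $q^*\mathrm{ad}P$-valued $2$-form on $C$ that in the coordinates $(x^i,A^\alpha_i)$ given by a chart of $M$, a local trivialization of $P$ and a basis $(B_\alpha)$ of $\mathfrak g$ with structure constants $c^\alpha_{\beta\gamma}$ is $$F=\bigl(dA^\alpha_i\wedge dx^i+\tfrac12 c^\alpha_{\beta\gamma}A^\beta_iA^\gamma_j\,dx^i\wedge dx^j\bigr)B_\alpha .$$ Let $p\in S^r(\mathfrak g^*)^G$ be a symmetric $r$-linear form on $\mathfrak g$ invariant under the adjoint action, and let $p(F)=p(F,\dots,F)\in\Omega^{2r}(C)$.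 For $0\le k\le 2r$, $A\in\mathcal A$ and $\xi_1,\dots,\xi_k\in T_A\mathcal A$, regarded as $q$-vertical vector fields along $A(M)$, put $$\beta_k^p(A)(\xi_1,\dots,\xi_k)=A^*\bigl(i_{\xi_1}\cdots i_{\xi_k}\,p(F)\bigr)\in\Omega^{2r-k}(M).$$ Let $d$ be the de Rham differential on $M$, and let $d_{\mathcal A}$ be the exterior derivative of forms on $\mathcal A$ with values in $\Omega^{2r-k}(M)$: for $\xi_0,\dots,\xi_k$ extended to constant vector fields, $(d_{\mathcal A}\beta)(\xi_0,\dots,\xi_k)=\sum_i(-1)^i\,\xi_i\bigl(\beta(\xi_0,\dots,\widehat{\xi_i},\dots,\xi_k)\bigr)$, with directional derivatives taken in the $C^\infty$ topology of $\Omega^{2r-k}(M)$. Then for all $0\le k\le r$ the form $\beta_k^p$, and for $2r-k\ge 1$ also $\beta_{k+1}^p$, is a differentiable alternating form on $\mathcal A$ (all directional derivatives exist) with values in $\Omega^{2r-k}(M)$, respectively $\Omega^{2r-k-1}(M)$; and $$d_{\mathcal A}\beta_k^p=d\circ\beta_{k+1}^p ,$$ where for $r=k=0$ the right-hand side is read as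 $0$. Equivalently for $k<r$, the normalized forms $\bar\beta_k^p=\frac{(r-k)!}{r!}\,\beta_k^p$ satisfy $$d_{\mathcal A}\bar\beta_k^p=(r-k)\; d\circ\bar\beta_{k+1}^p .$$ For $k=r$ one has $d_{\mathcal A}\beta_r^p=0$. In particular $d_{\mathcal A}\beta_k^p$ takes values in the exact forms $B^{2r-k}(M)=d\,\Omega^{2r-k-1}(M)$ (with $B^0(M)=0$). -/

import Mathlib

open scoped Manifold ContDiff Topology
open MulOpposite Filter Set

noncomputable section

namespace ConnForms

/-! ### Multilinear algebra -/

section Algebra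

variable {V : Type*} [NormedAddCommGroup V] [NormedSpace ℝ V] [FiniteDimensional ℝ V]

/-- Alternating maps on a finite-dimensional space are continuous. -/
theorem alternating_continuous {m : ℕ} (f : V [⋀^Fin m]→ₗ[ℝ] ℝ) : Continuous f := by
  classical
  let b := Module.finBasis ℝ V
  have key : ∀ v : Fin m → V, f v = ∑ s : Fin m → Fin (Module.finrank ℝ V),
      (∏ i, b.repr (v i) (s i)) * f (fun i => b (s i)) := by
    intro v
    have h1 : v = fun i => ∑ j, b.repr (v i) j • b j := by
      funext i
      exact (b.sum_repr (v i)).symm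
    conv_lhs => rw [h1]
    have h2 := f.toMultilinearMap.map_sum (fun i j => b.repr (v i) j • b j)
    refine h2.trans (Finset.sum_congr rfl fun s _ => ?_)
    exact f.toMultilinearMap.map_smul_univ (fun i => b.repr (v i) (s i)) (fun i => b (s i))
  have hc : ∀ j, Continuous fun v : V => b.repr v j := fun j =>
    (b.coord j).continuous_of_finiteDimensional
  rw [show (f : (Fin m → V) → ℝ) = _ from funext key]
  exact continuous_finsetSum _ fun s _ =>
    (continuous_finsetProd _ fun i _ => (hc (s i)).comp (continuous_apply i)).mul continuous_const

/-- An alternating map on a finite-dimensional space, as a continuous alternating map. -/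
def toCont {m : ℕ} (f : V [⋀^Fin m]→ₗ[ℝ] ℝ) : V [⋀^Fin m]→L[ℝ] ℝ :=
  { f with cont := alternating_continuous f }

/-- The iterated contraction `i_{ξ 0} i_{ξ 1} ⋯ i_{ξ (k-1)} θ`; the contraction with the last
vector `ξ (k-1)` is carried out first. -/
def iterContract {W : Type*} [AddCommGroup W] [Module ℝ W] (m : ℕ) :
    (k : ℕ) → (Fin k → W) → (W [⋀^Fin (m + k)]→ₗ[ℝ] ℝ) → (W [⋀^Fin m]→ₗ[ℝ] ℝ)
  | 0, _, θ => θ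
  | k + 1, ξ, θ =>
      iterContract m k (fun i => ξ i.castSucc) (AlternatingMap.curryLeft θ (ξ (Fin.last k)))

/-- For a bilinear map `Φ : W × W → L` and an `r`-linear form `p` on `L`, the `2r`-linear form
`v ↦ p (Φ (v_1, v_2), …, Φ (v_{2r-1}, v_{2r}))`; its variables are indexed by `Fin r × Fin 2`. -/
def pairEval {W L : Type*} [AddCommGroup W] [Module ℝ W] [AddCommGroup L] [Module ℝ L] {r : ℕ}
    (p : MultilinearMap ℝ (fun _ : Fin r => L) ℝ) (Φ : W →ₗ[ℝ] W →ₗ[ℝ] L) :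
    MultilinearMap ℝ (fun _ : Fin r × Fin 2 => W) ℝ :=
  MultilinearMap.mk' (fun v => p fun i => Φ (v (i, 0)) (v (i, 1)))
    (by
      classical
      rintro v ⟨i, j⟩ x y
      have key : ∀ z : W, (fun i' => Φ (Function.update v (i, j) z (i', 0))
          (Function.update v (i, j) z (i', 1))) =
          Function.update (fun i' => Φ (v (i', 0)) (v (i', 1))) i
            (Φ (Function.update v (i, j) z (i, 0)) (Function.update v (i, j) z (i, 1))) := by
        intro z
        funext i'
        by_cases h : i' = i
        · subst h; simp
        · simp [Function.update_of_ne, h]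
      rw [key, key, key, ← p.map_update_add]
      congr 2
      fin_cases j <;> simp)
    (by
      classical
      rintro v ⟨i, j⟩ c x
      have key : ∀ z : W, (fun i' => Φ (Function.update v (i, j) z (i', 0))
          (Function.update v (i, j) z (i', 1))) =
          Function.update (fun i' => Φ (v (i', 0)) (v (i', 1))) i
            (Φ (Function.update v (i, j) z (i, 0)) (Function.update v (i, j) z (i, 1))) := by
        intro z
        funext i'
        by_cases h : i' = i
        · subst h; simp
        · simp [Function.update_of_ne, h]
      rw [key, key, ← p.map_update_smul]
      congr 2
      fin_cases j <;> simp)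

/-- The scalar `2r`-form `p(Φ, …, Φ)` obtained from an `L`-valued 2-form `Φ` by wedging and
applying `p`:
`p(Φ,…,Φ)(v_1,…,v_{2r}) = 2^{-r} ∑_σ sgn(σ) p(Φ(v_{σ1},v_{σ2}),…,Φ(v_{σ(2r-1)},v_{σ(2r)}))`. -/
def polyForm {W L : Type*} [AddCommGroup W] [Module ℝ W] [AddCommGroup L] [Module ℝ L] {r : ℕ}
    (p : MultilinearMap ℝ (fun _ : Fin r => L) ℝ) (Φ : W →ₗ[ℝ] W →ₗ[ℝ] L) :
    W [⋀^Fin (r * 2)]→ₗ[ℝ] ℝ :=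
  ((2 : ℝ) ^ r)⁻¹ • (MultilinearMap.alternatization (pairEval p Φ)).domDomCongr finProdFinEquiv

end Algebra

/-! ### Differential forms on a manifold modelled on `E` -/

section Forms

variable {E : Type*} [NormedAddCommGroup E] [NormedSpace ℝ E]
  {M : Type*} [TopologicalSpace M] [ChartedSpace E M]

variable (E M) in
/-- Fields of alternating `j`-forms on the tangent spaces of `M` (no regularity). -/
abbrev RawForm (j : ℕ) : Type _ :=
  ∀ x : M, TangentSpace 𝓘(ℝ, E) x [⋀^Fin j]→L[ℝ] ℝ

/-- The expression of `θ` in the chart around `x₀`, i.e. its pullback under the inverse chart. -/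
def chartRep {j : ℕ} (x₀ : M) (θ : RawForm E M j) (y : E) : E [⋀^Fin j]→L[ℝ] ℝ :=
  (θ ((chartAt E x₀).symm y)).compContinuousLinearMap
    (mfderiv 𝓘(ℝ, E) 𝓘(ℝ, E) (chartAt E x₀).symm y)

/-- `θ ∈ Ω^j(M)`: the form is `C^∞`. -/
def IsSmoothForm {j : ℕ} (θ : RawForm E M j) : Prop :=
  ∀ x₀ : M, ContDiffOn ℝ ∞ (chartRep x₀ θ) (chartAt E x₀).target

/-- The de Rham differential on `M`, computed at `x` in the chart around `x`. -/
def extD {j : ℕ} (θ : RawForm E M j) : RawForm E M (j + 1) := fun x =>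
  (extDeriv (chartRep x θ) (chartAt E x x)).compContinuousLinearMap
    (mfderiv 𝓘(ℝ, E) 𝓘(ℝ, E) (chartAt E x) x)

/-- `θ` is exact: `θ = dη` with `η` smooth; in degree `0` only the zero form is exact. -/
def IsExactForm : {j : ℕ} → RawForm E M j → Prop
  | 0, θ => θ = 0
  | j + 1, θ => ∃ η : RawForm E M j, IsSmoothForm η ∧ θ = extD η

/-- Convergence in the Fréchet (`C^∞`) topology of the space of forms: all derivatives of all
chart expressions converge locally uniformly. -/
def SmoothTendsto {ι : Type*} {j : ℕ} (θ : ι → RawForm E M j) (l : Filter ι)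
    (η : RawForm E M j) : Prop :=
  ∀ (x₀ : M) (n : ℕ),
    TendstoLocallyUniformlyOn (fun t => iteratedFDeriv ℝ n (chartRep x₀ (θ t)))
      (iteratedFDeriv ℝ n (chartRep x₀ η)) l (chartAt E x₀).target

end Forms

/-! ### The Lie algebra, principal bundles and connections

The Lie algebra `𝔤 = T_1 G` of a Lie group `G` modelled on the normed space `EG` has `EG` as its
underlying normed space; its bracket and the adjoint representation are the following. -/

section Bundle

variable {E : Type*} [NormedAddCommGroup E] [NormedSpace ℝ E] [FiniteDimensional ℝ E]
  {EG : Type*} [NormedAddCommGroup EG] [NormedSpace ℝ EG] [FiniteDimensional ℝ EG]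
  {EP : Type*} [NormedAddCommGroup EP] [NormedSpace ℝ EP]
  {M : Type*} [TopologicalSpace M] [ChartedSpace E M]
  {G : Type*} [TopologicalSpace G] [ChartedSpace EG G] [Group G] [LieGroup 𝓘(ℝ, EG) ∞ G]
  {P : Type*} [TopologicalSpace P] [ChartedSpace EP P] [MulAction Gᵐᵒᵖ P]

variable (G) in
/-- The Lie bracket of `𝔤` as a bilinear map. -/
def lieBr : EG →ₗ[ℝ] EG →ₗ[ℝ] EG :=
  haveI : LieGroup 𝓘(ℝ, EG) (minSmoothness ℝ 3) G :=
    LieGroup.of_le (n := ∞) (by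
      rw [minSmoothness_of_isRCLikeNormedField]
      exact WithTop.coe_le_coe.2 le_top)
  haveI : CompleteSpace EG := FiniteDimensional.complete ℝ EG
  show GroupLieAlgebra 𝓘(ℝ, EG) G →ₗ[ℝ]
      GroupLieAlgebra 𝓘(ℝ, EG) G →ₗ[ℝ] GroupLieAlgebra 𝓘(ℝ, EG) G from
    LinearMap.mk₂ ℝ (fun a b => ⁅a, b⁆) add_lie smul_lie lie_add lie_smul

/-- The adjoint representation: `Ad g` is the differential at `1` of `h ↦ g h g⁻¹`. -/
def Ad (g : G) : EG →L[ℝ] EG :=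
  mfderiv 𝓘(ℝ, EG) 𝓘(ℝ, EG) (fun h : G => g * h * g⁻¹) 1

variable (G) in
/-- `p ∈ S^r(𝔤^*)^G`: `p` is symmetric and invariant under the adjoint action. -/
structure IsInvariantPoly {r : ℕ} (p : MultilinearMap ℝ (fun _ : Fin r => EG) ℝ) : Prop where
  symm : ∀ (σ : Equiv.Perm (Fin r)) (v : Fin r → EG), p (v ∘ σ) = p v
  inv : ∀ (g : G) (v : Fin r → EG), p (fun i => Ad g (v i)) = p v

variable (E EG EP M G P) in
/-- The structure of a `C^∞` principal `G`-bundle over `M` on the manifold `P` with right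
`G`-action (written `op g • u` for `u g`): an invariant projection, and around every point of `M`
an equivariant trivialization that is a diffeomorphism. -/
structure PrincipalBundle where
  proj : P → M
  smooth_proj : ContMDiff 𝓘(ℝ, EP) 𝓘(ℝ, E) ∞ proj
  smooth_act : ContMDiff (𝓘(ℝ, EP).prod 𝓘(ℝ, EG)) 𝓘(ℝ, EP) ∞
    (fun q : P × G => op q.2 • q.1)
  proj_act : ∀ (u : P) (g : G), proj (op g • u) = proj u
  triv : M → Bundle.Trivialization G proj
  mem_triv : ∀ x, x ∈ (triv x).baseSet
  triv_act : ∀ (x : M) (u : P) (g : G), proj u ∈ (triv x).baseSet →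
    (triv x (op g • u)).2 = (triv x u).2 * g
  smooth_triv : ∀ x, ContMDiffOn 𝓘(ℝ, EP) (𝓘(ℝ, E).prod 𝓘(ℝ, EG)) ∞ (triv x) (triv x).source
  smooth_triv_symm : ∀ x, ContMDiffOn (𝓘(ℝ, E).prod 𝓘(ℝ, EG)) 𝓘(ℝ, EP) ∞
    (triv x).toOpenPartialHomeomorph.symm (triv x).target

variable (EG EP P) in
/-- `𝔤`-valued 1-forms on `P` (no regularity). -/
abbrev GForm : Type _ := ∀ u : P, TangentSpace 𝓘(ℝ, EP) u →L[ℝ] EG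

/-- The expression of a `𝔤`-valued 1-form on `P` in the chart around `u₀`. -/
def gRep (u₀ : P) (θ : GForm EG EP P) (y : EP) : EP →L[ℝ] EG :=
  (θ ((chartAt EP u₀).symm y)).comp (mfderiv 𝓘(ℝ, EP) 𝓘(ℝ, EP) (chartAt EP u₀).symm y)

/-- The `𝔤`-valued 1-form on `P` is `C^∞`. -/
def IsSmoothGForm (θ : GForm EG EP P) : Prop :=
  ∀ u₀ : P, ContDiffOn ℝ ∞ (gRep u₀ θ) (chartAt EP u₀).target

variable (G) in
/-- `R_g^* θ = Ad(g⁻¹) θ`. -/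
def IsEquivariantGForm (θ : GForm EG EP P) : Prop :=
  ∀ (u : P) (g : G) (w : TangentSpace 𝓘(ℝ, EP) u),
    θ (op g • u) (mfderiv 𝓘(ℝ, EP) 𝓘(ℝ, EP) (fun v : P => op g • v) u w) = Ad g⁻¹ (θ u w)

/-- The value at `u 1 = u` of the fundamental vector field of `b ∈ 𝔤`, that is `d/dt u exp(tb)`. -/
def fundVec (u : P) (b : EG) : TangentSpace 𝓘(ℝ, EP) (op (1 : G) • u) :=
  mfderiv 𝓘(ℝ, EG) 𝓘(ℝ, EP) (fun g : G => op g • u) 1 b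

variable (EG EP G P) in
/-- The space `𝒜` of connections: smooth equivariant `𝔤`-valued 1-forms on `P` that reproduce
the generators of the fundamental vector fields. -/
structure Connection where
  form : GForm EG EP P
  smooth : IsSmoothGForm form
  equivariant : IsEquivariantGForm G form
  vertical : ∀ (u : P) (b : EG), form (op (1 : G) • u) (fundVec u b) = b

variable (EG EP G P) in
/-- The space `T_A 𝒜 = Ω^1(M, ad P)`, realised as the smooth, equivariant and horizontal
`𝔤`-valued 1-forms on `P`. -/
def AdForms : Submodule ℝ (GForm EG EP P) where
  carrier := {ξ | IsSmoothGForm ξ ∧ IsEquivariantGForm G ξ ∧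
    ∀ (u : P) (b : EG), ξ (op (1 : G) • u) (fundVec u b) = 0}
  zero_mem' := by
    refine ⟨fun u₀ => ?_, fun u g w => by simp, fun u b => by simp⟩
    exact (contDiffOn_const (c := (0 : EP →L[ℝ] EG))).congr fun y _ => rfl
  add_mem' := by
    rintro ξ η ⟨h1, h2, h3⟩ ⟨h1', h2', h3'⟩
    refine ⟨fun u₀ => ?_, fun u g w => ?_, fun u b => ?_⟩
    · exact ((h1 u₀).add (h1' u₀)).congr fun y _ => rfl
    · have := h2 u g w
      have := h2' u g w
      simp_all
    · have := h3 u b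
      have := h3' u b
      simp_all
  smul_mem' := by
    rintro t ξ ⟨h1, h2, h3⟩
    refine ⟨fun u₀ => ?_, fun u g w => ?_, fun u b => ?_⟩
    · exact ((h1 u₀).const_smul t).congr fun y _ => rfl
    · have := h2 u g w
      simp_all
    · have := h3 u b
      simp_all

/-- The affine structure of `𝒜`: the connection `A + ξ`. -/
def Connection.translate (A : Connection EG EP G P) (ξ : AdForms EG EP G P) :
    Connection EG EP G P where
  form := A.form + ξ.1
  smooth := fun u₀ => ((A.smooth u₀).add (ξ.2.1 u₀)).congr fun y _ => rfl
  equivariant := fun u g w => by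
    have := A.equivariant u g w
    have := ξ.2.2.1 u g w
    simp_all
  vertical := fun u b => by
    have := A.vertical u b
    have := ξ.2.2.2 u b
    simp_all

/-! ### Forms on `𝒜` with values in forms on `M` -/

variable (E EG EP M G P) in
/-- Functions assigning to a connection `A` and `k` tangent vectors at `A` a field of `j`-forms
on `M`. -/
abbrev ConnField (k j : ℕ) : Type _ :=
  Connection EG EP G P → (Fin k → AdForms EG EP G P) → RawForm E M j

/-- `η ∈ Ω^j(M)` is the derivative of `f : 𝒜 → Ω^j(M)` at `A` in the direction `ξ`, i.e. the limit
of `(f (A + tξ) - f A) / t` for `t → 0` in the `C^∞` topology. -/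
def HasDirDeriv {j : ℕ} (f : Connection EG EP G P → RawForm E M j)
    (A : Connection EG EP G P) (ξ : AdForms EG EP G P) (η : RawForm E M j) : Prop :=
  IsSmoothForm η ∧
    SmoothTendsto (fun t : ℝ => t⁻¹ • (f (A.translate (t • ξ)) - f A)) (𝓝[≠] 0) η

open Classical in
/-- The directional derivative, with value `0` where it does not exist. -/
def dirDeriv {j : ℕ} (f : Connection EG EP G P → RawForm E M j)
    (A : Connection EG EP G P) (ξ : AdForms EG EP G P) : RawForm E M j :=
  if h : ∃ η, HasDirDeriv f A ξ η then h.choose else 0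

/-- `b` is a differentiable `k`-form on `𝒜` with values in `Ω^j(M)`: its values are smooth forms,
it is multilinear and alternating in the tangent vectors, and its directional derivatives exist. -/
structure IsConnForm {k j : ℕ} (b : ConnField E EG EP M G P k j) : Prop where
  smooth : ∀ A ξ, IsSmoothForm (b A ξ)
  alternating : ∀ A, ∃ L : AlternatingMap ℝ (AdForms EG EP G P) (RawForm E M j) (Fin k),
    ∀ ξ, L ξ = b A ξ
  differentiable : ∀ A ξ ζ, ∃ η, HasDirDeriv (fun A' => b A' ξ) A ζ η

/-- The exterior derivative on the affine space `𝒜`; the tangent vectors are extended to constant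
vector fields:
`(d_𝒜 b)_A(ξ_0,…,ξ_k) = ∑_i (-1)^i ξ_i(b(ξ_0,…,ξ_{i-1},ξ_{i+1},…,ξ_k))(A)`. -/
def connD {k j : ℕ} (b : ConnField E EG EP M G P k j) : ConnField E EG EP M G P (k + 1) j :=
  fun A ξ => ∑ i : Fin (k + 1),
    (-1 : ℝ) ^ (i : ℕ) • dirDeriv (fun A' => b A' (fun l => ξ (i.succAbove l))) A (ξ i)

/-! ### The bundle of connections, the universal curvature and the forms `β`

Over a coordinate domain of `M` on which `P` is trivialized, the bundle of connections `C` has the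
coordinates `(x^i, A^α_i)`, that is, it is an open part of `E × (E →L[ℝ] EG)`, where a connection
corresponds to the pullback of its 1-form under the local section of the trivialization. -/

/-- The local section `x ↦ (x, 1)` of `P` given by the trivialization around `x₀`, in the chart
around `x₀`. -/
def localSection (B : PrincipalBundle E EG EP M G P) (x₀ : M) (y : E) : P :=
  (B.triv x₀).toOpenPartialHomeomorph.symm ((chartAt E x₀).symm y, 1)

/-- The local coordinate expression `(A^α_i)` of a `𝔤`-valued 1-form on `P`: its pullback under the
local section. -/
def localExpr (B : PrincipalBundle E EG EP M G P) (x₀ : M) (θ : GForm EG EP P) (y : E) :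
    E →L[ℝ] EG :=
  (θ (localSection B x₀ y)).comp (mfderiv 𝓘(ℝ, E) 𝓘(ℝ, EP) (localSection B x₀) y)

variable (G) in
/-- The universal curvature
`F = dA^α_i ∧ dx^i + ½ c^α_{βγ} A^β_i A^γ_j dx^i ∧ dx^j` at the point `c = (x, a)` of `C`:
`F((v,α),(w,β)) = α(w) - β(v) + [a(v), a(w)]`. -/
def univCurv (c : E × (E →L[ℝ] EG)) :
    (E × (E →L[ℝ] EG)) →ₗ[ℝ] (E × (E →L[ℝ] EG)) →ₗ[ℝ] EG :=
  LinearMap.mk₂ ℝ (fun X Y => X.2 Y.1 - Y.2 X.1 + lieBr G (c.2 X.1) (c.2 Y.1))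
    (fun X X' Y => by simp; abel)
    (fun t X Y => by simp [smul_add, smul_sub])
    (fun X Y Y' => by simp; abel)
    (fun t X Y => by simp [smul_add, smul_sub])

variable (G) in
/-- The `2r`-form `p(F) = p(F, …, F)` on `C`, in coordinates. -/
def polyF {r : ℕ} (p : MultilinearMap ℝ (fun _ : Fin r => EG) ℝ) (c : E × (E →L[ℝ] EG)) :
    (E × (E →L[ℝ] EG)) [⋀^Fin (r * 2)]→ₗ[ℝ] ℝ :=
  polyForm p (univCurv G c)

/-- The form `β_k^p` on `𝒜` with values in forms of degree `m = 2r - k` on `M`,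
`β_k^p(A)(ξ_1,…,ξ_k) = A^*(i_{ξ_1} ⋯ i_{ξ_k} p(F))`. At `x ∈ M` it is computed in the
coordinates around `x`: the connection `A` is the section `z ↦ (z, a z)` of `C`, and `ξ_i` is the
vertical tangent vector `(0, ξ_i)` of `C` at `A(x)`. -/
def beta (B : PrincipalBundle E EG EP M G P) {r : ℕ}
    (p : MultilinearMap ℝ (fun _ : Fin r => EG) ℝ) (k m : ℕ) (h : m + k = 2 * r) :
    ConnField E EG EP M G P k m := fun A ξ x =>
  let y : E := chartAt E x x
  let a : E → (E →L[ℝ] EG) := localExpr B x A.form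
  let pF : (E × (E →L[ℝ] EG)) [⋀^Fin (m + k)]→ₗ[ℝ] ℝ :=
    (polyF G p (y, a y)).domDomCongr (finCongr (by omega))
  let contracted := iterContract m k (fun i => ((0 : E), localExpr B x (ξ i).1 y)) pF
  let pulledBack : E [⋀^Fin m]→L[ℝ] ℝ :=
    toCont (contracted.compLinearMap (fderiv ℝ (fun z => (z, a z)) y).toLinearMap)
  pulledBack.compContinuousLinearMap (mfderiv 𝓘(ℝ, E) 𝓘(ℝ, E) (chartAt E x) x)

end Bundle

end ConnForms

end

/-!
The forms `β_k` are contractions of the Chern–Weil form `p(F)`, so the identity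
`d_𝒜 β_k = d β_{k+1}` is a consequence of two facts: `p(F)` is closed, and contractions with
constant vector fields obey an iterated Cartan formula. Everything is local on `M`. Near a point,
let the connection be given by `a` and the tangent vectors by `z_0, …, z_k`, and consider on
`ℝ^{k+1} × E` the connection form `a + ∑ t_i z_i` (`familyForm`). Its curvature is the pullback of
the universal curvature `F` under `(t, x) ↦ (x, a(x) + ∑ t_i z_i(x))`, and this map sends
`∂/∂t_i` to the vertical vector `z_i`; therefore contracting its Chern–Weil form with some of the
`∂/∂t_i` and restricting to `{t} × E` gives the forms `β` (`castDeg_polyForm_familyForm`).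

* Closedness, `alternation_fderiv_polyForm_curvForm`: the infinitesimal form of the invariance of
  `p` (`IsInvariantPoly.sum_update_lieBr`) lets one replace the derivative of the curvature by its
  covariant derivative, and the Bianchi identity together with a cyclic rearrangement of the
  alternating sum (`alternation_polyFormDeriv`) makes the result vanish.
* Cartan's formula, `alternatizeUncurryFin_iterContract`: for a closed form `ω` and constant vector
  fields `e_0, …, e_k`, the exterior derivative of `ι_{e_0} ⋯ ι_{e_k} ω` is the alternating sum of
  the derivatives in the direction `e_i` of the contractions that omit `e_i`. With `e_i = ∂/∂t_i`
  this is `sum_deriv_betaRep`, the coordinate form of the identity.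

`β_k` is defined at each point by the chart and the trivialization around that very point. That it
is a smooth form which may be computed in one fixed chart and trivialization (`chartRep_beta`) is
gauge invariance: under a change of trivialization the local connection form becomes
`Ad(g⁻¹) a + g⁻¹ dg` (`exists_pullForm_transition`), its curvature is transformed by `Ad(g⁻¹)`
(`curvForm_gauge`), and `p` does not change. A constant factor of the gauge transformation is
split off, so that only group elements near `1`, covered by the chart `oneChart` of `G`, have to be
differentiated; the group-theoretic input is the Maurer–Cartan equation in that chart.

Directional derivatives on `𝒜` exist in the `C^∞` topology because `β_k(A + tζ)` is a polynomial in
`t`: by Lagrange interpolation it is a combination of finitely many smooth forms with coefficients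
depending on `t` (`exists_hasDirDeriv_smul_beta`). They are therefore computed pointwise
(`dirDeriv_apply`).

For `k = r`, each of the `r` factors `F` of `p(F)` vanishes on pairs of vertical vectors, hence
`β_{r+1} = 0` (`betaRep_eq_zero`) and `d_𝒜 β_r = 0`.
-/

noncomputable section

namespace ConnForms

/-! ### Contractions and polarized forms -/

section Algebra

variable {W L : Type*} [AddCommGroup W] [Module ℝ W] [AddCommGroup L] [Module ℝ L]

theorem polyForm_apply {r : ℕ} (p : MultilinearMap ℝ (fun _ : Fin r => L) ℝ)
    (Φ : W →ₗ[ℝ] W →ₗ[ℝ] L) (v : Fin (r * 2) → W) :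
    polyForm p Φ v = ((2 : ℝ) ^ r)⁻¹ * ∑ σ : Equiv.Perm (Fin r × Fin 2),
      ((Equiv.Perm.sign σ : ℤ) : ℝ) *
        p fun i => Φ (v (finProdFinEquiv (σ (i, 0)))) (v (finProdFinEquiv (σ (i, 1)))) := by
  simp only [polyForm, AlternatingMap.smul_apply, AlternatingMap.domDomCongr_apply,
    MultilinearMap.alternatization_apply, smul_eq_mul]
  congr 1
  refine Finset.sum_congr rfl fun σ _ => ?_
  rw [Units.smul_def, zsmul_eq_mul]
  rfl

/-- `polyForm p Φ` sees its arguments only through the pairings `Φ (v i) (v j)`, and these only up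
to a transformation that preserves `p`. -/
theorem polyForm_congr {W' L' : Type*} [AddCommGroup W'] [Module ℝ W'] [AddCommGroup L']
    [Module ℝ L'] {r : ℕ} {p : MultilinearMap ℝ (fun _ : Fin r => L) ℝ}
    {p' : MultilinearMap ℝ (fun _ : Fin r => L') ℝ} {Φ : W →ₗ[ℝ] W →ₗ[ℝ] L}
    {Φ' : W' →ₗ[ℝ] W' →ₗ[ℝ] L'} {v : Fin (r * 2) → W} {v' : Fin (r * 2) → W'} (T : L → L')
    (hT : ∀ x : Fin r → L, p' (fun i => T (x i)) = p x)
    (h : ∀ i j, Φ' (v' i) (v' j) = T (Φ (v i) (v j))) :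
    polyForm p' Φ' v' = polyForm p Φ v := by
  rw [polyForm_apply, polyForm_apply]
  simp only [h, hT]

/-- The position of each argument of an iterated contraction: the contracting vectors occupy the
first `k` slots, in reverse order. -/
def contractIdx (m : ℕ) : (k : ℕ) → Fin (m + k) → Fin k ⊕ Fin m
  | 0 => Sum.inr
  | k + 1 => Fin.cons (Sum.inl (Fin.last k)) fun i => Sum.map Fin.castSucc id (contractIdx m k i)

theorem contractIdx_injective (m k : ℕ) : Function.Injective (contractIdx m k) := by
  induction k with
  | zero => exact Sum.inr_injective
  | succ k ih =>
    refine Fin.cons_injective_iff.2 ⟨?_, ?_⟩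
    · rintro ⟨i, hi⟩
      rcases h : contractIdx m k i with a | b <;> simp [h] at hi
    · exact (Function.Injective.sumMap (Fin.castSucc_injective k) Function.injective_id).comp ih

/-- `contractIdx` as a bijection. -/
def contractEquiv (m k : ℕ) : Fin (m + k) ≃ Fin k ⊕ Fin m :=
  Equiv.ofBijective (contractIdx m k)
    ((Fintype.bijective_iff_injective_and_card _).2
      ⟨contractIdx_injective m k, by simp [add_comm]⟩)

theorem iterContract_apply (m k : ℕ) (ξ : Fin k → W) (θ : W [⋀^Fin (m + k)]→ₗ[ℝ] ℝ)
    (v : Fin m → W) :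
    iterContract m k ξ θ v = θ fun i => Sum.elim ξ v (contractEquiv m k i) := by
  induction k with
  | zero => rfl
  | succ k ih =>
    rw [iterContract, ih, AlternatingMap.curryLeft_apply_apply]
    congr 1
    funext i
    refine Fin.cases ?_ (fun i => ?_) i
    · rfl
    · change Sum.elim _ v (contractIdx m k i) =
        Sum.elim ξ v (Sum.map Fin.castSucc id (contractIdx m k i))
      rcases contractIdx m k i with a | b <;> rfl

theorem iterContract_add (m k : ℕ) (e : Fin k → W) (θ θ' : W [⋀^Fin (m + k)]→ₗ[ℝ] ℝ) :
    iterContract m k e (θ + θ') = iterContract m k e θ + iterContract m k e θ' := by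
  ext v
  simp [iterContract_apply]

theorem iterContract_smul (m k : ℕ) (e : Fin k → W) (c : ℝ) (θ : W [⋀^Fin (m + k)]→ₗ[ℝ] ℝ) :
    iterContract m k e (c • θ) = c • iterContract m k e θ := by
  ext v
  simp [iterContract_apply]

/-- The iterated contraction as a linear map in the form. -/
def iterContractLM (m k : ℕ) (e : Fin k → W) :
    (W [⋀^Fin (m + k)]→ₗ[ℝ] ℝ) →ₗ[ℝ] (W [⋀^Fin m]→ₗ[ℝ] ℝ) where
  toFun := iterContract m k e
  map_add' := iterContract_add m k e
  map_smul' c θ := iterContract_smul m k e c θ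

/-- Algebraic form of Cartan's formula `d ι_x = D_x - ι_x d` for a constant vector field `x`; the
linear map `T` stands for the derivative of a form at a point. -/
theorem alternatizeUncurryFin_curryLeft_comp {n : ℕ} (T : W →ₗ[ℝ] W [⋀^Fin (n + 1)]→ₗ[ℝ] ℝ)
    (x : W) :
    AlternatingMap.alternatizeUncurryFin
        ((AlternatingMap.curryLeftLinearMap (R := ℝ) (M := W) (N := ℝ)).flip x ∘ₗ T) =
      T x - (AlternatingMap.alternatizeUncurryFin T).curryLeft x := by
  ext v
  simp only [AlternatingMap.sub_apply, AlternatingMap.curryLeft_apply_apply,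
    AlternatingMap.alternatizeUncurryFin_apply, Fin.sum_univ_succ (n := n + 1)]
  have h0 : Fin.removeNth 0 (Matrix.vecCons x v) = v := rfl
  have hs : ∀ i : Fin (n + 1), Fin.removeNth i.succ (Matrix.vecCons x v) =
      Matrix.vecCons x (i.removeNth v) := by
    intro i
    funext j
    refine Fin.cases ?_ (fun j => ?_) j <;> simp [Fin.removeNth]
  simp [h0, hs, pow_succ]

/-- Transport of an alternating map along an equality of degrees. -/
def castDeg {n n' : ℕ} (h : n = n') (θ : W [⋀^Fin n]→ₗ[ℝ] ℝ) : W [⋀^Fin n']→ₗ[ℝ] ℝ :=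
  θ.domDomCongr (finCongr h)

theorem castDeg_sub {n n' : ℕ} (h : n = n') (θ θ' : W [⋀^Fin n]→ₗ[ℝ] ℝ) :
    castDeg h (θ - θ') = castDeg h θ - castDeg h θ' := by
  subst h; rfl

theorem curryLeft_castDeg {n n' : ℕ} (h : n + 1 = n' + 1) (θ : W [⋀^Fin (n + 1)]→ₗ[ℝ] ℝ) (x : W) :
    (castDeg h θ).curryLeft x = castDeg (Nat.succ_injective h) (θ.curryLeft x) := by
  obtain rfl : n = n' := Nat.succ_injective h
  rfl

/-- Iterated Cartan formula: `d ι_{e 0} ⋯ ι_{e k}` in terms of the derivatives in the directions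
`e i` and of `d`, for constant vector fields `e i`. -/
theorem alternatizeUncurryFin_iterContract (m k : ℕ) (e : Fin (k + 1) → W)
    (T : W →ₗ[ℝ] W [⋀^Fin (m + (k + 1))]→ₗ[ℝ] ℝ) :
    AlternatingMap.alternatizeUncurryFin (iterContractLM m (k + 1) e ∘ₗ T) =
      ∑ i : Fin (k + 1), (-1 : ℝ) ^ (i : ℕ) •
        iterContract (m + 1) k (fun l => e (i.succAbove l))
          (castDeg (by omega) (T (e i))) +
      (-1 : ℝ) ^ (k + 1) • iterContract (m + 1) (k + 1) e
        (castDeg (by omega) (AlternatingMap.alternatizeUncurryFin T)) := by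
  induction k with
  | zero =>
    have h := alternatizeUncurryFin_curryLeft_comp (n := m) T (e 0)
    rw [Fin.sum_univ_one]
    change AlternatingMap.alternatizeUncurryFin _ = _ at h
    have e1 : iterContractLM m (0 + 1) e ∘ₗ T =
      (AlternatingMap.curryLeftLinearMap (R := ℝ) (M := W) (N := ℝ)).flip (e 0) ∘ₗ T := rfl
    rw [e1, h]
    ext v
    have h1 : (castDeg (by omega) (AlternatingMap.alternatizeUncurryFin T)).curryLeft (e 0) =
        (AlternatingMap.alternatizeUncurryFin T).curryLeft (e 0) :=
      curryLeft_castDeg (n := m + 1) (n' := m + 1) rfl _ _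
    simp only [AlternatingMap.sub_apply, AlternatingMap.add_apply, AlternatingMap.smul_apply,
      iterContract, Fin.last_zero, h1]
    simp [sub_eq_add_neg]
    rfl
  | succ k ih =>
    set T' : W →ₗ[ℝ] W [⋀^Fin (m + (k + 1))]→ₗ[ℝ] ℝ :=
      (AlternatingMap.curryLeftLinearMap (R := ℝ) (M := W) (N := ℝ)).flip (e (Fin.last (k + 1))) ∘ₗ
        T with hT'
    have e1 : iterContractLM m (k + 1 + 1) e ∘ₗ T =
      iterContractLM m (k + 1) (fun i => e i.castSucc) ∘ₗ T' := rfl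
    have hd : AlternatingMap.alternatizeUncurryFin T' =
        T (e (Fin.last (k + 1))) -
          (AlternatingMap.alternatizeUncurryFin T).curryLeft (e (Fin.last (k + 1))) :=
      alternatizeUncurryFin_curryLeft_comp (n := m + (k + 1)) T _
    rw [e1, ih, hd, Fin.sum_univ_castSucc (n := k + 1)]
    refine Eq.trans ?_ (add_assoc _ _ _).symm
    congr 1
    · refine Finset.sum_congr rfl fun i _ => ?_
      have hlast : i.castSucc.succAbove (Fin.last k) = Fin.last (k + 1) := by
        rw [Fin.succAbove_of_le_castSucc _ _ (Fin.castSucc_le_castSucc_iff.2 (Fin.le_last i)),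
          Fin.succ_last]
      rw [Fin.val_castSucc]
      congr 1
      rw [iterContract, curryLeft_castDeg (n := m + (k + 1)) (n' := m + 1 + k)]
      simp only [Fin.castSucc_succAbove_castSucc, hlast]
      rfl
    · have e2 : iterContract (m + 1) (k + 1 + 1) e
          (castDeg (by omega) (AlternatingMap.alternatizeUncurryFin T)) =
          iterContract (m + 1) (k + 1) (fun i => e i.castSucc) (castDeg (by omega)
            ((AlternatingMap.alternatizeUncurryFin T).curryLeft (e (Fin.last (k + 1))))) := by
        rw [iterContract]
        congr 1
        exact curryLeft_castDeg (n := m + (k + 1) + 1) (n' := m + 1 + (k + 1)) _ _ _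
      rw [e2, castDeg_sub]
      have e3 : ∀ θ θ' : W [⋀^Fin (m + 1 + (k + 1))]→ₗ[ℝ] ℝ,
          iterContract (m + 1) (k + 1) (fun i => e i.castSucc) (θ - θ') =
          iterContract (m + 1) (k + 1) (fun i => e i.castSucc) θ -
          iterContract (m + 1) (k + 1) (fun i => e i.castSucc) θ' :=
        fun θ θ' => map_sub (iterContractLM (m + 1) (k + 1) fun i => e i.castSucc) θ θ'
      rw [e3]
      ext v
      simp only [AlternatingMap.sub_apply, AlternatingMap.add_apply, AlternatingMap.smul_apply,
        Fin.val_last, Fin.succAbove_last, pow_succ, smul_eq_mul]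
      ring

end Algebra

/-! ### Alternation over one more argument -/

section Alternation

variable {X : Type*}

/-- Splitting an alternating sum over the permutations of `Fin (n + 1)` by the image of `0`. -/
theorem sum_perm_fin_succ {n : ℕ} (g : (Fin (n + 1) → X) → ℝ) (v : Fin (n + 1) → X) :
    ∑ τ : Equiv.Perm (Fin (n + 1)), ((Equiv.Perm.sign τ : ℤ) : ℝ) * g (v ∘ τ) =
      ∑ i : Fin (n + 1), (-1 : ℝ) ^ (i : ℕ) * ∑ σ : Equiv.Perm (Fin n),
        ((Equiv.Perm.sign σ : ℤ) : ℝ) * g (Fin.cons (v i) (i.removeNth v ∘ σ)) := by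
  simp only [Finset.mul_sum]
  rw [← Fintype.sum_prod_type' (f := fun (i : Fin (n + 1)) (σ : Equiv.Perm (Fin n)) =>
    (-1 : ℝ) ^ (i : ℕ) * (((Equiv.Perm.sign σ : ℤ) : ℝ) *
      g (Fin.cons (v i) (i.removeNth v ∘ σ))))]
  symm
  -- `F (i, σ)` sends `0` to `i` and `j + 1` to `i.succAbove (σ j)`
  let F : Fin (n + 1) × Equiv.Perm (Fin n) → Equiv.Perm (Fin (n + 1)) := fun q =>
    q.1.cycleRange⁻¹ * Equiv.Perm.decomposeFin.symm (0, q.2)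
  have hF0 : ∀ q, F q 0 = q.1 := fun q => by
    simp only [F, Equiv.Perm.mul_apply, Equiv.Perm.decomposeFin_symm_apply_zero]
    exact Fin.cycleRange_symm_zero q.1
  have hFs : ∀ q (j : Fin n), F q j.succ = q.1.succAbove (q.2 j) := fun q j => by
    simp only [F, Equiv.Perm.mul_apply, Equiv.Perm.decomposeFin_symm_apply_succ,
      Equiv.swap_self, Equiv.refl_apply]
    exact Fin.cycleRange_symm_succ q.1 (q.2 j)
  have hinj : Function.Injective F := by
    rintro ⟨i, σ⟩ ⟨i', σ'⟩ h
    have h0 : i = i' := by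
      have := hF0 (i, σ)
      rw [h, hF0] at this
      exact this.symm
    subst h0
    have h1 : σ = σ' := by
      ext j : 1
      have := hFs (i, σ) j
      rw [h, hFs] at this
      exact (Fin.succAbove_right_injective this).symm
    rw [h1]
  have hbij : Function.Bijective F := by
    refine (Fintype.bijective_iff_injective_and_card _).2 ⟨hinj, ?_⟩
    simp [Fintype.card_perm, Nat.factorial_succ]
  refine Fintype.sum_bijective F hbij _ _ ?_
  rintro ⟨i, σ⟩
  have hs : Equiv.Perm.sign (F (i, σ)) = (-1) ^ (i : ℕ) * Equiv.Perm.sign σ := by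
    simp [F, Fin.sign_cycleRange]
  have hv : v ∘ F (i, σ) = Fin.cons (v i) (i.removeNth v ∘ σ) := by
    funext j
    refine Fin.cases ?_ (fun j => ?_) j
    · simp [hF0]
    · simp [hFs, Fin.removeNth]
  rw [hs, hv]
  push_cast
  ring

/-- An alternating sum vanishes if the summand is annihilated by the cyclic sum over an even
permutation of order three. -/
theorem sum_perm_eq_zero_of_cyclic {N : ℕ} (g : (Fin N → X) → ℝ) (c : Equiv.Perm (Fin N))
    (hc : Equiv.Perm.sign c = 1) (hg : ∀ x, g x + g (x ∘ c) + g (x ∘ c ∘ c) = 0)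
    (v : Fin N → X) :
    ∑ τ : Equiv.Perm (Fin N), ((Equiv.Perm.sign τ : ℤ) : ℝ) * g (v ∘ τ) = 0 := by
  have h1 : ∀ d : Equiv.Perm (Fin N), Equiv.Perm.sign d = 1 →
      ∑ τ : Equiv.Perm (Fin N), ((Equiv.Perm.sign τ : ℤ) : ℝ) * g (v ∘ τ ∘ d) =
      ∑ τ : Equiv.Perm (Fin N), ((Equiv.Perm.sign τ : ℤ) : ℝ) * g (v ∘ τ) := by
    intro d hd
    refine Fintype.sum_equiv (Equiv.mulRight d) _ _ fun τ => ?_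
    simp only [Equiv.coe_mulRight, Equiv.Perm.sign_mul, hd, mul_one, Equiv.Perm.coe_mul]
  have h2 := h1 c hc
  have h3 := h1 (c * c) (by simp [hc])
  have h4 : ∑ τ : Equiv.Perm (Fin N), ((Equiv.Perm.sign τ : ℤ) : ℝ) *
      (g (v ∘ τ) + g (v ∘ τ ∘ c) + g (v ∘ τ ∘ c ∘ c)) = 0 :=
    Finset.sum_eq_zero fun τ _ => mul_eq_zero_of_right _ (hg (v ∘ τ))
  simp only [mul_add, Finset.sum_add_distrib] at h4
  rw [Equiv.Perm.coe_mul] at h3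
  linarith

variable {N L : Type*} [AddCommGroup L] [Module ℝ L]

/-- The derivative of `polyForm p Φ` in a direction in which `Φ` has derivative `Φ'`. -/
def polyFormDeriv {r : ℕ} (p : MultilinearMap ℝ (fun _ : Fin r => L) ℝ) (Φ Φ' : N → N → L)
    (v : Fin (r * 2) → N) : ℝ :=
  ((2 : ℝ) ^ r)⁻¹ * ∑ σ : Equiv.Perm (Fin r × Fin 2), ((Equiv.Perm.sign σ : ℤ) : ℝ) *
    ∑ l, p (Function.update
      (fun i => Φ (v (finProdFinEquiv (σ (i, 0)))) (v (finProdFinEquiv (σ (i, 1))))) l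
      (Φ' (v (finProdFinEquiv (σ (l, 0)))) (v (finProdFinEquiv (σ (l, 1))))))

/-- If the covariant derivative `Ψ` of `Φ` satisfies the Bianchi identity, the alternation of the
derivative of `polyForm p Φ` vanishes. -/
theorem alternation_polyFormDeriv {r : ℕ} (p : MultilinearMap ℝ (fun _ : Fin r => L) ℝ)
    (Φ : N → N → L) (Ψ : N → N → N → L)
    (hΨ : ∀ u v w, Ψ u v w + Ψ v w u + Ψ w u v = 0) (v : Fin (r * 2 + 1) → N) :
    ∑ i : Fin (r * 2 + 1), (-1 : ℝ) ^ (i : ℕ) * polyFormDeriv p Φ (Ψ (v i)) (i.removeNth v) =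
      0 := by
  classical
  let g : Fin r → (Fin (r * 2 + 1) → N) → ℝ := fun l x =>
    p (Function.update
      (fun i => Φ (x (finProdFinEquiv (i, 0)).succ) (x (finProdFinEquiv (i, 1)).succ)) l
      (Ψ (x 0) (x (finProdFinEquiv (l, 0)).succ) (x (finProdFinEquiv (l, 1)).succ)))
  have h1 : ∀ u (w : Fin (r * 2) → N), polyFormDeriv p Φ (Ψ u) w =
      ((2 : ℝ) ^ r)⁻¹ * ∑ l, ∑ σ : Equiv.Perm (Fin (r * 2)), ((Equiv.Perm.sign σ : ℤ) : ℝ) *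
        g l (Fin.cons u (w ∘ σ)) := by
    intro u w
    rw [polyFormDeriv, Finset.sum_comm]
    congr 1
    refine Fintype.sum_equiv finProdFinEquiv.permCongr _ _ fun σ => ?_
    rw [Equiv.Perm.sign_permCongr, Finset.mul_sum]
    refine Finset.sum_congr rfl fun l _ => ?_
    simp [g]
  have h2 : ∀ l, ∑ τ : Equiv.Perm (Fin (r * 2 + 1)),
      ((Equiv.Perm.sign τ : ℤ) : ℝ) * g l (v ∘ τ) = 0 := by
    intro l
    set a : Fin (r * 2 + 1) := (finProdFinEquiv (l, (0 : Fin 2))).succ with ha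
    set b : Fin (r * 2 + 1) := (finProdFinEquiv (l, (1 : Fin 2))).succ with hb
    have hab : a ≠ b := by simp [ha, hb]
    have ha0 : a ≠ 0 := Fin.succ_ne_zero _
    have hb0 : b ≠ 0 := Fin.succ_ne_zero _
    -- the 3-cycle `0 ↦ a ↦ b ↦ 0`
    let c : Equiv.Perm (Fin (r * 2 + 1)) := Equiv.swap 0 a * Equiv.swap a b
    have hc0 : c 0 = a := by
      simp [c, Equiv.swap_apply_of_ne_of_ne ha0.symm hb0.symm]
    have hca : c a = b := by
      simp [c, Equiv.swap_apply_of_ne_of_ne hb0 hab.symm]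
    have hcb : c b = 0 := by simp [c]
    have hcx : ∀ x, x ≠ 0 → x ≠ a → x ≠ b → c x = x := fun x h0 h1 h2 => by
      simp [c, Equiv.swap_apply_of_ne_of_ne h1 h2, Equiv.swap_apply_of_ne_of_ne h0 h1]
    refine sum_perm_eq_zero_of_cyclic (g l) c ?_ ?_ v
    · simp [c, Equiv.Perm.sign_swap ha0.symm, Equiv.Perm.sign_swap hab]
    · intro x
      have hupd : ∀ d : Equiv.Perm (Fin (r * 2 + 1)),
          (∀ y, y ≠ 0 → y ≠ a → y ≠ b → d y = y) → g l (x ∘ d) = p (Function.update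
            (fun i => Φ (x (finProdFinEquiv (i, 0)).succ) (x (finProdFinEquiv (i, 1)).succ)) l
            (Ψ (x (d 0)) (x (d a)) (x (d b)))) := by
        intro d hd
        simp only [g]
        congr 1
        funext i
        by_cases hi : i = l
        · subst hi; simp [ha, hb]
        · have hne : ∀ s s' : Fin 2, (finProdFinEquiv (i, s)).succ ≠
              (finProdFinEquiv (l, s')).succ :=
            fun s s' h => hi
              (Prod.mk.inj (finProdFinEquiv.injective (Fin.succ_injective _ h))).1
          simp only [Function.update_of_ne hi, Function.comp]
          rw [hd _ (Fin.succ_ne_zero _) (hne 0 0) (hne 0 1),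
            hd _ (Fin.succ_ne_zero _) (hne 1 0) (hne 1 1)]
      have e0 := hupd 1 (fun _ _ _ _ => rfl)
      have e1 := hupd c hcx
      have e2 := hupd (c * c) (fun y h0 h1 h2 => by simp [hcx y h0 h1 h2])
      have e0' : g l x = g l (x ∘ (1 : Equiv.Perm (Fin (r * 2 + 1)))) := rfl
      rw [Equiv.Perm.coe_mul] at e2
      rw [e0', e0, e1, e2, ← p.map_update_add, ← p.map_update_add]
      simp only [Function.comp, hc0, hca, hcb, Equiv.Perm.coe_one, id]
      rw [hΨ, ← zero_smul ℝ (0 : L), p.map_update_smul, zero_smul]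
  simp only [h1]
  have h3 : ∀ l, ∑ i : Fin (r * 2 + 1), (-1 : ℝ) ^ (i : ℕ) * ∑ σ : Equiv.Perm (Fin (r * 2)),
      ((Equiv.Perm.sign σ : ℤ) : ℝ) * g l (Fin.cons (v i) (i.removeNth v ∘ σ)) = 0 := fun l => by
    rw [← sum_perm_fin_succ, h2]
  calc _ = ((2 : ℝ) ^ r)⁻¹ * ∑ l, ∑ i : Fin (r * 2 + 1), (-1 : ℝ) ^ (i : ℕ) *
        ∑ σ : Equiv.Perm (Fin (r * 2)), ((Equiv.Perm.sign σ : ℤ) : ℝ) *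
          g l (Fin.cons (v i) (i.removeNth v ∘ σ)) := by
        rw [Finset.sum_comm, Finset.mul_sum]
        refine Finset.sum_congr rfl fun i _ => ?_
        rw [← Finset.mul_sum]
        ring
    _ = 0 := by simp [h3]

end Alternation

/-! ### Derivatives of maps between manifolds, read in the model spaces -/

theorem two_le_infty : (2 : WithTop ℕ∞) ≤ ∞ :=
  WithTop.coe_le_coe.2 (le_top : (2 : ℕ∞) ≤ ⊤)

theorem one_add_one_le_infty : (1 + 1 : WithTop ℕ∞) ≤ ∞ :=
  WithTop.coe_le_coe.2 (le_top : (1 + 1 : ℕ∞) ≤ ⊤)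

section ModelDerivative

variable {E : Type*} [NormedAddCommGroup E] [NormedSpace ℝ E]
  {E' : Type*} [NormedAddCommGroup E'] [NormedSpace ℝ E']
  {E'' : Type*} [NormedAddCommGroup E''] [NormedSpace ℝ E'']
  {M : Type*} [TopologicalSpace M] [ChartedSpace E M]
  {M' : Type*} [TopologicalSpace M'] [ChartedSpace E' M']
  {M'' : Type*} [TopologicalSpace M''] [ChartedSpace E'' M'']

variable (E E') in
/-- `mfderiv` as a map between the model spaces, which are by definition the tangent spaces. The
type does not depend on the base point, so that base points can be rewritten. -/
def mD (f : M → M') (x : M) : E →L[ℝ] E' := mfderiv 𝓘(ℝ, E) 𝓘(ℝ, E') f x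

theorem mD_comp {g : M' → M''} {f : M → M'} {x : M}
    (hg : MDifferentiableAt 𝓘(ℝ, E') 𝓘(ℝ, E'') g (f x))
    (hf : MDifferentiableAt 𝓘(ℝ, E) 𝓘(ℝ, E') f x) :
    mD E E'' (fun z => g (f z)) x = (mD E' E'' g (f x)).comp (mD E E' f x) :=
  mfderiv_comp x hg hf

theorem mD_congr {f g : M → M'} {x : M} (h : f =ᶠ[𝓝 x] g) : mD E E' f x = mD E E' g x :=
  h.mfderiv_eq

theorem mD_eq_fderiv (f : E → E') (x : E) : mD E E' f x = fderiv ℝ f x := mfderiv_eq_fderiv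

section Chart

variable [IsManifold 𝓘(ℝ, E) 1 M]

theorem mdifferentiableAt_chart {x₀ x : M} (hx : x ∈ (chartAt E x₀).source) :
    MDifferentiableAt 𝓘(ℝ, E) 𝓘(ℝ, E) (chartAt E x₀) x :=
  mdifferentiableAt_atlas (chart_mem_atlas E x₀) hx

theorem mdifferentiableAt_chart_symm {x₀ : M} {y : E} (hy : y ∈ (chartAt E x₀).target) :
    MDifferentiableAt 𝓘(ℝ, E) 𝓘(ℝ, E) (chartAt E x₀).symm y :=
  mdifferentiableAt_atlas_symm (chart_mem_atlas E x₀) hy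

theorem mD_chart_comp_symm {x₀ : M} {y : E} (hy : y ∈ (chartAt E x₀).target) :
    (mD E E (chartAt E x₀) ((chartAt E x₀).symm y)).comp (mD E E (chartAt E x₀).symm y) =
      ContinuousLinearMap.id ℝ E :=
  (mdifferentiable_chart (I := 𝓘(ℝ, E)) x₀).comp_symm_deriv hy

theorem mD_symm_comp_chart {x₀ x : M} (hx : x ∈ (chartAt E x₀).source) :
    (mD E E (chartAt E x₀).symm (chartAt E x₀ x)).comp (mD E E (chartAt E x₀) x) =
      ContinuousLinearMap.id ℝ E :=
  (mdifferentiable_chart (I := 𝓘(ℝ, E)) x₀).symm_comp_deriv hx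

theorem mD_chart_self (x : M) : mD E E (chartAt E x) x = ContinuousLinearMap.id ℝ E := by
  have h := mfderiv_extChartAt_self (I := 𝓘(ℝ, E)) (x := x)
  simpa only [extChartAt, OpenPartialHomeomorph.extend, modelWithCornersSelf_partialEquiv,
    PartialEquiv.trans_refl] using! h

theorem mD_chart_symm_self (x : M) :
    mD E E (chartAt E x).symm (chartAt E x x) = ContinuousLinearMap.id ℝ E := by
  have h := mD_symm_comp_chart (mem_chart_source E x)
  rwa [mD_chart_self, ContinuousLinearMap.comp_id] at h

end Chart

end ModelDerivative

/-! ### The multiplication of a Lie group in the chart around `1` -/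

section LieGroupChart

variable {EG : Type*} [NormedAddCommGroup EG]
  {G : Type*} [TopologicalSpace G] [ChartedSpace EG G] [Group G]

variable (EG G) in
/-- The chart of a Lie group around `1`. -/
abbrev oneChart : OpenPartialHomeomorph G EG := chartAt EG (1 : G)

variable (EG G) in
/-- The coordinates of `1` in the chart around it. -/
abbrev oneCoord : EG := oneChart EG G 1

variable (G) in
/-- The multiplication in the chart around `1`. -/
def mulChart (z w : EG) : EG := oneChart EG G ((oneChart EG G).symm z * (oneChart EG G).symm w)

theorem oneChart_symm_oneCoord : (oneChart EG G).symm (oneCoord EG G) = 1 :=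
  (oneChart EG G).left_inv (mem_chart_source EG 1)

theorem oneCoord_mem_target : oneCoord EG G ∈ (oneChart EG G).target :=
  mem_chart_target EG (1 : G)

theorem eventually_mem_target : ∀ᶠ z in 𝓝 (oneCoord EG G), z ∈ (oneChart EG G).target :=
  (oneChart EG G).open_target.mem_nhds oneCoord_mem_target

theorem tendsto_oneChart_symm : Tendsto (oneChart EG G).symm (𝓝 (oneCoord EG G)) (𝓝 1) := by
  have h := ((oneChart EG G).continuousAt_symm oneCoord_mem_target).tendsto
  rwa [oneChart_symm_oneCoord] at h

theorem mulChart_one_right {z : EG} (hz : z ∈ (oneChart EG G).target) :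
    mulChart G z (oneCoord EG G) = z := by
  rw [mulChart, oneChart_symm_oneCoord, mul_one, (oneChart EG G).right_inv hz]

theorem mulChart_one_left {z : EG} (hz : z ∈ (oneChart EG G).target) :
    mulChart G (oneCoord EG G) z = z := by
  rw [mulChart, oneChart_symm_oneCoord, one_mul, (oneChart EG G).right_inv hz]

variable [NormedSpace ℝ EG]

variable (G) in
/-- The left-invariant vector fields in the chart around `1`: `leftField G z x` is the value at `z`
of the field generated by `x`. -/
def leftField (z : EG) : EG →L[ℝ] EG := fderiv ℝ (fun w => mulChart G z w) (oneCoord EG G)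

variable (G) in
/-- The right-invariant vector fields in the chart around `1`. -/
def rightField (z : EG) : EG →L[ℝ] EG := fderiv ℝ (fun w => mulChart G w z) (oneCoord EG G)

theorem leftField_one : leftField G (oneCoord EG G) = ContinuousLinearMap.id ℝ EG := by
  have h : (fun w => mulChart G (oneCoord EG G) w) =ᶠ[𝓝 (oneCoord EG G)] id := by
    filter_upwards [eventually_mem_target (G := G)] with w hw using mulChart_one_left hw
  rw [leftField, h.fderiv_eq, fderiv_id]

theorem rightField_one : rightField G (oneCoord EG G) = ContinuousLinearMap.id ℝ EG := by
  have h : (fun w => mulChart G w (oneCoord EG G)) =ᶠ[𝓝 (oneCoord EG G)] id := by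
    filter_upwards [eventually_mem_target (G := G)] with w hw using mulChart_one_right hw
  rw [rightField, h.fderiv_eq, fderiv_id]

variable [LieGroup 𝓘(ℝ, EG) ∞ G]

theorem contMDiffAt_oneChart {g : G} (hg : g ∈ (oneChart EG G).source) :
    ContMDiffAt 𝓘(ℝ, EG) 𝓘(ℝ, EG) ∞ (oneChart EG G) g :=
  contMDiffAt_of_mem_maximalAtlas (IsManifold.chart_mem_maximalAtlas (1 : G)) hg

theorem contMDiffAt_oneChart_symm {z : EG} (hz : z ∈ (oneChart EG G).target) :
    ContMDiffAt 𝓘(ℝ, EG) 𝓘(ℝ, EG) ∞ (oneChart EG G).symm z :=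
  contMDiffAt_symm_of_mem_maximalAtlas (IsManifold.chart_mem_maximalAtlas (1 : G)) hz

theorem contDiffAt_mulChart {q : EG × EG} (h1 : q.1 ∈ (oneChart EG G).target)
    (h2 : q.2 ∈ (oneChart EG G).target)
    (h : (oneChart EG G).symm q.1 * (oneChart EG G).symm q.2 ∈ (oneChart EG G).source) :
    ContDiffAt ℝ ∞ (fun q : EG × EG => mulChart G q.1 q.2) q := by
  rw [← contMDiffAt_iff_contDiffAt]
  have e1 : ContMDiffAt 𝓘(ℝ, EG × EG) 𝓘(ℝ, EG) ∞
      (fun q : EG × EG => (oneChart EG G).symm q.1) q :=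
    (contMDiffAt_oneChart_symm h1).comp q contDiff_fst.contMDiff.contMDiffAt
  have e2 : ContMDiffAt 𝓘(ℝ, EG × EG) 𝓘(ℝ, EG) ∞
      (fun q : EG × EG => (oneChart EG G).symm q.2) q :=
    (contMDiffAt_oneChart_symm h2).comp q contDiff_snd.contMDiff.contMDiffAt
  exact (contMDiffAt_oneChart h).comp q (e1.mul e2)

theorem contDiffAt_mulChart_one :
    ContDiffAt ℝ ∞ (fun q : EG × EG => mulChart G q.1 q.2) (oneCoord EG G, oneCoord EG G) := by
  refine contDiffAt_mulChart oneCoord_mem_target oneCoord_mem_target ?_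
  simp only [oneChart_symm_oneCoord, mul_one]
  exact mem_chart_source EG 1

theorem eventually_contDiffAt_mulChart :
    ∀ᶠ q in 𝓝 (oneCoord EG G, oneCoord EG G),
      ContDiffAt ℝ 2 (fun q : EG × EG => mulChart G q.1 q.2) q :=
  (contDiffAt_mulChart_one.of_le two_le_infty).eventually (by simp)

theorem eventually_leftField : ∀ᶠ z in 𝓝 (oneCoord EG G),
    HasFDerivAt (fun w => mulChart G z w) (leftField G z) (oneCoord EG G) ∧
    leftField G z = (fderiv ℝ (fun q : EG × EG => mulChart G q.1 q.2) (z, oneCoord EG G)).comp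
      (ContinuousLinearMap.inr ℝ EG EG) := by
  have hc : Tendsto (fun z : EG => (z, oneCoord EG G)) (𝓝 (oneCoord EG G))
      (𝓝 (oneCoord EG G, oneCoord EG G)) := by
    exact Continuous.tendsto' (by fun_prop) _ _ rfl
  filter_upwards [hc.eventually eventually_contDiffAt_mulChart] with z hz
  have h := (hz.differentiableAt (by norm_num)).hasFDerivAt.comp (oneCoord EG G)
    (hasFDerivAt_prodMk_right (𝕜 := ℝ) z (oneCoord EG G))
  have h' := h.fderiv
  exact ⟨h.differentiableAt.hasFDerivAt, h'⟩

theorem eventually_rightField : ∀ᶠ z in 𝓝 (oneCoord EG G),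
    HasFDerivAt (fun w => mulChart G w z) (rightField G z) (oneCoord EG G) ∧
    rightField G z = (fderiv ℝ (fun q : EG × EG => mulChart G q.1 q.2) (oneCoord EG G, z)).comp
      (ContinuousLinearMap.inl ℝ EG EG) := by
  have hc : Tendsto (fun z : EG => (oneCoord EG G, z)) (𝓝 (oneCoord EG G))
      (𝓝 (oneCoord EG G, oneCoord EG G)) := by
    exact Continuous.tendsto' (by fun_prop) _ _ rfl
  filter_upwards [hc.eventually eventually_contDiffAt_mulChart] with z hz
  have h := (hz.differentiableAt (by norm_num)).hasFDerivAt.comp (oneCoord EG G)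
    (hasFDerivAt_prodMk_left (𝕜 := ℝ) (oneCoord EG G) z)
  have h' := h.fderiv
  exact ⟨h.differentiableAt.hasFDerivAt, h'⟩

theorem hasFDerivAt_fderiv_mulChart :
    HasFDerivAt (fderiv ℝ (fun q : EG × EG => mulChart G q.1 q.2))
      (fderiv ℝ (fderiv ℝ (fun q : EG × EG => mulChart G q.1 q.2)) (oneCoord EG G, oneCoord EG G))
      (oneCoord EG G, oneCoord EG G) := by
  have h : ContDiffAt ℝ 1 (fderiv ℝ (fun q : EG × EG => mulChart G q.1 q.2))
      (oneCoord EG G, oneCoord EG G) :=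
    contDiffAt_mulChart_one.fderiv_right one_add_one_le_infty
  exact (h.differentiableAt (by norm_num)).hasFDerivAt

theorem hasFDerivAt_leftField : HasFDerivAt (leftField (EG := EG) G)
    (((ContinuousLinearMap.compL ℝ EG (EG × EG) EG).flip (ContinuousLinearMap.inr ℝ EG EG)).comp
      ((fderiv ℝ (fderiv ℝ (fun q : EG × EG => mulChart G q.1 q.2))
        (oneCoord EG G, oneCoord EG G)).comp (ContinuousLinearMap.inl ℝ EG EG)))
    (oneCoord EG G) := by
  have h1 := (hasFDerivAt_fderiv_mulChart (G := G)).comp (oneCoord EG G)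
    (hasFDerivAt_prodMk_left (𝕜 := ℝ) (oneCoord EG G) (oneCoord EG G))
  have h2 := (((ContinuousLinearMap.compL ℝ EG (EG × EG) EG).flip
    (ContinuousLinearMap.inr ℝ EG EG)).hasFDerivAt).comp (oneCoord EG G) h1
  refine h2.congr_of_eventuallyEq ?_
  filter_upwards [eventually_leftField (G := G)] with z hz using hz.2

theorem hasFDerivAt_rightField : HasFDerivAt (rightField (EG := EG) G)
    (((ContinuousLinearMap.compL ℝ EG (EG × EG) EG).flip (ContinuousLinearMap.inl ℝ EG EG)).comp
      ((fderiv ℝ (fderiv ℝ (fun q : EG × EG => mulChart G q.1 q.2))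
        (oneCoord EG G, oneCoord EG G)).comp (ContinuousLinearMap.inr ℝ EG EG)))
    (oneCoord EG G) := by
  have h1 := (hasFDerivAt_fderiv_mulChart (G := G)).comp (oneCoord EG G)
    (hasFDerivAt_prodMk_right (𝕜 := ℝ) (oneCoord EG G) (oneCoord EG G))
  have h2 := (((ContinuousLinearMap.compL ℝ EG (EG × EG) EG).flip
    (ContinuousLinearMap.inl ℝ EG EG)).hasFDerivAt).comp (oneCoord EG G) h1
  refine h2.congr_of_eventuallyEq ?_
  filter_upwards [eventually_rightField (G := G)] with z hz using hz.2

/-- Both sides are the mixed second derivative of the multiplication at `(1, 1)`. -/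
theorem fderiv_rightField_apply (a b : EG) :
    fderiv ℝ (rightField G) (oneCoord EG G) a b = fderiv ℝ (leftField G) (oneCoord EG G) b a := by
  rw [hasFDerivAt_rightField.fderiv, hasFDerivAt_leftField.fderiv]
  have hs : IsSymmSndFDerivAt ℝ (fun q : EG × EG => mulChart G q.1 q.2)
      (oneCoord EG G, oneCoord EG G) :=
    (contDiffAt_mulChart_one (G := G)).isSymmSndFDerivAt (by
      rw [minSmoothness_of_isRCLikeNormedField]; exact two_le_infty)
  exact hs (0, a) (b, 0)

end LieGroupChart

/-! ### The adjoint representation and the Maurer–Cartan form -/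

section AdjointAction

variable {EG : Type*} [NormedAddCommGroup EG] [NormedSpace ℝ EG]
  {G : Type*} [TopologicalSpace G] [ChartedSpace EG G] [Group G] [LieGroup 𝓘(ℝ, EG) ∞ G]

variable (EG G) in
theorem isManifold_one : IsManifold 𝓘(ℝ, EG) 1 G :=
  IsManifold.of_le (n := ∞) (one_add_one_le_infty.trans' (by norm_num))

theorem contMDiff_conj (g : G) :
    ContMDiff 𝓘(ℝ, EG) 𝓘(ℝ, EG) ∞ (fun h : G => g * h * g⁻¹) :=
  (contMDiff_mul_left (I := 𝓘(ℝ, EG)) (a := g)).mul contMDiff_const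

/-- The differential at `1` of a map fixing `1`, in the chart around `1`. -/
theorem hasFDerivAt_oneChart_comp {f : G → G} (h1 : f 1 = 1)
    (hf : MDifferentiableAt 𝓘(ℝ, EG) 𝓘(ℝ, EG) f 1) :
    HasFDerivAt (fun z => oneChart EG G (f ((oneChart EG G).symm z))) (mD EG EG f 1)
      (oneCoord EG G) := by
  have := isManifold_one EG G
  have hs : MDifferentiableAt 𝓘(ℝ, EG) 𝓘(ℝ, EG) (oneChart EG G).symm (oneCoord EG G) :=
    mdifferentiableAt_chart_symm oneCoord_mem_target
  have hf' : MDifferentiableAt 𝓘(ℝ, EG) 𝓘(ℝ, EG) f ((oneChart EG G).symm (oneCoord EG G)) := by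
    rwa [oneChart_symm_oneCoord]
  have hfs : MDifferentiableAt 𝓘(ℝ, EG) 𝓘(ℝ, EG) (fun z => f ((oneChart EG G).symm z))
      (oneCoord EG G) := hf'.comp (oneCoord EG G) hs
  have hc : MDifferentiableAt 𝓘(ℝ, EG) 𝓘(ℝ, EG) (oneChart EG G)
      (f ((oneChart EG G).symm (oneCoord EG G))) := by
    rw [oneChart_symm_oneCoord, h1]
    exact mdifferentiableAt_chart (mem_chart_source EG 1)
  have hd : MDifferentiableAt 𝓘(ℝ, EG) 𝓘(ℝ, EG)
      (fun z => oneChart EG G (f ((oneChart EG G).symm z))) (oneCoord EG G) :=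
    hc.comp (oneCoord EG G) hfs
  have e := mD_comp (f := fun z => f ((oneChart EG G).symm z)) hc hfs
  rw [mD_comp hf' hs, oneChart_symm_oneCoord, h1, mD_chart_self, mD_chart_symm_self,
    ContinuousLinearMap.id_comp, ContinuousLinearMap.comp_id, mD_eq_fderiv] at e
  rw [← e]
  exact hd.differentiableAt.hasFDerivAt

theorem hasFDerivAt_conjChart (g : G) :
    HasFDerivAt (fun z => oneChart EG G (g * (oneChart EG G).symm z * g⁻¹)) (Ad g)
      (oneCoord EG G) :=
  hasFDerivAt_oneChart_comp (by simp)
    ((contMDiff_conj g).mdifferentiable (by simp) 1)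

theorem eventually_conj_mem_source (g : G) :
    ∀ᶠ z in 𝓝 (oneCoord EG G), g * (oneChart EG G).symm z * g⁻¹ ∈ (oneChart EG G).source := by
  have hc : Tendsto (fun h : G => g * h * g⁻¹) (𝓝 1) (𝓝 1) :=
    (contMDiff_conj (EG := EG) g).continuous.tendsto' _ _ (by simp)
  exact (hc.comp tendsto_oneChart_symm).eventually
    ((oneChart EG G).open_source.mem_nhds (mem_chart_source EG 1))

/-- The adjoint action carries right-invariant to left-invariant vector fields. -/
theorem eventually_leftField_Ad : ∀ᶠ z in 𝓝 (oneCoord EG G),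
    (leftField G z).comp (Ad ((oneChart EG G).symm z)⁻¹) = rightField G z := by
  filter_upwards [eventually_leftField (G := G), eventually_rightField (G := G),
    eventually_mem_target (G := G)] with z hL hR hz
  set g : G := (oneChart EG G).symm z with hg
  have hC := hasFDerivAt_conjChart (EG := EG) g⁻¹
  have hC1 : oneChart EG G (g⁻¹ * (oneChart EG G).symm (oneCoord EG G) * g⁻¹⁻¹) =
      oneCoord EG G := by
    rw [oneChart_symm_oneCoord]; simp
  have h1 : HasFDerivAt (fun w => mulChart G z w) (leftField G z)
      (oneChart EG G (g⁻¹ * (oneChart EG G).symm (oneCoord EG G) * g⁻¹⁻¹)) := by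
    rw [hC1]; exact hL.1
  have h2 := h1.comp (oneCoord EG G) hC
  refine h2.unique (hR.1.congr_of_eventuallyEq ?_)
  filter_upwards [eventually_conj_mem_source (EG := EG) g⁻¹] with w hw
  simp only [Function.comp, mulChart]
  rw [(oneChart EG G).left_inv hw, ← hg]
  congr 1
  group

variable (G) in
/-- The left Maurer–Cartan form in the chart around `1`. -/
def maurerCartan (z : EG) : EG →L[ℝ] EG :=
  fderiv ℝ (fun w => oneChart EG G (((oneChart EG G).symm z)⁻¹ * (oneChart EG G).symm w)) z

theorem hasFDerivAt_maurerCartan {z : EG} (hz : z ∈ (oneChart EG G).target) :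
    HasFDerivAt (fun w => oneChart EG G (((oneChart EG G).symm z)⁻¹ * (oneChart EG G).symm w))
      (maurerCartan G z) z := by
  have h : ContMDiffAt 𝓘(ℝ, EG) 𝓘(ℝ, EG) ∞
      (fun w => oneChart EG G (((oneChart EG G).symm z)⁻¹ * (oneChart EG G).symm w)) z := by
    refine (contMDiffAt_oneChart (g := ((oneChart EG G).symm z)⁻¹ * (oneChart EG G).symm z) ?_).comp
      z (contMDiffAt_const.mul (contMDiffAt_oneChart_symm hz))
    rw [inv_mul_cancel]; exact mem_chart_source EG 1
  exact (h.contDiffAt.differentiableAt (by simp)).hasFDerivAt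

theorem eventually_leftField_maurerCartan : ∀ᶠ z in 𝓝 (oneCoord EG G),
    (leftField G z).comp (maurerCartan G z) = ContinuousLinearMap.id ℝ EG := by
  filter_upwards [eventually_leftField (G := G), eventually_mem_target (G := G)] with z hL hz
  have hC := hasFDerivAt_maurerCartan hz
  have hC1 : oneChart EG G (((oneChart EG G).symm z)⁻¹ * (oneChart EG G).symm z) =
      oneCoord EG G := by
    rw [inv_mul_cancel]
  have h1 : HasFDerivAt (fun w => mulChart G z w) (leftField G z)
      (oneChart EG G (((oneChart EG G).symm z)⁻¹ * (oneChart EG G).symm z)) := by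
    rw [hC1]; exact hL.1
  have h2 := h1.comp z hC
  refine h2.unique ((hasFDerivAt_id z).congr_of_eventuallyEq ?_)
  have hcont : Tendsto (fun w => ((oneChart EG G).symm z)⁻¹ * (oneChart EG G).symm w) (𝓝 z)
      (𝓝 1) := by
    have := ((contMDiff_mul_left (I := 𝓘(ℝ, EG)) (n := ∞)
      (a := ((oneChart EG G).symm z)⁻¹)).continuous.continuousAt.comp
      ((oneChart EG G).continuousAt_symm hz)).tendsto
    simpa [Function.comp_def] using this
  filter_upwards [hcont.eventually
      ((oneChart EG G).open_source.mem_nhds (mem_chart_source EG 1)),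
    (oneChart EG G).open_target.mem_nhds hz] with w hw hw'
  simp only [Function.comp, mulChart, id]
  rw [(oneChart EG G).left_inv hw, mul_inv_cancel_left, (oneChart EG G).right_inv hw']

theorem maurerCartan_one : maurerCartan G (oneCoord EG G) = ContinuousLinearMap.id ℝ EG := by
  have h := (eventually_leftField_maurerCartan (EG := EG) (G := G)).self_of_nhds
  rwa [leftField_one, ContinuousLinearMap.id_comp] at h

theorem Ad_inv_one : Ad ((oneChart EG G).symm (oneCoord EG G))⁻¹ =
    ContinuousLinearMap.id ℝ EG := by
  have h := (eventually_leftField_Ad (EG := EG) (G := G)).self_of_nhds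
  rwa [leftField_one, ContinuousLinearMap.id_comp, rightField_one] at h

variable [FiniteDimensional ℝ EG]

/-- The bracket of `𝔤` is the bracket at `1` of the left-invariant vector fields, computed in the
chart around `1`. -/
theorem lieBr_eq_leftField (a b : EG) :
    lieBr G a b = fderiv ℝ (leftField G) (oneCoord EG G) a b -
      fderiv ℝ (leftField G) (oneCoord EG G) b a := by
  have := isManifold_one EG G
  let V : EG → EG → EG := fun x => VectorField.mpullbackWithin 𝓘(ℝ, EG) 𝓘(ℝ, EG)
    (extChartAt 𝓘(ℝ, EG) (1 : G)).symm
    (mulInvariantVectorField (I := 𝓘(ℝ, EG)) (G := G) x) (range 𝓘(ℝ, EG))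
  have hV : ∀ x : EG, V x =ᶠ[𝓝 (oneCoord EG G)] fun z => leftField G z x := by
    intro x
    filter_upwards [eventually_leftField (G := G), eventually_mem_target (G := G)] with z hL hz
    set g : G := (oneChart EG G).symm z with hg
    have e0 : V x z =
      (mD EG EG (oneChart EG G).symm z).inverse (mD EG EG (fun h : G => g * h) 1 x) := by
      simp only [V, VectorField.mpullbackWithin_apply, modelWithCornersSelf_coe, range_id,
        mfderivWithin_univ]
      rfl
    have einv : (mD EG EG (oneChart EG G).symm z).inverse = mD EG EG (oneChart EG G) g := by
      refine ContinuousLinearMap.inverse_eq ?_ ?_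
      · have := mD_symm_comp_chart ((oneChart EG G).map_target hz)
        rwa [(oneChart EG G).right_inv hz] at this
      · exact mD_chart_comp_symm hz
    have hs : MDifferentiableAt 𝓘(ℝ, EG) 𝓘(ℝ, EG) (oneChart EG G).symm (oneCoord EG G) :=
      mdifferentiableAt_chart_symm oneCoord_mem_target
    have hm : MDifferentiableAt 𝓘(ℝ, EG) 𝓘(ℝ, EG) (fun h : G => g * h)
        ((oneChart EG G).symm (oneCoord EG G)) :=
      (contMDiff_mul_left (I := 𝓘(ℝ, EG)) (n := ∞) (a := g)).mdifferentiable (by simp) _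
    have hms : MDifferentiableAt 𝓘(ℝ, EG) 𝓘(ℝ, EG) (fun w => g * (oneChart EG G).symm w)
        (oneCoord EG G) := hm.comp (oneCoord EG G) hs
    have hc : MDifferentiableAt 𝓘(ℝ, EG) 𝓘(ℝ, EG) (oneChart EG G)
        (g * (oneChart EG G).symm (oneCoord EG G)) := by
      rw [oneChart_symm_oneCoord, mul_one]
      exact mdifferentiableAt_chart ((oneChart EG G).map_target hz)
    have e := mD_comp (f := fun w => g * (oneChart EG G).symm w) hc hms
    rw [mD_comp hm hs, oneChart_symm_oneCoord, mul_one, mD_chart_symm_self,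
      ContinuousLinearMap.comp_id, mD_eq_fderiv] at e
    rw [e0, einv]
    have e' : leftField G z = (mD EG EG (oneChart EG G) g).comp
      (mD EG EG (fun h : G => g * h) 1) := e
    rw [e']
    rfl
  have hd : ∀ x y : EG, fderiv ℝ (fun z => leftField G z x) (oneCoord EG G) y =
      fderiv ℝ (leftField G) (oneCoord EG G) y x := by
    intro x y
    have h := (hasFDerivAt_leftField (EG := EG) (G := G)).differentiableAt.hasFDerivAt.clm_apply
      (hasFDerivAt_const x (oneCoord EG G))
    rw [h.fderiv]
    simp
  have hb : lieBr G a b = (mD EG EG (extChartAt 𝓘(ℝ, EG) (1 : G)) 1).inverse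
      (VectorField.lieBracketWithin ℝ (V a) (V b)
        ((extChartAt 𝓘(ℝ, EG) (1 : G)).symm ⁻¹' univ ∩ range 𝓘(ℝ, EG))
        (extChartAt 𝓘(ℝ, EG) (1 : G) 1)) := rfl
  have hid : mD EG EG (extChartAt 𝓘(ℝ, EG) (1 : G)) 1 = ContinuousLinearMap.id ℝ EG :=
    mD_chart_self (1 : G)
  have hset : (extChartAt 𝓘(ℝ, EG) (1 : G)).symm ⁻¹' univ ∩ range 𝓘(ℝ, EG) = univ := by
    simp
  have hpt : extChartAt 𝓘(ℝ, EG) (1 : G) 1 = oneCoord EG G := rfl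
  rw [hb, hid, ContinuousLinearMap.inverse_id, ContinuousLinearMap.id_apply, hset,
    VectorField.lieBracketWithin_univ, hpt,
    Filter.EventuallyEq.lieBracket_vectorField_eq (hV a) (hV b), VectorField.lieBracket, hd, hd,
    leftField_one]
  simp

theorem lieBr_swap (a b : EG) : lieBr G a b = -lieBr G b a := by
  rw [lieBr_eq_leftField, lieBr_eq_leftField]; abel

theorem lieBr_jacobi (a b c : EG) :
    lieBr G a (lieBr G b c) + lieBr G b (lieBr G c a) + lieBr G c (lieBr G a b) = 0 := by
  have : LieGroup 𝓘(ℝ, EG) (minSmoothness ℝ 3) G :=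
    LieGroup.of_le (n := ∞) (by
      rw [minSmoothness_of_isRCLikeNormedField]
      exact WithTop.coe_le_coe.2 le_top)
  have : CompleteSpace EG := FiniteDimensional.complete ℝ EG
  exact lie_jacobi (L := GroupLieAlgebra 𝓘(ℝ, EG) G) a b c

/-- The adjoint representation acts by Lie algebra automorphisms. -/
theorem lieBr_Ad (g : G) (a b : EG) : lieBr G (Ad g a) (Ad g b) = Ad g (lieBr G a b) := by
  set c : EG → EG := fun z => oneChart EG G (g * (oneChart EG G).symm z * g⁻¹) with hc
  have hc1 : c (oneCoord EG G) = oneCoord EG G := by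
    simp only [hc]; rw [oneChart_symm_oneCoord]; simp
  have hcd : HasFDerivAt c (Ad g) (oneCoord EG G) := hasFDerivAt_conjChart g
  have hcs : ContDiffAt ℝ ∞ c (oneCoord EG G) := by
    rw [← contMDiffAt_iff_contDiffAt]
    refine (contMDiffAt_oneChart (g := g * (oneChart EG G).symm (oneCoord EG G) * g⁻¹) ?_).comp
      (oneCoord EG G) ((contMDiff_conj g).contMDiffAt.comp (oneCoord EG G)
        (contMDiffAt_oneChart_symm oneCoord_mem_target))
    rw [oneChart_symm_oneCoord]
    simp
  have hcev : ∀ᶠ z in 𝓝 (oneCoord EG G), DifferentiableAt ℝ c z :=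
    ((hcs.of_le two_le_infty).eventually (by simp)).mono fun z hz =>
      hz.differentiableAt (by norm_num)
  have hct : Tendsto c (𝓝 (oneCoord EG G)) (𝓝 (oneCoord EG G)) := by
    have := hcs.continuousAt.tendsto
    rwa [hc1] at this
  have hmulev : ∀ᶠ z in 𝓝 (oneCoord EG G), ∀ᶠ w in 𝓝 (oneCoord EG G),
      c (mulChart G z w) = mulChart G (c z) (c w) := by
    have hm : Tendsto (fun q : EG × EG => (oneChart EG G).symm q.1 * (oneChart EG G).symm q.2)
        (𝓝 (oneCoord EG G, oneCoord EG G)) (𝓝 1) := by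
      have h1 : Tendsto (fun q : G × G => q.1 * q.2) (𝓝 1 ×ˢ 𝓝 1) (𝓝 1) := by
        have := (contMDiff_mul 𝓘(ℝ, EG) ∞ (G := G)).continuous.tendsto (1, 1)
        rwa [nhds_prod_eq, mul_one] at this
      rw [nhds_prod_eq]
      exact h1.comp (tendsto_oneChart_symm.prodMap tendsto_oneChart_symm)
    have hsrc := hm.eventually ((oneChart EG G).open_source.mem_nhds (mem_chart_source EG 1))
    have hz := eventually_conj_mem_source (EG := EG) g
    filter_upwards [hsrc.curry_nhds, hz] with z h1 h2
    filter_upwards [h1, hz] with w h3 h4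
    simp only [hc, mulChart]
    rw [(oneChart EG G).left_inv h3, (oneChart EG G).left_inv h2, (oneChart EG G).left_inv h4]
    congr 1
    group
  -- conjugation carries left-invariant vector fields to left-invariant vector fields; the
  -- derivative of this relation at `1` is antisymmetrized below, which removes `D²c`
  have key : ∀ᶠ z in 𝓝 (oneCoord EG G),
      (fderiv ℝ c z).comp (leftField G z) = (leftField G (c z)).comp (Ad g) := by
    filter_upwards [hmulev, hcev, eventually_leftField (G := G),
      hct.eventually (eventually_leftField (G := G)), eventually_mem_target (G := G)]
      with z h1 h2 h3 h4 h5
    have h2' : HasFDerivAt c (fderiv ℝ c z) (mulChart G z (oneCoord EG G)) := by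
      rw [mulChart_one_right h5]; exact h2.hasFDerivAt
    have h4' : HasFDerivAt (fun w => mulChart G (c z) w) (leftField G (c z))
        (c (oneCoord EG G)) := by
      rw [hc1]; exact h4.1
    exact (h2'.comp (oneCoord EG G) h3.1).unique
      ((h4'.comp (oneCoord EG G) hcd).congr_of_eventuallyEq h1)
  have hL := (hasFDerivAt_leftField (EG := EG) (G := G)).differentiableAt.hasFDerivAt
  have hL' : HasFDerivAt (leftField G) (fderiv ℝ (leftField G) (oneCoord EG G))
      (c (oneCoord EG G)) := by rwa [hc1]
  have hD : ContDiffAt ℝ 1 (fderiv ℝ c) (oneCoord EG G) := hcs.fderiv_right one_add_one_le_infty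
  have hD' := (hD.differentiableAt (by norm_num)).hasFDerivAt
  have hsymm : IsSymmSndFDerivAt ℝ c (oneCoord EG G) := hcs.isSymmSndFDerivAt (by
    rw [minSmoothness_of_isRCLikeNormedField]; exact two_le_infty)
  have e1 := (hD'.clm_comp hL)
  have e2 := ((hL'.comp (oneCoord EG G) hcd).clm_comp
    (hasFDerivAt_const (Ad g) (oneCoord EG G)))
  have e3 := e1.unique (e2.congr_of_eventuallyEq key)
  have e4 : ∀ u v : EG, fderiv ℝ (fderiv ℝ c) (oneCoord EG G) u v +
      Ad g (fderiv ℝ (leftField G) (oneCoord EG G) u v) =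
      fderiv ℝ (leftField G) (oneCoord EG G) (Ad g u) (Ad g v) := by
    intro u v
    have := congrArg (fun T : EG →L[ℝ] EG →L[ℝ] EG => T u v) e3
    simp [leftField_one, hcd.fderiv] at this
    rw [← this]; abel
  rw [lieBr_eq_leftField, lieBr_eq_leftField, ← e4, ← e4, hsymm a b, map_sub]
  abel

/-- The field of inverses of `leftField`. -/
theorem differentiableAt_leftField_inverse :
    DifferentiableAt ℝ (fun z => Ring.inverse (leftField G z)) (oneCoord EG G) := by
  have : CompleteSpace EG := FiniteDimensional.complete ℝ EG
  have h : DifferentiableAt ℝ Ring.inverse (leftField G (oneCoord EG G)) := by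
    rw [leftField_one]
    exact (contDiffAt_ringInverse (n := 1) ℝ (1 : (EG →L[ℝ] EG)ˣ)).differentiableAt (by norm_num)
  exact h.comp (oneCoord EG G) (hasFDerivAt_leftField (G := G)).differentiableAt

theorem eventually_isUnit_leftField : ∀ᶠ z in 𝓝 (oneCoord EG G), IsUnit (leftField G z) := by
  have : CompleteSpace EG := FiniteDimensional.complete ℝ EG
  refine (hasFDerivAt_leftField (G := G)).continuousAt.eventually ?_
  rw [leftField_one]
  exact Units.isOpen.mem_nhds isUnit_one

theorem differentiableAt_of_leftField_comp {f h : EG → EG →L[ℝ] EG}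
    (hf : ∀ᶠ z in 𝓝 (oneCoord EG G), (leftField G z).comp (f z) = h z)
    (hh : DifferentiableAt ℝ h (oneCoord EG G)) : DifferentiableAt ℝ f (oneCoord EG G) := by
  refine (differentiableAt_leftField_inverse.clm_comp hh).congr_of_eventuallyEq ?_
  filter_upwards [hf, eventually_isUnit_leftField (G := G)] with z h1 h2
  rw [← h1]
  change f z = Ring.inverse (leftField G z) * (leftField G z * f z)
  rw [← mul_assoc, Ring.inverse_mul_cancel _ h2, one_mul]

theorem differentiableAt_Ad_inv :
    DifferentiableAt ℝ (fun z => Ad (EG := EG) ((oneChart EG G).symm z)⁻¹) (oneCoord EG G) :=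
  differentiableAt_of_leftField_comp eventually_leftField_Ad
    (hasFDerivAt_rightField (G := G)).differentiableAt

theorem differentiableAt_maurerCartan :
    DifferentiableAt ℝ (maurerCartan (EG := EG) G) (oneCoord EG G) :=
  differentiableAt_of_leftField_comp eventually_leftField_maurerCartan
    (differentiableAt_const _)

theorem fderiv_Ad_inv (b x : EG) :
    fderiv ℝ (fun z => Ad (EG := EG) ((oneChart EG G).symm z)⁻¹) (oneCoord EG G) b x =
      -lieBr G b x := by
  have hL := (hasFDerivAt_leftField (EG := EG) (G := G)).differentiableAt.hasFDerivAt
  have hR := (hasFDerivAt_rightField (EG := EG) (G := G)).differentiableAt.hasFDerivAt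
  have hA := (differentiableAt_Ad_inv (EG := EG) (G := G)).hasFDerivAt
  have e := (hL.clm_comp hA).unique (hR.congr_of_eventuallyEq eventually_leftField_Ad)
  have e' := congrArg (fun T : EG →L[ℝ] EG →L[ℝ] EG => T b x) e
  simp only [Ad_inv_one, leftField_one, fderiv_rightField_apply] at e'
  simp at e'
  rw [lieBr_eq_leftField, ← e']
  abel

/-- The Maurer–Cartan equation at `1`. -/
theorem fderiv_maurerCartan (b w : EG) :
    fderiv ℝ (maurerCartan G) (oneCoord EG G) b w - fderiv ℝ (maurerCartan G) (oneCoord EG G) w b =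
      -lieBr G b w := by
  have hL := (hasFDerivAt_leftField (EG := EG) (G := G)).differentiableAt.hasFDerivAt
  have hA := (differentiableAt_maurerCartan (EG := EG) (G := G)).hasFDerivAt
  have e := (hL.clm_comp hA).unique ((hasFDerivAt_const (ContinuousLinearMap.id ℝ EG)
    (oneCoord EG G)).congr_of_eventuallyEq eventually_leftField_maurerCartan)
  have e' : ∀ b x : EG, fderiv ℝ (maurerCartan G) (oneCoord EG G) b x =
      -fderiv ℝ (leftField G) (oneCoord EG G) b x := by
    intro b x
    have e' := congrArg (fun T : EG →L[ℝ] EG →L[ℝ] EG => T b x) e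
    simp [maurerCartan_one, leftField_one] at e'
    exact eq_neg_of_add_eq_zero_left e'
  rw [lieBr_eq_leftField, e', e']
  abel

end AdjointAction

/-! ### The Chern–Weil form of a Lie algebra valued 1-form is closed -/

section ChernWeil

variable {EG : Type*} [NormedAddCommGroup EG] [NormedSpace ℝ EG] [FiniteDimensional ℝ EG]

/-- Multilinear maps on a finite-dimensional space are continuous. -/
theorem multilinear_continuous {r : ℕ} (p : MultilinearMap ℝ (fun _ : Fin r => EG) ℝ) :
    Continuous p := by
  classical
  let b := Module.finBasis ℝ EG
  have key : ∀ v : Fin r → EG, p v = ∑ s : Fin r → Fin (Module.finrank ℝ EG),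
      (∏ i, b.repr (v i) (s i)) * p (fun i => b (s i)) := by
    intro v
    have h1 : v = fun i => ∑ j, b.repr (v i) j • b j := by
      funext i
      exact (b.sum_repr (v i)).symm
    conv_lhs => rw [h1]
    have h2 := p.map_sum (fun i j => b.repr (v i) j • b j)
    refine h2.trans (Finset.sum_congr rfl fun s _ => ?_)
    exact p.map_smul_univ (fun i => b.repr (v i) (s i)) (fun i => b (s i))
  have hc : ∀ j, Continuous fun v : EG => b.repr v j := fun j =>
    (b.coord j).continuous_of_finiteDimensional
  rw [show (p : (Fin r → EG) → ℝ) = _ from funext key]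
  exact continuous_finsetSum _ fun s _ =>
    (continuous_finsetProd _ fun i _ => (hc (s i)).comp (continuous_apply i)).mul continuous_const

/-- A multilinear map on a finite-dimensional space, as a continuous multilinear map. -/
def multilinearCont {r : ℕ} (p : MultilinearMap ℝ (fun _ : Fin r => EG) ℝ) :
    ContinuousMultilinearMap ℝ (fun _ : Fin r => EG) ℝ :=
  { p with cont := multilinear_continuous p }

theorem hasFDerivAt_multilinear {N : Type*} [NormedAddCommGroup N] [NormedSpace ℝ N] {r : ℕ}
    (p : MultilinearMap ℝ (fun _ : Fin r => EG) ℝ) {g : Fin r → N → EG} {g' : Fin r → N →L[ℝ] EG}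
    {z : N} (hg : ∀ i, HasFDerivAt (g i) (g' i) z) :
    ∃ L : N →L[ℝ] ℝ, HasFDerivAt (fun z => p fun i => g i z) L z ∧
      ∀ x, L x = ∑ l, p (Function.update (fun i => g i z) l (g' l x)) := by
  classical
  refine ⟨_, HasFDerivAt.multilinear_comp (f := multilinearCont p) hg, fun x => ?_⟩
  simp only [sum_apply]
  rfl

variable {G : Type*} [TopologicalSpace G] [ChartedSpace EG G] [Group G] [LieGroup 𝓘(ℝ, EG) ∞ G]

/-- The infinitesimal form of the invariance of `p` under the adjoint representation. -/
theorem IsInvariantPoly.sum_update_lieBr {r : ℕ} {p : MultilinearMap ℝ (fun _ : Fin r => EG) ℝ}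
    (hp : IsInvariantPoly G p) (b : EG) (x : Fin r → EG) :
    ∑ l, p (Function.update x l (lieBr G b (x l))) = 0 := by
  classical
  have hA := (differentiableAt_Ad_inv (EG := EG) (G := G)).hasFDerivAt
  obtain ⟨L, hL, hLx⟩ := hasFDerivAt_multilinear p (fun i => hA.clm_apply
    (hasFDerivAt_const (x i) (oneCoord EG G)))
  simp only [hp.inv] at hL
  have h0 : L = 0 := hL.unique (hasFDerivAt_const (p x) _)
  simp only [Ad_inv_one, ContinuousLinearMap.id_apply] at hLx
  have h1 := hLx b
  rw [h0] at h1
  simpa [fderiv_Ad_inv] using h1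

variable {N : Type*} [NormedAddCommGroup N] [NormedSpace ℝ N]

variable (G) in
/-- The curvature of an `EG`-valued 1-form with value `a` and derivative `D` at a point:
`(u, v) ↦ D u v - D v u + [a u, a v]`. -/
def curvForm (a : N →L[ℝ] EG) (D : N →L[ℝ] N →L[ℝ] EG) : N →ₗ[ℝ] N →ₗ[ℝ] EG :=
  LinearMap.mk₂ ℝ (fun u v => D u v - D v u + lieBr G (a u) (a v))
    (fun u u' v => by simp; abel)
    (fun t u v => by simp [smul_add, smul_sub])
    (fun u v v' => by simp; abel)
    (fun t u v => by simp [smul_add, smul_sub])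

theorem curvForm_apply (a : N →L[ℝ] EG) (D : N →L[ℝ] N →L[ℝ] EG) (u v : N) :
    curvForm G a D u v = D u v - D v u + lieBr G (a u) (a v) := rfl

variable (G) in
/-- The Lie bracket as a continuous bilinear map. -/
def lieBrL : EG →L[ℝ] EG →L[ℝ] EG :=
  LinearMap.toContinuousLinearMap (LinearMap.toContinuousLinearMap.toLinearMap ∘ₗ lieBr G)

theorem hasFDerivAt_polyForm {N' : Type*} [NormedAddCommGroup N'] [NormedSpace ℝ N'] {r : ℕ}
    (p : MultilinearMap ℝ (fun _ : Fin r => EG) ℝ) {Φ : N' → N →ₗ[ℝ] N →ₗ[ℝ] EG}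
    {Φ' : N → N → N' →L[ℝ] EG} {z : N'}
    (h : ∀ u w, HasFDerivAt (fun z => Φ z u w) (Φ' u w) z) (v : Fin (r * 2) → N) :
    DifferentiableAt ℝ (fun z => polyForm p (Φ z) v) z ∧
      ∀ x, fderiv ℝ (fun z => polyForm p (Φ z) v) z x =
        polyFormDeriv p (fun u w => Φ z u w) (fun u w => Φ' u w x) v := by
  choose L hL hLx using fun σ : Equiv.Perm (Fin r × Fin 2) => hasFDerivAt_multilinear p
    (fun i => h (v (finProdFinEquiv (σ (i, 0)))) (v (finProdFinEquiv (σ (i, 1)))))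
  have key := (HasFDerivAt.fun_sum (u := Finset.univ) fun σ _ =>
    (hL σ).const_mul ((Equiv.Perm.sign σ : ℤ) : ℝ)).const_mul ((2 : ℝ) ^ r)⁻¹
  simp only [← polyForm_apply] at key
  refine ⟨key.differentiableAt, fun x => ?_⟩
  rw [key.fderiv, polyFormDeriv]
  simp [hLx]

theorem hasFDerivAt_curvForm {α : N → N →L[ℝ] EG} {z : N} (hα : ContDiffAt ℝ 2 α z) (u w : N) :
    HasFDerivAt (fun z => curvForm G (α z) (fderiv ℝ α z) u w)
      ((((ContinuousLinearMap.apply ℝ EG w).comp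
          ((ContinuousLinearMap.apply ℝ (N →L[ℝ] EG) u).comp (fderiv ℝ (fderiv ℝ α) z))) -
        ((ContinuousLinearMap.apply ℝ EG u).comp
          ((ContinuousLinearMap.apply ℝ (N →L[ℝ] EG) w).comp (fderiv ℝ (fderiv ℝ α) z)))) +
        ((lieBrL G (α z u)).comp ((ContinuousLinearMap.apply ℝ EG w).comp (fderiv ℝ α z)) +
          ((lieBrL G).flip (α z w)).comp ((ContinuousLinearMap.apply ℝ EG u).comp (fderiv ℝ α z))))
      z := by
  have h1 : HasFDerivAt α (fderiv ℝ α z) z := (hα.differentiableAt (by norm_num)).hasFDerivAt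
  have h2 : HasFDerivAt (fderiv ℝ α) (fderiv ℝ (fderiv ℝ α) z) z :=
    ((hα.fderiv_right (m := 1) (by norm_num)).differentiableAt (by norm_num)).hasFDerivAt
  have ev : ∀ x : N, HasFDerivAt (fun z => α z x)
      ((ContinuousLinearMap.apply ℝ EG x).comp (fderiv ℝ α z)) z := fun x =>
    (ContinuousLinearMap.apply ℝ EG x).hasFDerivAt.comp z h1
  have ev2 : ∀ x y : N, HasFDerivAt (fun z => fderiv ℝ α z x y)
      ((ContinuousLinearMap.apply ℝ EG y).comp
        ((ContinuousLinearMap.apply ℝ (N →L[ℝ] EG) x).comp (fderiv ℝ (fderiv ℝ α) z))) z :=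
    fun x y => by
      have e : HasFDerivAt (fun z => fderiv ℝ α z x)
          ((ContinuousLinearMap.apply ℝ (N →L[ℝ] EG) x).comp (fderiv ℝ (fderiv ℝ α) z)) z :=
        HasFDerivAt.comp (g := fun T : N →L[ℝ] N →L[ℝ] EG => T x) z
          (ContinuousLinearMap.apply ℝ (N →L[ℝ] EG) x).hasFDerivAt h2
      exact (ContinuousLinearMap.apply ℝ EG y).hasFDerivAt.comp z e
  have hb : HasFDerivAt (fun z => lieBrL G (α z u) (α z w)) _ z :=
    (lieBrL G).hasFDerivAt_of_bilinear (ev u) (ev w)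
  exact ((ev2 u w).sub (ev2 w u)).add hb

/-- The Chern–Weil forms are closed: by invariance the derivative of `p (F, …, F)` may be computed
with the covariant derivative of the curvature `F`, whose cyclic sum vanishes by the Bianchi
identity. -/
theorem alternation_fderiv_polyForm_curvForm {r : ℕ}
    {p : MultilinearMap ℝ (fun _ : Fin r => EG) ℝ} (hp : IsInvariantPoly G p)
    {α : N → N →L[ℝ] EG} {z : N} (hα : ContDiffAt ℝ 2 α z) (v : Fin (r * 2 + 1) → N) :
    ∑ i : Fin (r * 2 + 1), (-1 : ℝ) ^ (i : ℕ) *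
      fderiv ℝ (fun z => polyForm p (curvForm G (α z) (fderiv ℝ α z)) (i.removeNth v)) z (v i) =
      0 := by
  set D := fderiv ℝ α z with hD
  set DD := fderiv ℝ (fderiv ℝ α) z with hDD
  have hsymm : ∀ u v, DD u v = DD v u := hα.isSymmSndFDerivAt (by
    rw [minSmoothness_of_isRCLikeNormedField])
  let Φ : N → N → EG := fun u w => curvForm G (α z) D u w
  let Φ' : N → N → N → EG := fun x u w => DD x u w - DD x w u +
    (lieBr G (α z u) (D x w) + lieBr G (D x u) (α z w))
  let Ψ : N → N → N → EG := fun x u w => Φ' x u w + lieBr G (α z x) (Φ u w)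
  have h1 : ∀ x (v : Fin (r * 2) → N),
      fderiv ℝ (fun z => polyForm p (curvForm G (α z) (fderiv ℝ α z)) v) z x =
        polyFormDeriv p Φ (Ψ x) v := by
    intro x v
    rw [(hasFDerivAt_polyForm p (hasFDerivAt_curvForm hα) v).2 x]
    simp only [polyFormDeriv]
    congr 1
    refine Finset.sum_congr rfl fun σ _ => ?_
    congr 1
    simp only [Ψ, p.map_update_add, Finset.sum_add_distrib]
    rw [show ∑ l, p (Function.update (fun i => Φ (v (finProdFinEquiv (σ (i, 0))))
      (v (finProdFinEquiv (σ (i, 1))))) l (lieBr G (α z x) (Φ (v (finProdFinEquiv (σ (l, 0))))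
      (v (finProdFinEquiv (σ (l, 1))))))) = 0 from hp.sum_update_lieBr (α z x)
        (fun i => Φ (v (finProdFinEquiv (σ (i, 0)))) (v (finProdFinEquiv (σ (i, 1))))), add_zero]
    rfl
  simp only [h1]
  refine alternation_polyFormDeriv p Φ Ψ (fun u v w => ?_) v
  simp only [Ψ, Φ', Φ, curvForm_apply, map_add, map_sub]
  rw [hsymm v u, hsymm w u, hsymm w v]
  rw [lieBr_swap (α z u) (D v w), lieBr_swap (α z u) (D w v), lieBr_swap (α z v) (D u w),
    lieBr_swap (α z v) (D w u), lieBr_swap (α z w) (D u v), lieBr_swap (α z w) (D v u)]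
  have hj := lieBr_jacobi (G := G) (α z u) (α z v) (α z w)
  rw [← hj]
  abel

end ChernWeil

/-! ### Curvature under changes of coordinates and gauge -/

section Gauge

variable {EG : Type*} [NormedAddCommGroup EG] [NormedSpace ℝ EG] [FiniteDimensional ℝ EG]
  {G : Type*} [TopologicalSpace G] [ChartedSpace EG G] [Group G] [LieGroup 𝓘(ℝ, EG) ∞ G]
  {E : Type*} [NormedAddCommGroup E] [NormedSpace ℝ E]

/-- Naturality of the curvature under pullback along `τ`. -/
theorem curvForm_pullback {a : E → E →L[ℝ] EG} {τ : E → E} {y : E} (hτ : ContDiffAt ℝ 2 τ y)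
    (ha : DifferentiableAt ℝ a (τ y)) :
    DifferentiableAt ℝ (fun z => (a (τ z)).comp (fderiv ℝ τ z)) y ∧ ∀ u v,
      curvForm G ((a (τ y)).comp (fderiv ℝ τ y))
          (fderiv ℝ (fun z => (a (τ z)).comp (fderiv ℝ τ z)) y) u v =
        curvForm G (a (τ y)) (fderiv ℝ a (τ y)) (fderiv ℝ τ y u) (fderiv ℝ τ y v) := by
  have h1 : HasFDerivAt τ (fderiv ℝ τ y) y := (hτ.differentiableAt (by norm_num)).hasFDerivAt
  have h2 : HasFDerivAt (fderiv ℝ τ) (fderiv ℝ (fderiv ℝ τ) y) y :=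
    ((hτ.fderiv_right (m := 1) (by norm_num)).differentiableAt (by norm_num)).hasFDerivAt
  have hsymm : IsSymmSndFDerivAt ℝ τ y := hτ.isSymmSndFDerivAt (by
    rw [minSmoothness_of_isRCLikeNormedField])
  have h3 := (ha.hasFDerivAt.comp y h1).clm_comp h2
  refine ⟨h3.differentiableAt, fun u v => ?_⟩
  have h4 : fderiv ℝ (fun z => (a (τ z)).comp (fderiv ℝ τ z)) y = _ := h3.fderiv
  rw [h4]
  simp only [curvForm_apply]
  simp [hsymm u v]

/-- The curvature at a point where the gauge transformation `oneChart⁻¹ ∘ ζ` takes the value `1`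
does not change. -/
theorem curvForm_gauge_one {a : E → E →L[ℝ] EG} {ζ : E → EG} {y : E} (hζ : ContDiffAt ℝ 2 ζ y)
    (h1 : ζ y = oneCoord EG G) (ha : DifferentiableAt ℝ a y) :
    DifferentiableAt ℝ (fun z => (Ad ((oneChart EG G).symm (ζ z))⁻¹).comp (a z) +
        (maurerCartan G (ζ z)).comp (fderiv ℝ ζ z)) y ∧ ∀ u v,
      curvForm G ((Ad ((oneChart EG G).symm (ζ y))⁻¹).comp (a y) +
          (maurerCartan G (ζ y)).comp (fderiv ℝ ζ y))
        (fderiv ℝ (fun z => (Ad ((oneChart EG G).symm (ζ z))⁻¹).comp (a z) +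
          (maurerCartan G (ζ z)).comp (fderiv ℝ ζ z)) y) u v =
        curvForm G (a y) (fderiv ℝ a y) u v := by
  have hζ1 : HasFDerivAt ζ (fderiv ℝ ζ y) y := (hζ.differentiableAt (by norm_num)).hasFDerivAt
  have hζ2 : HasFDerivAt (fderiv ℝ ζ) (fderiv ℝ (fderiv ℝ ζ) y) y :=
    ((hζ.fderiv_right (m := 1) (by norm_num)).differentiableAt (by norm_num)).hasFDerivAt
  have hsymm : IsSymmSndFDerivAt ℝ ζ y := hζ.isSymmSndFDerivAt (by
    rw [minSmoothness_of_isRCLikeNormedField])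
  have hA : HasFDerivAt (fun z => Ad (EG := EG) ((oneChart EG G).symm z)⁻¹)
      (fderiv ℝ (fun z => Ad (EG := EG) ((oneChart EG G).symm z)⁻¹) (oneCoord EG G)) (ζ y) := by
    rw [h1]; exact (differentiableAt_Ad_inv (EG := EG) (G := G)).hasFDerivAt
  have hM : HasFDerivAt (maurerCartan G) (fderiv ℝ (maurerCartan G) (oneCoord EG G)) (ζ y) := by
    rw [h1]; exact (differentiableAt_maurerCartan (EG := EG) (G := G)).hasFDerivAt
  have h3 := ((hA.comp y hζ1).clm_comp ha.hasFDerivAt).add ((hM.comp y hζ1).clm_comp hζ2)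
  refine ⟨h3.differentiableAt, fun u v => ?_⟩
  have h4 : fderiv ℝ (fun z => (Ad ((oneChart EG G).symm (ζ z))⁻¹).comp (a z) +
          (maurerCartan G (ζ z)).comp (fderiv ℝ ζ z)) y = _ := h3.fderiv
  rw [h4]
  simp only [curvForm_apply, Function.comp, h1, Ad_inv_one, maurerCartan_one]
  have hm := fderiv_maurerCartan (G := G) (fderiv ℝ ζ y u) (fderiv ℝ ζ y v)
  rw [sub_eq_iff_eq_add] at hm
  simp [hsymm u v, fderiv_Ad_inv, hm]
  rw [lieBr_swap (a y u) (fderiv ℝ ζ y v)]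
  abel

theorem curvForm_Ad (g : G) {a : E → E →L[ℝ] EG} {y : E} (ha : DifferentiableAt ℝ a y) :
    DifferentiableAt ℝ (fun z => (Ad g).comp (a z)) y ∧ ∀ u v,
      curvForm G ((Ad g).comp (a y)) (fderiv ℝ (fun z => (Ad g).comp (a z)) y) u v =
        Ad g (curvForm G (a y) (fderiv ℝ a y) u v) := by
  have h3 := (hasFDerivAt_const (Ad (EG := EG) g) y).clm_comp ha.hasFDerivAt
  refine ⟨h3.differentiableAt, fun u v => ?_⟩
  rw [h3.fderiv]
  simp only [curvForm_apply]
  simp [lieBr_Ad]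

/-- The effect on the curvature of a change of coordinates `τ` and of a gauge transformation
`z ↦ oneChart⁻¹ (ζ z) * g₀` with `oneChart⁻¹ (ζ y) = 1`. -/
theorem curvForm_gauge {a a' : E → E →L[ℝ] EG} {τ : E → E} {ζ : E → EG} {y : E} (g : G)
    (hτ : ContDiffAt ℝ 2 τ y) (hζ : ContDiffAt ℝ 2 ζ y) (h1 : ζ y = oneCoord EG G)
    (ha : DifferentiableAt ℝ a (τ y))
    (h : a' =ᶠ[𝓝 y] fun z => (Ad g).comp ((Ad ((oneChart EG G).symm (ζ z))⁻¹).comp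
      ((a (τ z)).comp (fderiv ℝ τ z)) + (maurerCartan G (ζ z)).comp (fderiv ℝ ζ z))) (u v : E) :
    curvForm G (a' y) (fderiv ℝ a' y) u v =
      Ad g (curvForm G (a (τ y)) (fderiv ℝ a (τ y)) (fderiv ℝ τ y u) (fderiv ℝ τ y v)) := by
  obtain ⟨d1, e1⟩ := curvForm_pullback (G := G) hτ ha
  obtain ⟨d2, e2⟩ := curvForm_gauge_one (G := G) hζ h1 d1
  obtain ⟨-, e3⟩ := curvForm_Ad (G := G) g d2
  rw [h.self_of_nhds, h.fderiv_eq, e3, e2, e1]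

end Gauge

/-! ### Connection forms in local trivializations -/

section LocalForms

variable {E : Type*} [NormedAddCommGroup E] [NormedSpace ℝ E]
  {EG : Type*} [NormedAddCommGroup EG] [NormedSpace ℝ EG]
  {EP : Type*} [NormedAddCommGroup EP] [NormedSpace ℝ EP]
  {M : Type*} [TopologicalSpace M] [ChartedSpace E M]
  {P : Type*} [TopologicalSpace P] [ChartedSpace EP P]

/-- The value of a form on `P`, read on the model space. -/
def formAt (θ : GForm EG EP P) (u : P) : EP →L[ℝ] EG := θ u

/-- The pullback under `s` of an `EG`-valued 1-form on `P`. -/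
def pullForm (s : E → P) (θ : GForm EG EP P) (y : E) : E →L[ℝ] EG :=
  (formAt θ (s y)).comp (mD E EP s y)

theorem pullForm_congr {s s' : E → P} (θ : GForm EG EP P) {y : E} (h : s =ᶠ[𝓝 y] s') :
    pullForm s θ y = pullForm s' θ y := by
  rw [pullForm, pullForm, mD_congr h, h.self_of_nhds]

theorem pullForm_comp {s : E → P} {τ : E → E} (θ : GForm EG EP P) {y : E}
    (hs : MDifferentiableAt 𝓘(ℝ, E) 𝓘(ℝ, EP) s (τ y)) (hτ : DifferentiableAt ℝ τ y) :
    pullForm (fun z => s (τ z)) θ y = (pullForm s θ (τ y)).comp (fderiv ℝ τ y) := by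
  rw [pullForm, mD_comp (f := τ) hs hτ.mdifferentiableAt, mD_eq_fderiv]
  rfl

theorem contDiffAt_pullForm [IsManifold 𝓘(ℝ, EP) ∞ P] {s : E → P} {θ : GForm EG EP P} {y : E}
    (hθ : IsSmoothGForm θ) (hs : ∀ᶠ z in 𝓝 y, ContMDiffAt 𝓘(ℝ, E) 𝓘(ℝ, EP) ∞ s z) :
    ContDiffAt ℝ ∞ (pullForm s θ) y := by
  have : IsManifold 𝓘(ℝ, EP) 1 P := IsManifold.of_le (n := ∞) (by simp)
  set φ := chartAt EP (s y) with hφ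
  have hsy := hs.self_of_nhds
  have hsrc : ∀ᶠ z in 𝓝 y, s z ∈ φ.source :=
    hsy.continuousAt.eventually (φ.open_source.mem_nhds (mem_chart_source EP (s y)))
  have hσ : ContDiffAt ℝ ∞ (fun z => φ (s z)) y := by
    rw [← contMDiffAt_iff_contDiffAt]
    exact (contMDiffAt_of_mem_maximalAtlas (IsManifold.chart_mem_maximalAtlas (s y))
      (mem_chart_source EP (s y))).comp y hsy
  have hg : ContDiffAt ℝ ∞ (gRep (s y) θ) (φ (s y)) :=
    (hθ (s y)).contDiffAt (φ.open_target.mem_nhds (mem_chart_target EP (s y)))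
  have hd : ContDiffAt ℝ ∞ (fderiv ℝ fun z => φ (s z)) y := hσ.fderiv_right (by simp)
  refine ((hg.comp y hσ).clm_comp hd).congr_of_eventuallyEq ?_
  filter_upwards [hsrc, hs] with z hz hsz
  have h1 : MDifferentiableAt 𝓘(ℝ, EP) 𝓘(ℝ, EP) φ (s z) := mdifferentiableAt_chart hz
  have h2 : MDifferentiableAt 𝓘(ℝ, E) 𝓘(ℝ, EP) s z := hsz.mdifferentiableAt (by simp)
  have e1 : fderiv ℝ (fun z => φ (s z)) z = (mD EP EP φ (s z)).comp (mD E EP s z) := by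
    rw [← mD_eq_fderiv, mD_comp h1 h2]
  have e2 : gRep (s y) θ (φ (s z)) =
      (formAt θ (s z)).comp (mD EP EP φ.symm (φ (s z))) :=
    congrArg (fun u => (formAt θ u).comp (mD EP EP φ.symm (φ (s z)))) (φ.left_inv hz)
  have e3 := mD_symm_comp_chart (M := P) hz
  simp only [Function.comp]
  rw [e1, e2, pullForm, ContinuousLinearMap.comp_assoc,
    ← ContinuousLinearMap.comp_assoc (mD EP EP φ.symm (φ (s z))), e3, ContinuousLinearMap.id_comp]

variable {G : Type*} [TopologicalSpace G] [ChartedSpace EG G] [Group G]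
  [MulAction Gᵐᵒᵖ P]

/-- `θ` takes the value `c • b` on the fundamental vector field of `b`: `c = 1` for connections and
`c = 0` for horizontal forms. -/
def HasVerticalFactor (G : Type*) [TopologicalSpace G] [ChartedSpace EG G] [Group G]
    [MulAction Gᵐᵒᵖ P] (θ : GForm EG EP P) (c : ℝ) : Prop :=
  ∀ (u : P) (b : EG), θ (op (1 : G) • u) (fundVec u b) = c • b

theorem Connection.hasVerticalFactor (A : Connection EG EP G P) :
    HasVerticalFactor G A.form 1 := fun u b => by rw [A.vertical, one_smul]

theorem AdForms.hasVerticalFactor (ξ : AdForms EG EP G P) :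
    HasVerticalFactor G ξ.1 0 := fun u b => by rw [ξ.2.2.2, zero_smul]

theorem mdifferentiable_act_right (B : PrincipalBundle E EG EP M G P) (u : P) :
    MDifferentiable 𝓘(ℝ, EG) 𝓘(ℝ, EP) (fun g : G => op g • u) :=
  (B.smooth_act.mdifferentiable (by simp)).comp
    ((mdifferentiable_const (c := u)).prodMk mdifferentiable_id)

theorem mdifferentiable_act_left (B : PrincipalBundle E EG EP M G P) (g : G) :
    MDifferentiable 𝓘(ℝ, EP) 𝓘(ℝ, EP) (fun u : P => op g • u) :=
  (B.smooth_act.mdifferentiable (by simp)).comp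
    (mdifferentiable_id.prodMk (mdifferentiable_const (c := g)))

/-- The local section of `P` given by the trivialization around `x₁`, in the chart around `x₀`. -/
def secAt (B : PrincipalBundle E EG EP M G P) (x₀ x₁ : M) (y : E) : P :=
  (B.triv x₁).toOpenPartialHomeomorph.symm ((chartAt E x₀).symm y, 1)

/-- The domain of `secAt B x₀ x₁`. -/
def secDom (B : PrincipalBundle E EG EP M G P) (x₀ x₁ : M) : Set E :=
  (chartAt E x₀).target ∩ (chartAt E x₀).symm ⁻¹' (B.triv x₁).baseSet

theorem isOpen_secDom (B : PrincipalBundle E EG EP M G P) (x₀ x₁ : M) :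
    IsOpen (secDom B x₀ x₁) :=
  (chartAt E x₀).isOpen_inter_preimage_symm (B.triv x₁).open_baseSet

theorem localExpr_eq_pullForm (B : PrincipalBundle E EG EP M G P) (x : M) (θ : GForm EG EP P) :
    localExpr B x θ = pullForm (secAt B x x) θ := rfl

theorem eventually_mem_secDom (B : PrincipalBundle E EG EP M G P) {x₀ x₁ : M} {y : E}
    (hy : y ∈ secDom B x₀ x₁) : ∀ᶠ z in 𝓝 y, z ∈ secDom B x₀ x₁ :=
  (isOpen_secDom B x₀ x₁).mem_nhds hy

theorem chart_mem_secDom (B : PrincipalBundle E EG EP M G P) (x : M) :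
    chartAt E x x ∈ secDom B x x := by
  refine ⟨mem_chart_target E x, ?_⟩
  rw [mem_preimage, (chartAt E x).left_inv (mem_chart_source E x)]
  exact B.mem_triv x

theorem mem_secDom_symm (B : PrincipalBundle E EG EP M G P) {x₀ : M} {y : E}
    (hy : y ∈ (chartAt E x₀).target) : y ∈ secDom B x₀ ((chartAt E x₀).symm y) :=
  ⟨hy, B.mem_triv _⟩

section

variable [IsManifold 𝓘(ℝ, E) ∞ M]

theorem contMDiffAt_secAt (B : PrincipalBundle E EG EP M G P) {x₀ x₁ : M} {y : E}
    (hy : y ∈ secDom B x₀ x₁) : ContMDiffAt 𝓘(ℝ, E) 𝓘(ℝ, EP) ∞ (secAt B x₀ x₁) y := by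
  have h1 : ContMDiffAt 𝓘(ℝ, E) 𝓘(ℝ, E) ∞ (chartAt E x₀).symm y :=
    contMDiffAt_symm_of_mem_maximalAtlas (IsManifold.chart_mem_maximalAtlas x₀) hy.1
  have h2 : ContMDiffAt (𝓘(ℝ, E).prod 𝓘(ℝ, EG)) 𝓘(ℝ, EP) ∞
      (B.triv x₁).toOpenPartialHomeomorph.symm ((chartAt E x₀).symm y, (1 : G)) :=
    (B.smooth_triv_symm x₁).contMDiffAt ((B.triv x₁).open_target.mem_nhds
      ((B.triv x₁).mem_target.2 hy.2))
  exact h2.comp y (h1.prodMk contMDiffAt_const)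

theorem contDiffAt_pullForm_secAt [IsManifold 𝓘(ℝ, EP) ∞ P] (B : PrincipalBundle E EG EP M G P)
    {x₀ x₁ : M} {y : E} (hy : y ∈ secDom B x₀ x₁) {θ : GForm EG EP P} (hθ : IsSmoothGForm θ) :
    ContDiffAt ℝ ∞ (pullForm (secAt B x₀ x₁) θ) y :=
  contDiffAt_pullForm hθ ((eventually_mem_secDom B hy).mono fun _ hz => contMDiffAt_secAt B hz)

end

/-- The product rule for the action of `G` on `P`. -/
theorem mD_act (B : PrincipalBundle E EG EP M G P) {q : E → P} {k : E → G} {y : E}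
    (hq : MDifferentiableAt 𝓘(ℝ, E) 𝓘(ℝ, EP) q y) (hk : MDifferentiableAt 𝓘(ℝ, E) 𝓘(ℝ, EG) k y)
    (v : E) :
    mD E EP (fun z => op (k z) • q z) y v =
      mD EP EP (fun u => op (k y) • u) (q y) (mD E EP q y v) +
        mD EG EP (fun g => op g • q y) (k y) (mD E EG k y v) := by
  have ha : MDifferentiableAt (𝓘(ℝ, EP).prod 𝓘(ℝ, EG)) 𝓘(ℝ, EP)
      (fun p : P × G => op p.2 • p.1) (q y, k y) := B.smooth_act.mdifferentiable (by simp) _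
  have hqk := hq.prodMk hk
  have e1 : mD E EP (fun z => op (k z) • q z) y v =
      mfderiv (𝓘(ℝ, EP).prod 𝓘(ℝ, EG)) 𝓘(ℝ, EP) (fun p : P × G => op p.2 • p.1) (q y, k y)
        (mfderiv 𝓘(ℝ, E) (𝓘(ℝ, EP).prod 𝓘(ℝ, EG)) (fun z => (q z, k z)) y v) :=
    congrArg (fun T : E →L[ℝ] EP => T v)
      (mfderiv_comp (g := fun p : P × G => op p.2 • p.1) y ha hqk)
  rw [e1, mfderiv_prod_eq_add_apply ha, mfderiv_prodMk hq hk]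
  rfl

theorem pullForm_act_const (B : PrincipalBundle E EG EP M G P) {θ : GForm EG EP P}
    (hθ : IsEquivariantGForm G θ) (g : G) {q : E → P} {y : E}
    (hq : MDifferentiableAt 𝓘(ℝ, E) 𝓘(ℝ, EP) q y) :
    pullForm (fun z => op g • q z) θ y = (Ad g⁻¹).comp (pullForm q θ y) := by
  ext v
  have e1 := mD_comp (mdifferentiable_act_left B g (q y)) hq
  have e2 := hθ (q y) g (mD E EP q y v)
  rw [pullForm, e1]
  exact e2

variable [LieGroup 𝓘(ℝ, EG) ∞ G]

/-- The value of `θ` on the vertical vectors at `u g`. -/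
theorem apply_mD_act_right (B : PrincipalBundle E EG EP M G P) {θ : GForm EG EP P} {c : ℝ}
    (hv : HasVerticalFactor G θ c) (u : P) (g : G) (X : EG) :
    formAt θ (op g • u) (mD EG EP (fun h : G => op h • u) g X) =
      c • mD EG EG (fun h : G => g⁻¹ * h) g X := by
  have h1 : MDifferentiableAt 𝓘(ℝ, EG) 𝓘(ℝ, EG) (fun h : G => g⁻¹ * h) g :=
    (contMDiff_mul_left (I := 𝓘(ℝ, EG)) (n := ∞) (a := g⁻¹)).mdifferentiable (by simp) _
  have e0 : (fun h : G => op h • u) = fun h : G => op (g⁻¹ * h) • op g • u := by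
    funext h
    rw [smul_smul, ← op_mul, mul_inv_cancel_left]
  have e1 : mD EG EP (fun h : G => op h • u) g =
      (mD EG EP (fun h : G => op h • op g • u) 1).comp (mD EG EG (fun h : G => g⁻¹ * h) g) := by
    rw [e0, mD_comp (f := fun h : G => g⁻¹ * h) (mdifferentiable_act_right B (op g • u) _) h1,
      inv_mul_cancel]
  rw [e1]
  have e2 := hv (op g • u) (mD EG EG (fun h : G => g⁻¹ * h) g X)
  have e3 : formAt θ (op (1 : G) • op g • u) = formAt θ (op g • u) := by rw [op_one, one_smul]
  rw [← e2, ← e3]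
  rfl

/-- The effect of a gauge transformation on a local connection form. -/
theorem pullForm_act (B : PrincipalBundle E EG EP M G P) {θ : GForm EG EP P} {c : ℝ}
    (hθ : IsEquivariantGForm G θ) (hv : HasVerticalFactor G θ c) {q : E → P} {ζ : E → EG} {y : E}
    (hq : MDifferentiableAt 𝓘(ℝ, E) 𝓘(ℝ, EP) q y) (hζ : DifferentiableAt ℝ ζ y)
    (ht : ζ y ∈ (oneChart EG G).target) :
    pullForm (fun z => op ((oneChart EG G).symm (ζ z)) • q z) θ y =
      (Ad ((oneChart EG G).symm (ζ y))⁻¹).comp (pullForm q θ y) +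
        c • (maurerCartan G (ζ y)).comp (fderiv ℝ ζ y) := by
  have := isManifold_one EG G
  have hs : MDifferentiableAt 𝓘(ℝ, EG) 𝓘(ℝ, EG) (oneChart EG G).symm (ζ y) :=
    mdifferentiableAt_chart_symm ht
  have hk : MDifferentiableAt 𝓘(ℝ, E) 𝓘(ℝ, EG) (fun z => (oneChart EG G).symm (ζ z)) y :=
    hs.comp y hζ.mdifferentiableAt
  set g : G := (oneChart EG G).symm (ζ y) with hg
  have hm : MDifferentiableAt 𝓘(ℝ, EG) 𝓘(ℝ, EG) (fun h : G => g⁻¹ * h) g :=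
    (contMDiff_mul_left (I := 𝓘(ℝ, EG)) (n := ∞) (a := g⁻¹)).mdifferentiable (by simp) _
  -- the chart has derivative `1` at the unit, so the logarithmic derivative may be read in it
  have e1 : (mD EG EG (fun h : G => g⁻¹ * h) g).comp
      (mD E EG (fun z => (oneChart EG G).symm (ζ z)) y) =
      (maurerCartan G (ζ y)).comp (fderiv ℝ ζ y) := by
    have hc : MDifferentiableAt 𝓘(ℝ, EG) 𝓘(ℝ, EG) (oneChart EG G)
        ((fun h : G => g⁻¹ * h) ((oneChart EG G).symm (ζ y))) := by
      show MDifferentiableAt 𝓘(ℝ, EG) 𝓘(ℝ, EG) (oneChart EG G) (g⁻¹ * g)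
      rw [inv_mul_cancel]
      exact mdifferentiableAt_chart (mem_chart_source EG 1)
    have hms : MDifferentiableAt 𝓘(ℝ, EG) 𝓘(ℝ, EG)
        (fun w => (fun h : G => g⁻¹ * h) ((oneChart EG G).symm w)) (ζ y) := hm.comp (ζ y) hs
    have e2 : maurerCartan G (ζ y) = (mD EG EG (fun h : G => g⁻¹ * h) g).comp
        (mD EG EG (oneChart EG G).symm (ζ y)) := by
      have e3 : maurerCartan G (ζ y) = (mD EG EG (oneChart EG G) (g⁻¹ * g)).comp
          (mD EG EG (fun w => (fun h : G => g⁻¹ * h) ((oneChart EG G).symm w)) (ζ y)) := by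
        rw [← mD_comp (f := fun w => (fun h : G => g⁻¹ * h) ((oneChart EG G).symm w)) hc hms,
          mD_eq_fderiv]
        rfl
      rw [e3, inv_mul_cancel, mD_chart_self, ContinuousLinearMap.id_comp,
        mD_comp (g := fun h : G => g⁻¹ * h) (f := (oneChart EG G).symm) hm hs]
    rw [e2, mD_comp (f := ζ) hs hζ.mdifferentiableAt, mD_eq_fderiv, ContinuousLinearMap.comp_assoc]
  ext v
  have e4 := mD_act B hq hk v
  have e5 := hθ (q y) g (mD E EP q y v)
  have e6 := apply_mD_act_right B hv (q y) g
    (mD E EG (fun z => (oneChart EG G).symm (ζ z)) y v)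
  have e7 := congrArg (fun T : E →L[ℝ] EG => T v) e1
  simp only [ContinuousLinearMap.comp_apply] at e7
  rw [e7] at e6
  change formAt θ (op g • q y) (mD E EP (fun z => op ((oneChart EG G).symm (ζ z)) • q z) y v) =
    Ad g⁻¹ (formAt θ (q y) (mD E EP q y v)) + c • maurerCartan G (ζ y) (fderiv ℝ ζ y v)
  rw [e4, map_add]
  exact congrArg₂ (· + ·) e5 e6

/-! ### Transition between local trivializations -/

variable [IsManifold 𝓘(ℝ, E) ∞ M]

/-- The local section over the chart and the trivialization around `x₀`, `x₁` arises from the one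
at `x = chart⁻¹ y` by a change of coordinates `τ` and a gauge transformation `oneChart⁻¹ (ζ z) * g`
with `oneChart⁻¹ (ζ y) = 1`. -/
theorem exists_secAt_transition (B : PrincipalBundle E EG EP M G P) {x₀ x₁ : M} {y : E}
    (hy : y ∈ secDom B x₀ x₁) :
    ∃ (g : G) (ζ : E → EG), ζ y = oneCoord EG G ∧ ContDiffAt ℝ ∞ ζ y ∧
      ∀ᶠ z in 𝓝 y, secAt B x₀ x₁ z = op g • op ((oneChart EG G).symm (ζ z)) •
        secAt B ((chartAt E x₀).symm y) ((chartAt E x₀).symm y)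
          (chartAt E ((chartAt E x₀).symm y) ((chartAt E x₀).symm z)) := by
  set x : M := (chartAt E x₀).symm y with hx
  let γ : E → G := fun z => (B.triv x (secAt B x₀ x₁ z)).2
  have hproj : ∀ z ∈ secDom B x₀ x₁, B.proj (secAt B x₀ x₁ z) = (chartAt E x₀).symm z :=
    fun z hz => (B.triv x₁).proj_symm_apply' hz.2
  have hsrcy : secAt B x₀ x₁ y ∈ (B.triv x).source := by
    rw [(B.triv x).mem_source, hproj y hy]; exact B.mem_triv x
  have hγ : ContMDiffAt 𝓘(ℝ, E) 𝓘(ℝ, EG) ∞ γ y :=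
    (((B.smooth_triv x).contMDiffAt ((B.triv x).open_source.mem_nhds hsrcy)).comp y
      (contMDiffAt_secAt B hy)).snd
  have hk : ContMDiffAt 𝓘(ℝ, E) 𝓘(ℝ, EG) ∞ (fun z => γ z * (γ y)⁻¹) y :=
    hγ.mul contMDiffAt_const
  have hk1 : γ y * (γ y)⁻¹ ∈ (oneChart EG G).source := by
    rw [mul_inv_cancel]; exact mem_chart_source EG 1
  have hsymm : ContMDiffAt 𝓘(ℝ, E) 𝓘(ℝ, E) ∞ (chartAt E x₀).symm y :=
    contMDiffAt_symm_of_mem_maximalAtlas (IsManifold.chart_mem_maximalAtlas x₀) hy.1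
  refine ⟨γ y, fun z => oneChart EG G (γ z * (γ y)⁻¹), by simp, ?_, ?_⟩
  · rw [← contMDiffAt_iff_contDiffAt]
    exact (contMDiffAt_oneChart hk1).comp y hk
  · filter_upwards [eventually_mem_secDom B hy,
      hk.continuousAt.eventually ((oneChart EG G).open_source.mem_nhds hk1),
      hsymm.continuousAt.eventually ((chartAt E x).open_source.mem_nhds (mem_chart_source E x)),
      hsymm.continuousAt.eventually ((B.triv x).open_baseSet.mem_nhds (B.mem_triv x))]
      with z h1 h2 h3 h4
    rw [(oneChart EG G).left_inv h2, smul_smul, ← op_mul, inv_mul_cancel_right]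
    have e1 : secAt B x x (chartAt E x ((chartAt E x₀).symm z)) =
        (B.triv x).toOpenPartialHomeomorph.symm ((chartAt E x₀).symm z, 1) := by
      rw [secAt, (chartAt E x).left_inv h3]
    rw [e1]
    set w : P := (B.triv x).toOpenPartialHomeomorph.symm ((chartAt E x₀).symm z, 1) with hw
    have hwp : B.proj w = (chartAt E x₀).symm z := (B.triv x).proj_symm_apply' h4
    have hw2 : (B.triv x w).2 = 1 := by rw [hw, (B.triv x).apply_symm_apply' h4]
    have e2 : op (γ z) • w ∈ (B.triv x).source := by
      rw [(B.triv x).mem_source, B.proj_act, hwp]; exact h4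
    have e3 : secAt B x₀ x₁ z ∈ (B.triv x).source := by
      rw [(B.triv x).mem_source, hproj z h1]; exact h4
    rw [← (B.triv x).symm_apply_mk_proj e2, ← (B.triv x).symm_apply_mk_proj e3, B.proj_act, hwp,
      hproj z h1, B.triv_act x w _ (by rw [hwp]; exact h4), hw2, one_mul]

end LocalForms

/-! ### The coordinate expression of `β` -/

section CoordinateExpression

variable {E : Type*} [NormedAddCommGroup E] [NormedSpace ℝ E]
  {EG : Type*} [NormedAddCommGroup EG] [NormedSpace ℝ EG] [FiniteDimensional ℝ EG]
  {G : Type*} [TopologicalSpace G] [ChartedSpace EG G] [Group G] [LieGroup 𝓘(ℝ, EG) ∞ G]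

theorem univCurv_apply (c X Y : E × (E →L[ℝ] EG)) :
    univCurv G c X Y = X.2 Y.1 - Y.2 X.1 + lieBr G (c.2 X.1) (c.2 Y.1) := rfl

variable [FiniteDimensional ℝ E]

/-- Evaluation of alternating maps on the tuples of basis vectors. -/
def evalBasis (E : Type*) [NormedAddCommGroup E] [NormedSpace ℝ E] [FiniteDimensional ℝ E] (m : ℕ) :
    (E [⋀^Fin m]→L[ℝ] ℝ) →ₗ[ℝ] ((Fin m → Fin (Module.finrank ℝ E)) → ℝ) where
  toFun f s := f fun i => Module.finBasis ℝ E (s i)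
  map_add' _ _ := rfl
  map_smul' _ _ := rfl

theorem evalBasis_injective (m : ℕ) : Function.Injective (evalBasis E m) := by
  intro f g h
  have h1 : f.toAlternatingMap = g.toAlternatingMap :=
    Module.Basis.ext_alternating (Module.finBasis ℝ E) fun s _ => congrFun h s
  ext v
  exact congrArg (fun q : E [⋀^Fin m]→ₗ[ℝ] ℝ => q v) h1

theorem exists_evalBasis_leftInverse (m : ℕ) :
    ∃ L : ((Fin m → Fin (Module.finrank ℝ E)) → ℝ) →L[ℝ] (E [⋀^Fin m]→L[ℝ] ℝ),
      ∀ f, L (evalBasis E m f) = f := by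
  obtain ⟨L, hL⟩ := (evalBasis E m).exists_leftInverse_of_injective
    (LinearMap.ker_eq_bot.2 (evalBasis_injective m))
  exact ⟨LinearMap.toContinuousLinearMap L, fun f => LinearMap.congr_fun hL f⟩

theorem contDiffAt_alternating {N : Type*} [NormedAddCommGroup N] [NormedSpace ℝ N] {m : ℕ}
    {n : WithTop ℕ∞} {f : N → E [⋀^Fin m]→L[ℝ] ℝ} {y : N}
    (h : ∀ v, ContDiffAt ℝ n (fun z => f z v) y) : ContDiffAt ℝ n f y := by
  obtain ⟨L, hL⟩ := exists_evalBasis_leftInverse (E := E) m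
  have h1 : ContDiffAt ℝ n (fun z => evalBasis E m (f z)) y :=
    contDiffAt_pi.2 fun s => h _
  have h2 := L.contDiff.contDiffAt.comp y h1
  exact h2.congr_of_eventuallyEq (Eventually.of_forall fun z => (hL (f z)).symm)

variable (G) in
/-- The expression of `β_k` at a point in coordinates, in terms of the value `a` and the derivative
`D` of the connection and the values `ξ` of the tangent vectors. -/
def betaRep {r : ℕ} (p : MultilinearMap ℝ (fun _ : Fin r => EG) ℝ) (k m : ℕ) (h : m + k = 2 * r)
    (a : E →L[ℝ] EG) (D : E →L[ℝ] E →L[ℝ] EG) (ξ : Fin k → E →L[ℝ] EG) : E [⋀^Fin m]→L[ℝ] ℝ :=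
  toCont ((iterContract m k (fun i => ((0 : E), ξ i))
    ((polyF G p ((0 : E), a)).domDomCongr (finCongr (by omega)))).compLinearMap
      ((ContinuousLinearMap.id ℝ E).prod D).toLinearMap)

/-- The vectors on which `p (F)` is evaluated in `betaRep`. -/
def betaArgs {k m : ℕ} (D : E →L[ℝ] E →L[ℝ] EG) (ξ : Fin k → E →L[ℝ] EG) (v : Fin m → E) :
    Fin k ⊕ Fin m → E × (E →L[ℝ] EG) :=
  Sum.elim (fun i => (0, ξ i)) fun i => (v i, D (v i))

/-- The position of the arguments of `p (F)` in `betaArgs`. -/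
def betaIdx {r k m : ℕ} (h : m + k = 2 * r) (i : Fin (r * 2)) : Fin k ⊕ Fin m :=
  contractEquiv m k (finCongr (by omega) i)

theorem betaRep_apply {r : ℕ} (p : MultilinearMap ℝ (fun _ : Fin r => EG) ℝ) (k m : ℕ)
    (h : m + k = 2 * r) (a : E →L[ℝ] EG) (D : E →L[ℝ] E →L[ℝ] EG) (ξ : Fin k → E →L[ℝ] EG)
    (v : Fin m → E) :
    betaRep G p k m h a D ξ v =
      polyForm p (univCurv G ((0 : E), a)) fun i => betaArgs D ξ v (betaIdx h i) := by
  change iterContract m k (fun i => ((0 : E), ξ i))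
    ((polyF G p ((0 : E), a)).domDomCongr (finCongr (by omega))) (fun i => (v i, D (v i))) = _
  rw [iterContract_apply]
  rfl

/-- `betaRep` is determined by the pairings `ξ_i (v_j)` and by the curvature, up to a
transformation that preserves `p`. -/
theorem betaRep_eq_of_gauge {E' : Type*} [NormedAddCommGroup E'] [NormedSpace ℝ E']
    [FiniteDimensional ℝ E'] {r : ℕ} {p : MultilinearMap ℝ (fun _ : Fin r => EG) ℝ} {k m : ℕ}
    {h : m + k = 2 * r} (T : EG →L[ℝ] EG) (hT : ∀ x : Fin r → EG, p (fun i => T (x i)) = p x)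
    {a : E →L[ℝ] EG} {D : E →L[ℝ] E →L[ℝ] EG} {ξ : Fin k → E →L[ℝ] EG}
    {a' : E' →L[ℝ] EG} {D' : E' →L[ℝ] E' →L[ℝ] EG} {ξ' : Fin k → E' →L[ℝ] EG} (τ : E' → E)
    (hξ : ∀ i u, ξ' i u = T (ξ i (τ u)))
    (hF : ∀ u v, curvForm G a' D' u v = T (curvForm G a D (τ u) (τ v))) (v : Fin m → E') :
    betaRep G p k m h a' D' ξ' v = betaRep G p k m h a D ξ fun i => τ (v i) := by
  rw [betaRep_apply, betaRep_apply]
  refine polyForm_congr T hT fun i j => ?_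
  rcases betaIdx h i with s | s <;> rcases betaIdx h j with t | t
  · simp [betaArgs, univCurv_apply]
  · simp [betaArgs, univCurv_apply, hξ]
  · simp [betaArgs, univCurv_apply, hξ]
  · exact hF _ _

theorem contDiffAt_betaRep {N : Type*} [NormedAddCommGroup N] [NormedSpace ℝ N] {n : WithTop ℕ∞}
    {r : ℕ} (p : MultilinearMap ℝ (fun _ : Fin r => EG) ℝ) {k m : ℕ} (h : m + k = 2 * r)
    {a : N → E →L[ℝ] EG} {D : N → E →L[ℝ] E →L[ℝ] EG} {ξ : Fin k → N → E →L[ℝ] EG} {y : N}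
    (ha : ContDiffAt ℝ n a y) (hD : ContDiffAt ℝ n D y) (hξ : ∀ i, ContDiffAt ℝ n (ξ i) y) :
    ContDiffAt ℝ n (fun z => betaRep G p k m h (a z) (D z) (fun i => ξ i z)) y := by
  refine contDiffAt_alternating fun v => ?_
  simp only [betaRep_apply, polyForm_apply]
  have hF : ∀ s t : Fin k ⊕ Fin m, ContDiffAt ℝ n (fun z => univCurv G ((0 : E), a z)
      (betaArgs (D z) (fun i => ξ i z) v s) (betaArgs (D z) (fun i => ξ i z) v t)) y := by
    have hlin : ∀ (ψ : N → E →L[ℝ] EG) (u : E), ContDiffAt ℝ n ψ y →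
        ContDiffAt ℝ n (fun z => ψ z u) y := fun ψ u hψ => hψ.clm_apply contDiffAt_const
    have hDv : ∀ u : E, ContDiffAt ℝ n (fun z => D z u) y := fun u =>
      hD.clm_apply contDiffAt_const
    intro s t
    rcases s with s | s <;> rcases t with t | t
    · simp only [betaArgs, univCurv_apply, Sum.elim_inl, map_zero, sub_zero]
      exact contDiffAt_const
    · simp only [betaArgs, univCurv_apply, Sum.elim_inl, Sum.elim_inr, map_zero, sub_zero,
        LinearMap.zero_apply, add_zero]
      exact hlin _ _ (hξ s)
    · simp only [betaArgs, univCurv_apply, Sum.elim_inl, Sum.elim_inr, map_zero, zero_sub,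
        add_zero]
      exact (hlin _ _ (hξ t)).neg
    · simp only [betaArgs, univCurv_apply, Sum.elim_inr]
      refine ((hlin _ _ (hDv _)).sub (hlin _ _ (hDv _))).add ?_
      exact ((lieBrL G).contDiff.contDiffAt.comp y (hlin _ _ ha)).clm_apply (hlin _ _ ha)
  refine contDiffAt_const.mul (ContDiffAt.sum fun σ _ => contDiffAt_const.mul ?_)
  exact (multilinearCont p).contDiff.contDiffAt.comp y (contDiffAt_pi.2 fun i => hF _ _)

end CoordinateExpression

/-! ### The forms `β` in charts and trivializations -/

section ChartExpression

variable {E : Type*} [NormedAddCommGroup E] [NormedSpace ℝ E]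
  {EG : Type*} [NormedAddCommGroup EG] [NormedSpace ℝ EG]
  {EP : Type*} [NormedAddCommGroup EP] [NormedSpace ℝ EP]
  {M : Type*} [TopologicalSpace M] [ChartedSpace E M] [IsManifold 𝓘(ℝ, E) ∞ M]
  {G : Type*} [TopologicalSpace G] [ChartedSpace EG G] [Group G] [LieGroup 𝓘(ℝ, EG) ∞ G]
  {P : Type*} [TopologicalSpace P] [ChartedSpace EP P] [MulAction Gᵐᵒᵖ P]

variable (E) in
/-- The change of coordinates from the chart around `x₀` to the chart around the point with
coordinates `y`. -/
def coordChange (x₀ : M) (y z : E) : E :=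
  chartAt E ((chartAt E x₀).symm y) ((chartAt E x₀).symm z)

theorem contDiffAt_coordChange {x₀ : M} {y : E} (hy : y ∈ (chartAt E x₀).target) :
    ContDiffAt ℝ ∞ (coordChange E x₀ y) y := by
  rw [← contMDiffAt_iff_contDiffAt]
  exact (contMDiffAt_of_mem_maximalAtlas (IsManifold.chart_mem_maximalAtlas _)
    (mem_chart_source E _)).comp y
    (contMDiffAt_symm_of_mem_maximalAtlas (IsManifold.chart_mem_maximalAtlas x₀) hy)

theorem fderiv_coordChange {x₀ : M} {y : E} (hy : y ∈ (chartAt E x₀).target) :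
    fderiv ℝ (coordChange E x₀ y) y = mD E E (chartAt E x₀).symm y := by
  have : IsManifold 𝓘(ℝ, E) 1 M := IsManifold.of_le (n := ∞) (by simp)
  rw [← mD_eq_fderiv]
  unfold coordChange
  rw [mD_comp (g := chartAt E ((chartAt E x₀).symm y)) (f := (chartAt E x₀).symm)
    (mdifferentiableAt_chart (mem_chart_source E _)) (mdifferentiableAt_chart_symm hy),
    mD_chart_self, ContinuousLinearMap.id_comp]

/-- The transformation of local connection forms under a change of the chart and the
trivialization. -/
theorem exists_pullForm_transition (B : PrincipalBundle E EG EP M G P) {x₀ x₁ : M} {y : E}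
    (hy : y ∈ secDom B x₀ x₁) :
    ∃ (g : G) (ζ : E → EG), ζ y = oneCoord EG G ∧ ContDiffAt ℝ ∞ ζ y ∧
      ∀ (θ : GForm EG EP P) (c : ℝ), IsEquivariantGForm G θ → HasVerticalFactor G θ c →
        ∀ᶠ z in 𝓝 y, pullForm (secAt B x₀ x₁) θ z =
          (Ad g⁻¹).comp ((Ad ((oneChart EG G).symm (ζ z))⁻¹).comp
            ((localExpr B ((chartAt E x₀).symm y) θ (coordChange E x₀ y z)).comp
              (fderiv ℝ (coordChange E x₀ y) z)) +
            c • (maurerCartan G (ζ z)).comp (fderiv ℝ ζ z)) := by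
  have := isManifold_one EG G
  obtain ⟨g, ζ, h1, hζ, h⟩ := exists_secAt_transition B hy
  refine ⟨g, ζ, h1, hζ, fun θ c hθ hv => ?_⟩
  set x : M := (chartAt E x₀).symm y with hx
  have hτ := contDiffAt_coordChange hy.1
  have hτy : coordChange E x₀ y y ∈ secDom B x x := chart_mem_secDom B x
  have ht : ζ y ∈ (oneChart EG G).target := by rw [h1]; exact mem_chart_target EG 1
  filter_upwards [h.eventually_nhds, (hτ.of_le (m := 1) (by simp)).eventually (by simp),
    (hζ.of_le (m := 1) (by simp)).eventually (by simp),
    hτ.continuousAt.eventually ((isOpen_secDom B x x).mem_nhds hτy),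
    hζ.continuousAt.eventually ((oneChart EG G).open_target.mem_nhds ht)] with z hz hτz hζz hz1 hz2
  have hs : MDifferentiableAt 𝓘(ℝ, E) 𝓘(ℝ, EP) (secAt B x x) (coordChange E x₀ y z) :=
    (contMDiffAt_secAt B hz1).mdifferentiableAt (by simp)
  have hτd := hτz.differentiableAt (by simp)
  have hζd := hζz.differentiableAt (by simp)
  have hq : MDifferentiableAt 𝓘(ℝ, E) 𝓘(ℝ, EP) (fun w => secAt B x x (coordChange E x₀ y w)) z :=
    hs.comp z hτd.mdifferentiableAt
  have hk : MDifferentiableAt 𝓘(ℝ, E) 𝓘(ℝ, EG) (fun w => (oneChart EG G).symm (ζ w)) z :=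
    (mdifferentiableAt_chart_symm hz2).comp z hζd.mdifferentiableAt
  have ha : MDifferentiableAt (𝓘(ℝ, EP).prod 𝓘(ℝ, EG)) 𝓘(ℝ, EP)
      (fun p : P × G => op p.2 • p.1) (secAt B x x (coordChange E x₀ y z),
        (oneChart EG G).symm (ζ z)) := B.smooth_act.mdifferentiable (by simp) _
  have hq2 : MDifferentiableAt 𝓘(ℝ, E) 𝓘(ℝ, EP)
      (fun w => op ((oneChart EG G).symm (ζ w)) • secAt B x x (coordChange E x₀ y w)) z :=
    ha.comp (f := fun w => (secAt B x x (coordChange E x₀ y w), (oneChart EG G).symm (ζ w)))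
      z (hq.prodMk hk)
  have hz' : secAt B x₀ x₁ =ᶠ[𝓝 z] fun w => op g • (fun w =>
      op ((oneChart EG G).symm (ζ w)) • secAt B x x (coordChange E x₀ y w)) w := hz
  rw [pullForm_congr θ hz', pullForm_act_const B hθ g hq2, pullForm_act B hθ hv hq hζd hz2,
    pullForm_comp θ hs hτd]
  rfl

variable [FiniteDimensional ℝ E] [FiniteDimensional ℝ EG] [IsManifold 𝓘(ℝ, EP) ∞ P]

/-- The value of `β_k` at `x` on tangent vectors of the model space. -/
theorem beta_eq (B : PrincipalBundle E EG EP M G P) {r : ℕ}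
    (p : MultilinearMap ℝ (fun _ : Fin r => EG) ℝ) {k m : ℕ} (h : m + k = 2 * r)
    (A : Connection EG EP G P) (ξ : Fin k → AdForms EG EP G P) (x : M) :
    (show E [⋀^Fin m]→L[ℝ] ℝ from beta B p k m h A ξ x) =
      betaRep G p k m h (localExpr B x A.form (chartAt E x x))
        (fderiv ℝ (localExpr B x A.form) (chartAt E x x))
        (fun i => localExpr B x (ξ i).1 (chartAt E x x)) := by
  have : IsManifold 𝓘(ℝ, E) 1 M := IsManifold.of_le (n := ∞) (by simp)
  have ha : DifferentiableAt ℝ (localExpr B x A.form) (chartAt E x x) :=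
    (contDiffAt_pullForm_secAt B (chart_mem_secDom B x) A.smooth).differentiableAt (by simp)
  have e1 : fderiv ℝ (fun z => (z, localExpr B x A.form z)) (chartAt E x x) =
      (ContinuousLinearMap.id ℝ E).prod (fderiv ℝ (localExpr B x A.form) (chartAt E x x)) :=
    ((hasFDerivAt_id _).prodMk ha.hasFDerivAt).fderiv
  ext v
  have e2 : ∀ u, mD E E (chartAt E x) x u = u := fun u => by rw [mD_chart_self]; rfl
  change (iterContract m k (fun i => ((0 : E), localExpr B x (ξ i).1 (chartAt E x x)))
    ((polyF G p ((0 : E), localExpr B x A.form (chartAt E x x))).domDomCongr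
      (finCongr (by omega)))) (fun i => fderiv ℝ (fun z => (z, localExpr B x A.form z))
        (chartAt E x x) (mD E E (chartAt E x) x (v i))) = _
  simp only [e2, e1]
  rfl

/-- The form `β_k` in a chart, in terms of an arbitrary trivialization. -/
theorem chartRep_beta (B : PrincipalBundle E EG EP M G P) {r : ℕ}
    {p : MultilinearMap ℝ (fun _ : Fin r => EG) ℝ} (hp : IsInvariantPoly G p) {k m : ℕ}
    (h : m + k = 2 * r) (A : Connection EG EP G P) (ξ : Fin k → AdForms EG EP G P) {x₀ x₁ : M}
    {y : E} (hy : y ∈ secDom B x₀ x₁) :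
    chartRep x₀ (beta B p k m h A ξ) y =
      betaRep G p k m h (pullForm (secAt B x₀ x₁) A.form y)
        (fderiv ℝ (pullForm (secAt B x₀ x₁) A.form) y)
        (fun i => pullForm (secAt B x₀ x₁) (ξ i).1 y) := by
  obtain ⟨g, ζ, h1, hζ, H⟩ := exists_pullForm_transition B hy
  set x : M := (chartAt E x₀).symm y with hx
  have hτ := contDiffAt_coordChange hy.1
  have ha : ContDiffAt ℝ ∞ (localExpr B x A.form) (coordChange E x₀ y y) :=
    contDiffAt_pullForm_secAt B (chart_mem_secDom B x) A.smooth
  have hgauge := curvForm_gauge (a' := pullForm (secAt B x₀ x₁) A.form) g⁻¹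
    (hτ.of_le two_le_infty) (hζ.of_le two_le_infty) h1
    (ha.differentiableAt (by simp))
    ((H A.form 1 A.equivariant A.hasVerticalFactor).mono fun z hz => by rw [hz, one_smul])
  have hξ : ∀ i, pullForm (secAt B x₀ x₁) (ξ i).1 y =
      (Ad g⁻¹).comp ((localExpr B x (ξ i).1 (chartAt E x x)).comp
        (fderiv ℝ (coordChange E x₀ y) y)) := fun i => by
    rw [(H (ξ i).1 0 (ξ i).2.2.1 (AdForms.hasVerticalFactor (ξ i))).self_of_nhds, h1, zero_smul,
      add_zero, Ad_inv_one, ContinuousLinearMap.id_comp]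
    rfl
  ext v
  have e1 := congrArg (fun q : E [⋀^Fin m]→L[ℝ] ℝ =>
    q fun i => mD E E (chartAt E x₀).symm y (v i)) (beta_eq B p h A ξ x)
  refine e1.trans ?_
  rw [betaRep_eq_of_gauge (ξ := fun i => localExpr B x (ξ i).1 (chartAt E x x)) (Ad g⁻¹)
    (hp.inv g⁻¹) (fderiv ℝ (coordChange E x₀ y) y)
    (fun i u => by rw [hξ]; rfl) hgauge, fderiv_coordChange hy.1]
  rfl

/-- The form `β_k (A) (ξ)` is smooth. -/
theorem isSmoothForm_beta (B : PrincipalBundle E EG EP M G P) {r : ℕ}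
    {p : MultilinearMap ℝ (fun _ : Fin r => EG) ℝ} (hp : IsInvariantPoly G p) {k m : ℕ}
    (h : m + k = 2 * r) (A : Connection EG EP G P) (ξ : Fin k → AdForms EG EP G P) :
    IsSmoothForm (beta B p k m h A ξ) := by
  intro x₀ y hy
  have hd := mem_secDom_symm B hy
  have ha := contDiffAt_pullForm_secAt B hd A.smooth
  refine ContDiffAt.contDiffWithinAt ?_
  refine (contDiffAt_betaRep (G := G) p h ha (ha.fderiv_right (m := ∞) (by simp)) fun i =>
    contDiffAt_pullForm_secAt B hd (ξ i).2.1).congr_of_eventuallyEq ?_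
  filter_upwards [eventually_mem_secDom B hd] with z hz
  exact chartRep_beta B hp h A ξ hz

end ChartExpression

/-! ### Directional derivatives of functions on `𝒜` -/

section RawForms

variable {E : Type*} [NormedAddCommGroup E] [NormedSpace ℝ E]
  {M : Type*} [TopologicalSpace M] [ChartedSpace E M]

/-- The value of a form on `M`, read on the model space. -/
def rawAt {j : ℕ} (θ : RawForm E M j) (x : M) : E [⋀^Fin j]→L[ℝ] ℝ := θ x

theorem rawForm_ext {j : ℕ} {θ η : RawForm E M j} (h : ∀ x v, rawAt θ x v = rawAt η x v) :
    θ = η := by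
  funext x
  exact ContinuousAlternatingMap.ext (h x)

theorem chartRep_chart_self [IsManifold 𝓘(ℝ, E) 1 M] {j : ℕ} (x : M) (θ : RawForm E M j) :
    chartRep x θ (chartAt E x x) = rawAt θ x := by
  ext v
  change rawAt θ ((chartAt E x).symm (chartAt E x x))
    (fun i => mD E E (chartAt E x).symm (chartAt E x x) (v i)) = _
  rw [(chartAt E x).left_inv (mem_chart_source E x), mD_chart_symm_self]
  rfl

theorem chartRep_sum {ι : Type*} {j : ℕ} (x₀ : M) (s : Finset ι) (θ : ι → RawForm E M j) (y : E) :
    chartRep x₀ (∑ i ∈ s, θ i) y = ∑ i ∈ s, chartRep x₀ (θ i) y := by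
  classical
  induction s using Finset.induction_on with
  | empty => rfl
  | insert a s ha ih =>
    rw [Finset.sum_insert ha, Finset.sum_insert ha, ← ih]
    rfl

theorem rawAt_sum_smul {ι : Type*} {j : ℕ} (s : Finset ι) (c : ι → ℝ) (θ : ι → RawForm E M j)
    (x : M) (v : Fin j → E) :
    rawAt (∑ i ∈ s, c i • θ i) x v = ∑ i ∈ s, c i * rawAt (θ i) x v :=
  (congrArg (fun q : E [⋀^Fin j]→L[ℝ] ℝ => q v)
    (Finset.sum_apply x s fun i => c i • θ i)).trans (ContinuousAlternatingMap.sum_apply _ _)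

theorem IsSmoothForm.sum_smul {ι : Type*} {j : ℕ} (s : Finset ι) (c : ι → ℝ)
    {θ : ι → RawForm E M j} (h : ∀ i, IsSmoothForm (θ i)) :
    IsSmoothForm (∑ i ∈ s, c i • θ i) := fun x₀ =>
  (ContDiffOn.sum fun i _ => (h i x₀).const_smul (c i)).congr fun y _ => by
    rw [chartRep_sum]; rfl

theorem iteratedFDeriv_chartRep_sum_smul {ι : Type*} {j : ℕ} (s : Finset ι) (c : ι → ℝ)
    {θ : ι → RawForm E M j} (h : ∀ i, IsSmoothForm (θ i)) (x₀ : M) (n : ℕ) {y : E}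
    (hy : y ∈ (chartAt E x₀).target) :
    iteratedFDeriv ℝ n (chartRep x₀ (∑ i ∈ s, c i • θ i)) y =
      ∑ i ∈ s, c i • iteratedFDeriv ℝ n (chartRep x₀ (θ i)) y := by
  have hd : ∀ i, ContDiffAt ℝ n (chartRep x₀ (θ i)) y := fun i =>
    ((h i x₀).contDiffAt ((chartAt E x₀).open_target.mem_nhds hy)).of_le
      (WithTop.coe_le_coe.2 le_top)
  have e1 : chartRep x₀ (∑ i ∈ s, c i • θ i) = fun z => ∑ i ∈ s, (c i • chartRep x₀ (θ i)) z := by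
    funext z
    rw [chartRep_sum]
    rfl
  rw [e1, iteratedFDeriv_fun_sum_apply (f := fun i => c i • chartRep x₀ (θ i)) fun i _ =>
    (hd i).const_smul (c i)]
  exact Finset.sum_congr rfl fun i _ => iteratedFDeriv_const_smul_apply (hd i)

/-- Linear combinations of smooth forms with convergent coefficients converge in the
`C^∞` topology. -/
theorem smoothTendsto_sum_smul {ι κ : Type*} {j : ℕ} {l : Filter κ} (s : Finset ι)
    {c : ι → κ → ℝ} {c' : ι → ℝ} {θ : ι → RawForm E M j} (h : ∀ i, IsSmoothForm (θ i))
    (hc : ∀ i, Tendsto (c i) l (𝓝 (c' i))) :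
    SmoothTendsto (fun t => ∑ i ∈ s, c i t • θ i) l (∑ i ∈ s, c' i • θ i) := by
  intro x₀ n
  have hD : ∀ i, ContinuousOn (iteratedFDeriv ℝ n (chartRep x₀ (θ i))) (chartAt E x₀).target :=
    fun i y hy => (((h i x₀).contDiffAt
      ((chartAt E x₀).open_target.mem_nhds hy)).iteratedFDeriv_right (m := 0)
      (by simp; exact WithTop.coe_le_coe.2 le_top)).continuousAt.continuousWithinAt
  rw [tendstoLocallyUniformlyOn_iff_forall_tendsto]
  intro y hy
  have h1 : Tendsto (fun q : κ × E => ∑ i ∈ s, c i q.1 • iteratedFDeriv ℝ n (chartRep x₀ (θ i)) q.2)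
      (l ×ˢ 𝓝[(chartAt E x₀).target] y)
      (𝓝 (∑ i ∈ s, c' i • iteratedFDeriv ℝ n (chartRep x₀ (θ i)) y)) :=
    tendsto_finsetSum _ fun i _ => ((hc i).comp tendsto_fst).smul
      ((hD i y hy).tendsto.comp tendsto_snd)
  have h2 : Tendsto (fun q : κ × E => ∑ i ∈ s, c' i • iteratedFDeriv ℝ n (chartRep x₀ (θ i)) q.2)
      (l ×ˢ 𝓝[(chartAt E x₀).target] y)
      (𝓝 (∑ i ∈ s, c' i • iteratedFDeriv ℝ n (chartRep x₀ (θ i)) y)) :=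
    tendsto_finsetSum _ fun i _ => tendsto_const_nhds.smul ((hD i y hy).tendsto.comp tendsto_snd)
  have h3 := ((h2.prodMk_nhds h1).mono_right (nhds_le_uniformity _))
  refine h3.congr' ?_
  have h4 : ∀ᶠ q : κ × E in l ×ˢ 𝓝[(chartAt E x₀).target] y, q.2 ∈ (chartAt E x₀).target :=
    tendsto_snd.eventually self_mem_nhdsWithin
  filter_upwards [h4] with q hq
  rw [iteratedFDeriv_chartRep_sum_smul s _ h x₀ n hq,
    iteratedFDeriv_chartRep_sum_smul s _ h x₀ n hq]

theorem SmoothTendsto.tendsto_apply [IsManifold 𝓘(ℝ, E) 1 M] {κ : Type*} {j : ℕ} {l : Filter κ}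
    {θ : κ → RawForm E M j} {η : RawForm E M j} (h : SmoothTendsto θ l η) (x : M)
    (v : Fin j → E) : Tendsto (fun t => rawAt (θ t) x v) l (𝓝 (rawAt η x v)) := by
  have h1 := (h x 0).tendsto_at (mem_chart_target E x)
  have hc : Continuous fun q : ContinuousMultilinearMap ℝ (fun _ : Fin 0 => E)
      (E [⋀^Fin j]→L[ℝ] ℝ) => q 0 v :=
    (ContinuousAlternatingMap.apply ℝ E ℝ v).continuous.comp
      (ContinuousMultilinearMap.apply ℝ (fun _ : Fin 0 => E) (E [⋀^Fin j]→L[ℝ] ℝ) 0).continuous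
  have h2 := (hc.tendsto _).comp h1
  simpa only [Function.comp_def, iteratedFDeriv_zero_apply, chartRep_chart_self] using h2

end RawForms

section Derivatives

variable {E : Type*} [NormedAddCommGroup E] [NormedSpace ℝ E]
  {EG : Type*} [NormedAddCommGroup EG] [NormedSpace ℝ EG]
  {EP : Type*} [NormedAddCommGroup EP] [NormedSpace ℝ EP]
  {M : Type*} [TopologicalSpace M] [ChartedSpace E M]
  {G : Type*} [TopologicalSpace G] [ChartedSpace EG G] [Group G]
  {P : Type*} [TopologicalSpace P] [ChartedSpace EP P] [MulAction Gᵐᵒᵖ P]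

theorem Connection.translate_zero_smul (A : Connection EG EP G P) (ξ : AdForms EG EP G P) :
    A.translate ((0 : ℝ) • ξ) = A := by
  obtain ⟨a, h1, h2, h3⟩ := A
  have : a + ((0 : ℝ) • ξ).1 = a := by rw [zero_smul]; exact add_zero a
  simp only [Connection.translate, this]

/-- A function that is a combination of fixed smooth forms along a line, with differentiable
coefficients, has a directional derivative. -/
theorem hasDirDeriv_of_eq_sum {ι : Type*} {j : ℕ} {f : Connection EG EP G P → RawForm E M j}
    {A : Connection EG EP G P} {ξ : AdForms EG EP G P} (s : Finset ι) {c : ι → ℝ → ℝ}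
    {c' : ι → ℝ} {θ : ι → RawForm E M j} (hθ : ∀ i, IsSmoothForm (θ i))
    (hc : ∀ i, HasDerivAt (c i) (c' i) 0)
    (hf : ∀ t : ℝ, f (A.translate (t • ξ)) = ∑ i ∈ s, c i t • θ i) :
    HasDirDeriv f A ξ (∑ i ∈ s, c' i • θ i) := by
  refine ⟨IsSmoothForm.sum_smul s c' hθ, ?_⟩
  have h0 := hf 0
  rw [A.translate_zero_smul] at h0
  have h1 := smoothTendsto_sum_smul s hθ fun i => (hasDerivAt_iff_tendsto_slope.1 (hc i))
  have h2 : ∀ t : ℝ, t⁻¹ • (f (A.translate (t • ξ)) - f A) = ∑ i ∈ s, slope (c i) 0 t • θ i := by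
    intro t
    rw [hf, h0, ← Finset.sum_sub_distrib, Finset.smul_sum]
    refine Finset.sum_congr rfl fun i _ => ?_
    refine rawForm_ext fun x v => ?_
    change t⁻¹ * (c i t * rawAt (θ i) x v - c i 0 * rawAt (θ i) x v) =
      slope (c i) 0 t * rawAt (θ i) x v
    rw [slope_def_field, sub_zero]
    ring
  simpa only [h2] using h1

variable [IsManifold 𝓘(ℝ, E) 1 M]

theorem HasDirDeriv.hasDerivAt {j : ℕ} {f : Connection EG EP G P → RawForm E M j}
    {A : Connection EG EP G P} {ξ : AdForms EG EP G P} {η : RawForm E M j}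
    (h : HasDirDeriv f A ξ η) (x : M) (v : Fin j → E) :
    HasDerivAt (fun t : ℝ => rawAt (f (A.translate (t • ξ))) x v) (rawAt η x v) 0 := by
  rw [hasDerivAt_iff_tendsto_slope]
  refine (h.2.tendsto_apply x v).congr fun t => ?_
  rw [slope_def_field, A.translate_zero_smul, sub_zero, ← inv_mul_eq_div]
  rfl

/-- The directional derivative is computed pointwise. -/
theorem dirDeriv_apply {j : ℕ} {f : Connection EG EP G P → RawForm E M j}
    {A : Connection EG EP G P} {ξ : AdForms EG EP G P} (h : ∃ η, HasDirDeriv f A ξ η) (x : M)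
    (v : Fin j → E) :
    HasDerivAt (fun t : ℝ => rawAt (f (A.translate (t • ξ))) x v)
      (rawAt (dirDeriv f A ξ) x v) 0 := by
  rw [dirDeriv, dif_pos h]
  exact h.choose_spec.hasDerivAt x v

theorem dirDeriv_const_smul {j : ℕ} {f : Connection EG EP G P → RawForm E M j}
    {A : Connection EG EP G P} {ξ : AdForms EG EP G P} (c : ℝ) (h : ∃ η, HasDirDeriv f A ξ η)
    (h' : ∃ η, HasDirDeriv (fun A' => c • f A') A ξ η) :
    dirDeriv (fun A' => c • f A') A ξ = c • dirDeriv f A ξ :=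
  rawForm_ext fun x v => (dirDeriv_apply h' x v).unique ((dirDeriv_apply h x v).const_mul c)

end Derivatives

/-! ### The dependence of `β` on the connection and on the tangent vectors -/

section AlternatingInl

variable {W : Type*} [AddCommGroup W] [Module ℝ W] {κ μ : Type*}

/-- The alternating form obtained by fixing the second group of variables. -/
def alternatingInl (f : W [⋀^κ ⊕ μ]→ₗ[ℝ] ℝ) (V : μ → W) : W [⋀^κ]→ₗ[ℝ] ℝ where
  toFun ξ := f (Sum.elim ξ V)
  map_update_add' ξ i x y := by
    classical
    simp only [← Sum.update_elim_inl]
    exact f.map_update_add _ _ _ _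
  map_update_smul' ξ i c x := by
    classical
    simp only [← Sum.update_elim_inl]
    exact f.map_update_smul _ _ _ _
  map_eq_zero_of_eq' ξ i j h hij :=
    f.map_eq_zero_of_eq _ (i := Sum.inl i) (j := Sum.inl j) h (by simpa using hij)

end AlternatingInl

/-- The function `F` on `ℝ` is a polynomial of degree at most `n`. -/
def IsPolyLE (n : ℕ) (F : ℝ → ℝ) : Prop :=
  ∃ q : Polynomial ℝ, q.degree ≤ n ∧ ∀ t, F t = q.eval t

theorem IsPolyLE.sum {ι : Type*} {n : ℕ} (s : Finset ι) {F : ι → ℝ → ℝ}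
    (h : ∀ i, IsPolyLE n (F i)) : IsPolyLE n fun t => ∑ i ∈ s, F i t := by
  choose q hq hF using h
  refine ⟨∑ i ∈ s, q i, (Polynomial.degree_sum_le s q).trans (Finset.sup_le fun i _ => hq i),
    fun t => ?_⟩
  rw [Polynomial.eval_finsetSum]
  exact Finset.sum_congr rfl fun i _ => hF i t

theorem IsPolyLE.const_mul {n : ℕ} (c : ℝ) {F : ℝ → ℝ} (h : IsPolyLE n F) :
    IsPolyLE n fun t => c * F t := by
  obtain ⟨q, hq, hF⟩ := h
  refine ⟨c • q, (Polynomial.degree_smul_le c q).trans hq, fun t => ?_⟩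
  change c * F t = _
  rw [Polynomial.eval_smul, hF, smul_eq_mul]

theorem isPolyLE_const_mul_pow {n d : ℕ} (hd : d ≤ n) (c : ℝ) :
    IsPolyLE n fun t => t ^ d * c :=
  ⟨Polynomial.C c * Polynomial.X ^ d, (Polynomial.degree_C_mul_X_pow_le d c).trans
    (by exact_mod_cast hd), fun t => by
    rw [Polynomial.eval_mul, Polynomial.eval_C, Polynomial.eval_pow, Polynomial.eval_X, mul_comm]⟩

/-- A multilinear form evaluated at quadratic polynomials is a polynomial. -/
theorem isPolyLE_multilinear {L : Type*} [AddCommGroup L] [Module ℝ L] {r : ℕ}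
    (p : MultilinearMap ℝ (fun _ : Fin r => L) ℝ) (c : Fin r → Fin 3 → L) :
    IsPolyLE (r * 2) fun t => p fun i => ∑ j : Fin 3, t ^ (j : ℕ) • c i j := by
  classical
  have h1 : ∀ t : ℝ, (p fun i => ∑ j : Fin 3, t ^ (j : ℕ) • c i j) =
      ∑ s : Fin r → Fin 3, t ^ (∑ i, (s i : ℕ)) * p fun i => c i (s i) := by
    intro t
    rw [p.map_sum]
    refine Finset.sum_congr rfl fun s _ => ?_
    rw [p.map_smul_univ (fun i => t ^ (s i : ℕ)) (fun i => c i (s i)), smul_eq_mul,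
      Finset.prod_pow_eq_pow_sum]
  simp only [h1]
  refine IsPolyLE.sum _ fun s => isPolyLE_const_mul_pow ?_ _
  calc ∑ i, (s i : ℕ) ≤ ∑ _i : Fin r, 2 := Finset.sum_le_sum fun i _ => by omega
    _ = r * 2 := by simp

/-- The coefficients of Lagrange interpolation at the nodes `0, …, n`. -/
def lagrangeCoeff (n j : ℕ) : Polynomial ℝ :=
  Lagrange.basis (Finset.range (n + 1)) (fun i : ℕ => (i : ℝ)) j

theorem IsPolyLE.eq_interpolate {n : ℕ} {F : ℝ → ℝ} (h : IsPolyLE n F) (t : ℝ) :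
    F t = ∑ j ∈ Finset.range (n + 1), (lagrangeCoeff n j).eval t * F j := by
  obtain ⟨q, hq, hF⟩ := h
  have h1 := Lagrange.eq_interpolate (s := Finset.range (n + 1)) (v := fun i : ℕ => (i : ℝ))
    (f := q) Nat.cast_injective.injOn
    (lt_of_le_of_lt hq (by rw [Finset.card_range]; exact_mod_cast Nat.lt_succ_self n))
  rw [hF]
  conv_lhs => rw [h1]
  rw [Lagrange.interpolate_apply, Polynomial.eval_finsetSum]
  refine Finset.sum_congr rfl fun j _ => ?_
  rw [Polynomial.eval_mul, Polynomial.eval_C, hF, mul_comm]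
  rfl

section Rep

variable {E : Type*} [NormedAddCommGroup E] [NormedSpace ℝ E]
  {EG : Type*} [NormedAddCommGroup EG] [NormedSpace ℝ EG] [FiniteDimensional ℝ EG]
  {G : Type*} [TopologicalSpace G] [ChartedSpace EG G] [Group G] [LieGroup 𝓘(ℝ, EG) ∞ G]

/-- The universal curvature is quadratic along a line of connections. -/
theorem exists_univCurv_line {k m : ℕ} (a z : E →L[ℝ] EG) (D Dz : E →L[ℝ] E →L[ℝ] EG)
    (ξ : Fin k → E →L[ℝ] EG) (v : Fin m → E) (s s' : Fin k ⊕ Fin m) :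
    ∃ c : Fin 3 → EG, ∀ t : ℝ, univCurv G ((0 : E), a + t • z) (betaArgs (D + t • Dz) ξ v s)
      (betaArgs (D + t • Dz) ξ v s') = ∑ j : Fin 3, t ^ (j : ℕ) • c j := by
  rcases s with s | s <;> rcases s' with s' | s'
  · exact ⟨0, fun t => by simp [betaArgs, univCurv_apply]⟩
  · exact ⟨![ξ s (v s'), 0, 0], fun t => by simp [betaArgs, univCurv_apply, Fin.sum_univ_three]⟩
  · exact ⟨![-ξ s' (v s), 0, 0], fun t => by simp [betaArgs, univCurv_apply, Fin.sum_univ_three]⟩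
  · refine ⟨![D (v s) (v s') - D (v s') (v s) + lieBr G (a (v s)) (a (v s')),
      Dz (v s) (v s') - Dz (v s') (v s) + lieBr G (a (v s)) (z (v s')) +
        lieBr G (z (v s)) (a (v s')), lieBr G (z (v s)) (z (v s'))], fun t => ?_⟩
    simp only [betaArgs, univCurv_apply, Fin.sum_univ_three, Sum.elim_inr, add_apply,
      smul_apply, map_add, map_smul, LinearMap.add_apply, LinearMap.smul_apply]
    simp
    module

variable [FiniteDimensional ℝ E]

theorem isPolyLE_betaRep {r : ℕ} (p : MultilinearMap ℝ (fun _ : Fin r => EG) ℝ) {k m : ℕ}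
    (h : m + k = 2 * r) (a z : E →L[ℝ] EG) (D Dz : E →L[ℝ] E →L[ℝ] EG)
    (ξ : Fin k → E →L[ℝ] EG) (v : Fin m → E) :
    IsPolyLE (r * 2) fun t : ℝ => betaRep G p k m h (a + t • z) (D + t • Dz) ξ v := by
  simp only [betaRep_apply, polyForm_apply]
  choose c hc using exists_univCurv_line (G := G) a z D Dz ξ v
  simp only [hc]
  exact (IsPolyLE.sum _ fun σ => (isPolyLE_multilinear p _).const_mul _).const_mul _

end Rep

section Beta

variable {E : Type*} [NormedAddCommGroup E] [NormedSpace ℝ E]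
  {EG : Type*} [NormedAddCommGroup EG] [NormedSpace ℝ EG]
  {EP : Type*} [NormedAddCommGroup EP] [NormedSpace ℝ EP]
  {M : Type*} [TopologicalSpace M] [ChartedSpace E M]
  {G : Type*} [TopologicalSpace G] [ChartedSpace EG G] [Group G]
  {P : Type*} [TopologicalSpace P] [ChartedSpace EP P] [MulAction Gᵐᵒᵖ P]

/-- The local expression of an element of `Ω^1(M, ad P)` at a point, as a linear map. -/
def localExprLM (B : PrincipalBundle E EG EP M G P) (x : M) (y : E) :
    AdForms EG EP G P →ₗ[ℝ] E →L[ℝ] EG where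
  toFun ξ := localExpr B x ξ.1 y
  map_add' _ _ := rfl
  map_smul' _ _ := rfl

theorem localExpr_translate (B : PrincipalBundle E EG EP M G P) (x : M)
    (A : Connection EG EP G P) (ξ : AdForms EG EP G P) (t : ℝ) :
    localExpr B x (A.translate (t • ξ)).form =
      localExpr B x A.form + t • localExpr B x ξ.1 := rfl

variable [FiniteDimensional ℝ E] [FiniteDimensional ℝ EG] [LieGroup 𝓘(ℝ, EG) ∞ G]
  [IsManifold 𝓘(ℝ, E) ∞ M] [IsManifold 𝓘(ℝ, EP) ∞ P]

theorem rawAt_beta (B : PrincipalBundle E EG EP M G P) {r : ℕ}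
    (p : MultilinearMap ℝ (fun _ : Fin r => EG) ℝ) {k m : ℕ} (h : m + k = 2 * r)
    (A : Connection EG EP G P) (ξ : Fin k → AdForms EG EP G P) (x : M) :
    rawAt (beta B p k m h A ξ) x =
      betaRep G p k m h (localExpr B x A.form (chartAt E x x))
        (fderiv ℝ (localExpr B x A.form) (chartAt E x x))
        (fun i => localExpr B x (ξ i).1 (chartAt E x x)) :=
  beta_eq B p h A ξ x

theorem rawAt_beta_translate (B : PrincipalBundle E EG EP M G P) {r : ℕ}
    (p : MultilinearMap ℝ (fun _ : Fin r => EG) ℝ) {k m : ℕ} (h : m + k = 2 * r)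
    (A : Connection EG EP G P) (ζ : AdForms EG EP G P) (t : ℝ) (ξ : Fin k → AdForms EG EP G P)
    (x : M) :
    rawAt (beta B p k m h (A.translate (t • ζ)) ξ) x =
      betaRep G p k m h
        (localExpr B x A.form (chartAt E x x) + t • localExpr B x ζ.1 (chartAt E x x))
        (fderiv ℝ (localExpr B x A.form) (chartAt E x x) +
          t • fderiv ℝ (localExpr B x ζ.1) (chartAt E x x))
        (fun i => localExpr B x (ξ i).1 (chartAt E x x)) := by
  have ha : DifferentiableAt ℝ (localExpr B x A.form) (chartAt E x x) :=
    (contDiffAt_pullForm_secAt B (chart_mem_secDom B x) A.smooth).differentiableAt (by simp)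
  have hz : DifferentiableAt ℝ (localExpr B x ζ.1) (chartAt E x x) :=
    (contDiffAt_pullForm_secAt B (chart_mem_secDom B x) ζ.2.1).differentiableAt (by simp)
  rw [rawAt_beta, localExpr_translate,
    (ha.hasFDerivAt.add (hz.hasFDerivAt.const_smul t)).fderiv]
  rfl

/-- The alternating dependence of `β_k (A)` on the tangent vectors, at a point of `M`. -/
def betaAlt (B : PrincipalBundle E EG EP M G P) {r : ℕ}
    (p : MultilinearMap ℝ (fun _ : Fin r => EG) ℝ) {k m : ℕ} (h : m + k = 2 * r)
    (A : Connection EG EP G P) (x : M) (v : Fin m → E) :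
    AdForms EG EP G P [⋀^Fin k]→ₗ[ℝ] ℝ :=
  (alternatingInl ((polyF G p ((0 : E), localExpr B x A.form (chartAt E x x))).domDomCongr
      ((finCongr (show r * 2 = m + k by omega)).trans (contractEquiv m k)))
    fun i => (v i, fderiv ℝ (localExpr B x A.form) (chartAt E x x) (v i))).compLinearMap
    ((LinearMap.inr ℝ E (E →L[ℝ] EG)).comp (localExprLM B x (chartAt E x x)))

theorem rawAt_beta_eq_betaAlt (B : PrincipalBundle E EG EP M G P) {r : ℕ}
    (p : MultilinearMap ℝ (fun _ : Fin r => EG) ℝ) {k m : ℕ} (h : m + k = 2 * r)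
    (A : Connection EG EP G P) (ξ : Fin k → AdForms EG EP G P) (x : M) (v : Fin m → E) :
    rawAt (beta B p k m h A ξ) x v = betaAlt B p h A x v ξ := by
  rw [rawAt_beta, betaRep_apply]
  rfl

/-- `β_k (A)` as an alternating map. -/
def betaAlternating (B : PrincipalBundle E EG EP M G P) {r : ℕ}
    (p : MultilinearMap ℝ (fun _ : Fin r => EG) ℝ) {k m : ℕ} (h : m + k = 2 * r)
    (A : Connection EG EP G P) :
    AlternatingMap ℝ (AdForms EG EP G P) (RawForm E M m) (Fin k) where
  toFun ξ := beta B p k m h A ξ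
  map_update_add' ξ i a b := rawForm_ext fun x v => by
    change _ = rawAt (beta B p k m h A _) x v + rawAt (beta B p k m h A _) x v
    simp only [rawAt_beta_eq_betaAlt, AlternatingMap.map_update_add]
  map_update_smul' ξ i c a := rawForm_ext fun x v => by
    change _ = c * rawAt (beta B p k m h A _) x v
    simp only [rawAt_beta_eq_betaAlt, AlternatingMap.map_update_smul, smul_eq_mul]
  map_eq_zero_of_eq' ξ i j hξ hij := rawForm_ext fun x v => by
    change _ = (0 : ℝ)
    rw [rawAt_beta_eq_betaAlt]
    exact AlternatingMap.map_eq_zero_of_eq _ _ hξ hij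

/-- All directional derivatives of `β_k` and of its multiples exist: `β_k` is polynomial along
lines, so Lagrange interpolation writes it there as a combination of finitely many of its values. -/
theorem exists_hasDirDeriv_smul_beta (B : PrincipalBundle E EG EP M G P) {r : ℕ}
    {p : MultilinearMap ℝ (fun _ : Fin r => EG) ℝ} (hp : IsInvariantPoly G p) {k m : ℕ}
    (h : m + k = 2 * r) (b : ℝ) (A : Connection EG EP G P) (ξ : Fin k → AdForms EG EP G P)
    (ζ : AdForms EG EP G P) :
    ∃ η, HasDirDeriv (fun A' => b • beta B p k m h A' ξ) A ζ η := by
  refine ⟨_, hasDirDeriv_of_eq_sum (Finset.range (r * 2 + 1))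
    (c := fun j t => b * (lagrangeCoeff (r * 2) j).eval t)
    (θ := fun j : ℕ => beta B p k m h (A.translate ((j : ℝ) • ζ)) ξ)
    (fun j => isSmoothForm_beta B hp h _ ξ)
    (fun j => ((lagrangeCoeff (r * 2) j).hasDerivAt 0).const_mul b) fun t => ?_⟩
  refine rawForm_ext fun x v => ?_
  have h1 := (isPolyLE_betaRep (G := G) p h (localExpr B x A.form (chartAt E x x))
    (localExpr B x ζ.1 (chartAt E x x)) (fderiv ℝ (localExpr B x A.form) (chartAt E x x))
    (fderiv ℝ (localExpr B x ζ.1) (chartAt E x x))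
    (fun i => localExpr B x (ξ i).1 (chartAt E x x)) v).eq_interpolate t
  rw [rawAt_sum_smul]
  change b * rawAt (beta B p k m h (A.translate (t • ζ)) ξ) x v = _
  simp only [rawAt_beta_translate]
  rw [h1, Finset.mul_sum]
  exact Finset.sum_congr rfl fun j _ => (mul_assoc _ _ _).symm

theorem exists_hasDirDeriv_beta (B : PrincipalBundle E EG EP M G P) {r : ℕ}
    {p : MultilinearMap ℝ (fun _ : Fin r => EG) ℝ} (hp : IsInvariantPoly G p) {k m : ℕ}
    (h : m + k = 2 * r) (A : Connection EG EP G P) (ξ : Fin k → AdForms EG EP G P)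
    (ζ : AdForms EG EP G P) :
    ∃ η, HasDirDeriv (fun A' => beta B p k m h A' ξ) A ζ η := by
  simpa only [one_smul] using exists_hasDirDeriv_smul_beta B hp h 1 A ξ ζ

/-- `β_k` is a differentiable form on `𝒜`. -/
theorem isConnForm_beta (B : PrincipalBundle E EG EP M G P) {r : ℕ}
    {p : MultilinearMap ℝ (fun _ : Fin r => EG) ℝ} (hp : IsInvariantPoly G p) {k m : ℕ}
    (h : m + k = 2 * r) : IsConnForm (beta B p k m h) where
  smooth A ξ := isSmoothForm_beta B hp h A ξ
  alternating A := ⟨betaAlternating B p h A, fun _ => rfl⟩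
  differentiable A ξ ζ := exists_hasDirDeriv_beta B hp h A ξ ζ

end Beta

/-! ### The family of connections spanned by tangent vectors -/

section Family

section Alternating

variable {W : Type*} [NormedAddCommGroup W] [NormedSpace ℝ W]

theorem differentiableAt_alternating [FiniteDimensional ℝ W] {N : Type*} [NormedAddCommGroup N]
    [NormedSpace ℝ N] {m : ℕ}
    {f : N → W [⋀^Fin m]→L[ℝ] ℝ} {y : N} (h : ∀ v, DifferentiableAt ℝ (fun z => f z v) y) :
    DifferentiableAt ℝ f y := by
  obtain ⟨L, hL⟩ := exists_evalBasis_leftInverse (E := W) m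
  have h1 : DifferentiableAt ℝ (fun z => evalBasis W m (f z)) y :=
    differentiableAt_pi.2 fun s => h _
  have h2 := L.differentiableAt.comp y h1
  exact h2.congr_of_eventuallyEq (Eventually.of_forall fun z => (hL (f z)).symm)

theorem fderiv_alternating_apply {N : Type*} [NormedAddCommGroup N] [NormedSpace ℝ N] {m : ℕ}
    {f : N → W [⋀^Fin m]→L[ℝ] ℝ} {y : N} (h : DifferentiableAt ℝ f y) (v : Fin m → W) (w : N) :
    fderiv ℝ (fun z => f z v) y w = fderiv ℝ f y w v :=
  congrArg (fun T : N →L[ℝ] ℝ => T w)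
    ((ContinuousAlternatingMap.apply ℝ W ℝ v).hasFDerivAt.comp y h.hasFDerivAt).fderiv

/-- `castDeg` as a linear map. -/
def castDegLM {n n' : ℕ} (h : n = n') : (W [⋀^Fin n]→ₗ[ℝ] ℝ) →ₗ[ℝ] (W [⋀^Fin n']→ₗ[ℝ] ℝ) where
  toFun := castDeg h
  map_add' _ _ := rfl
  map_smul' _ _ := rfl

theorem alternatizeUncurryFin_castDeg_eq_zero {n n' : ℕ} (h : n = n')
    {T : W →ₗ[ℝ] W [⋀^Fin n]→ₗ[ℝ] ℝ} (hT : AlternatingMap.alternatizeUncurryFin T = 0) :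
    AlternatingMap.alternatizeUncurryFin (castDegLM h ∘ₗ T) = 0 := by
  subst h
  exact hT

/-- The derivative of a field of alternating forms, without continuity in the arguments. -/
def fderivAlt {m : ℕ} (f : W → W [⋀^Fin m]→L[ℝ] ℝ) (q : W) : W →ₗ[ℝ] W [⋀^Fin m]→ₗ[ℝ] ℝ where
  toFun w := (fderiv ℝ f q w).toAlternatingMap
  map_add' w w' := by rw [map_add]; rfl
  map_smul' c w := by rw [map_smul]; rfl

theorem alternating_sum_apply {ι : Type*} {m : ℕ} (s : Finset ι) (f : ι → W [⋀^Fin m]→ₗ[ℝ] ℝ)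
    (v : Fin m → W) : (∑ i ∈ s, f i) v = ∑ i ∈ s, f i v :=
  map_sum ({ toFun := fun θ => θ v, map_zero' := rfl, map_add' := fun _ _ => rfl } :
    (W [⋀^Fin m]→ₗ[ℝ] ℝ) →+ ℝ) f s

end Alternating

variable {E : Type*} [NormedAddCommGroup E] [NormedSpace ℝ E]
  {EG : Type*} [NormedAddCommGroup EG] [NormedSpace ℝ EG] {n : ℕ}

/-- The connection form on `ℝⁿ × E` that restricts to `a + ∑ tᵢ zᵢ` on `{t} × E` and vanishes in
the directions of `ℝⁿ`. -/
def familyForm (a : E → E →L[ℝ] EG) (z : Fin n → E → E →L[ℝ] EG) (q : (Fin n → ℝ) × E) :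
    ((Fin n → ℝ) × E) →L[ℝ] EG :=
  (a q.2 + ∑ i, q.1 i • z i q.2).comp (ContinuousLinearMap.snd ℝ (Fin n → ℝ) E)

theorem contDiffAt_familyForm {l : WithTop ℕ∞} {a : E → E →L[ℝ] EG} {z : Fin n → E → E →L[ℝ] EG}
    {q : (Fin n → ℝ) × E} (ha : ContDiffAt ℝ l a q.2) (hz : ∀ i, ContDiffAt ℝ l (z i) q.2) :
    ContDiffAt ℝ l (familyForm a z) q := by
  refine ContDiffAt.clm_comp ?_ contDiffAt_const
  refine (ha.comp q contDiffAt_snd).add (ContDiffAt.sum fun i _ => ?_)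
  exact (contDiffAt_pi.1 contDiffAt_fst i).smul ((hz i).comp q contDiffAt_snd)

theorem fderiv_familyForm_apply {a : E → E →L[ℝ] EG} {z : Fin n → E → E →L[ℝ] EG}
    {q : (Fin n → ℝ) × E} (ha : DifferentiableAt ℝ a q.2) (hz : ∀ i, DifferentiableAt ℝ (z i) q.2)
    (u v : (Fin n → ℝ) × E) :
    fderiv ℝ (familyForm a z) q u v =
      fderiv ℝ a q.2 u.2 v.2 + ∑ i, q.1 i • fderiv ℝ (z i) q.2 u.2 v.2 +
        ∑ i, u.1 i • z i q.2 v.2 := by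
  have h1 : HasFDerivAt (fun q : (Fin n → ℝ) × E => a q.2)
      ((fderiv ℝ a q.2).comp (ContinuousLinearMap.snd ℝ (Fin n → ℝ) E)) q :=
    ha.hasFDerivAt.comp q hasFDerivAt_snd
  have h2 : ∀ i, HasFDerivAt (fun q : (Fin n → ℝ) × E => q.1 i • z i q.2)
      (q.1 i • (fderiv ℝ (z i) q.2).comp (ContinuousLinearMap.snd ℝ (Fin n → ℝ) E) +
        ((ContinuousLinearMap.proj (R := ℝ) (φ := fun _ : Fin n => ℝ) i).comp
          (ContinuousLinearMap.fst ℝ (Fin n → ℝ) E)).smulRight (z i q.2)) q := fun i =>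
    HasFDerivAt.smul (((ContinuousLinearMap.proj (R := ℝ) (φ := fun _ : Fin n => ℝ) i).comp
      (ContinuousLinearMap.fst ℝ (Fin n → ℝ) E)).hasFDerivAt)
      ((hz i).hasFDerivAt.comp q hasFDerivAt_snd)
  have h3 := h1.add (HasFDerivAt.fun_sum fun i (_ : i ∈ Finset.univ) => h2 i)
  have h4 : HasFDerivAt (familyForm a z) _ q :=
    (((ContinuousLinearMap.compL ℝ ((Fin n → ℝ) × E) E EG).flip
      (ContinuousLinearMap.snd ℝ (Fin n → ℝ) E)).hasFDerivAt.comp q h3)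
  rw [h4.fderiv]
  simp [sum_apply, Finset.sum_add_distrib, add_assoc]

variable [FiniteDimensional ℝ E] [FiniteDimensional ℝ EG]
  {G : Type*} [TopologicalSpace G] [ChartedSpace EG G] [Group G] [LieGroup 𝓘(ℝ, EG) ∞ G]

/-- The form `β` is obtained from the Chern–Weil form of the family of connections by contraction
with the coordinate vector fields of the parameter space and restriction to `{t} × E`. -/
theorem castDeg_polyForm_familyForm {r k m : ℕ} (p : MultilinearMap ℝ (fun _ : Fin r => EG) ℝ)
    (h : m + k = 2 * r) (hd : r * 2 = m + k) {a : E → E →L[ℝ] EG} {z : Fin n → E → E →L[ℝ] EG}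
    {q : (Fin n → ℝ) × E} (ha : DifferentiableAt ℝ a q.2) (hz : ∀ i, DifferentiableAt ℝ (z i) q.2)
    {a' : E →L[ℝ] EG} {D' : E →L[ℝ] E →L[ℝ] EG}
    (ha' : ∀ w, a' w = a q.2 w + ∑ i, q.1 i • z i q.2 w)
    (hD' : ∀ u w, D' u w = fderiv ℝ a q.2 u w + ∑ i, q.1 i • fderiv ℝ (z i) q.2 u w)
    (f : Fin k → Fin n) (v : Fin m → E) :
    castDeg hd (polyForm p (curvForm G (familyForm a z q) (fderiv ℝ (familyForm a z) q)))
        (fun i => Sum.elim (fun l => ((Pi.single (f l) 1, 0) : (Fin n → ℝ) × E))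
          (fun i => (0, v i)) (contractEquiv m k i)) =
      betaRep G p k m h a' D' (fun l => z (f l) q.2) v := by
  rw [betaRep_apply]
  refine polyForm_congr (ContinuousLinearMap.id ℝ EG) (fun _ => rfl) fun i j => ?_
  change curvForm G (familyForm a z q) (fderiv ℝ (familyForm a z) q)
    (Sum.elim _ _ (betaIdx h i)) (Sum.elim _ _ (betaIdx h j)) = univCurv G _ _ _
  rw [curvForm_apply, fderiv_familyForm_apply ha hz, fderiv_familyForm_apply ha hz]
  rcases betaIdx h i with s | s <;> rcases betaIdx h j with t | t
  · simp [betaArgs, univCurv_apply, familyForm]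
  · simp [betaArgs, univCurv_apply, familyForm, Pi.single_apply]
  · simp [betaArgs, univCurv_apply, familyForm, Pi.single_apply]
  · simp [betaArgs, univCurv_apply, familyForm, sum_apply, ha', hD']

/-- The identity `d_𝒜 β_k = d β_{k+1}` in coordinates. The Chern–Weil form of the family of
connections `a + ∑ tᵢ zᵢ` is closed, so the iterated Cartan formula for the contractions with
`∂/∂t₀, …, ∂/∂t_k` expresses `d β_{k+1}` by the derivatives of `β_k` in the parameters. -/
theorem sum_deriv_betaRep {r k j : ℕ} {p : MultilinearMap ℝ (fun _ : Fin r => EG) ℝ}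
    (hp : IsInvariantPoly G p) (h : j + 1 + k = 2 * r) (h' : j + (k + 1) = 2 * r)
    {a : E → E →L[ℝ] EG} {z : Fin (k + 1) → E → E →L[ℝ] EG} {y : E}
    (ha : ContDiffAt ℝ ∞ a y) (hz : ∀ i, ContDiffAt ℝ ∞ (z i) y) (v : Fin (j + 1) → E) :
    ∑ i : Fin (k + 1), (-1 : ℝ) ^ (i : ℕ) *
      deriv (fun t : ℝ => betaRep G p k (j + 1) h (a y + t • z i y)
        (fderiv ℝ a y + t • fderiv ℝ (z i) y) (fun l => z (i.succAbove l) y) v) 0 =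
    ∑ i : Fin (j + 1), (-1 : ℝ) ^ (i : ℕ) *
      fderiv ℝ (fun y' => betaRep G p (k + 1) j h' (a y') (fderiv ℝ a y') (fun i => z i y')
        (i.removeNth v)) y (v i) := by
  have hd : r * 2 = j + (k + 1) := by omega
  have hd' : r * 2 = j + 1 + k := by omega
  set q₀ : (Fin (k + 1) → ℝ) × E := (0, y) with hq₀
  let e : Fin (k + 1) → (Fin (k + 1) → ℝ) × E := fun i => (Pi.single i 1, 0)
  let V : Fin (j + 1) → (Fin (k + 1) → ℝ) × E := fun i => (0, v i)
  let Ω : (Fin (k + 1) → ℝ) × E → ((Fin (k + 1) → ℝ) × E) [⋀^Fin (r * 2)]→L[ℝ] ℝ := fun q =>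
    toCont (polyForm p (curvForm G (familyForm a z q) (fderiv ℝ (familyForm a z) q)))
  have hα : ContDiffAt ℝ 2 (familyForm a z) q₀ :=
    (contDiffAt_familyForm (q := q₀) ha hz).of_le two_le_infty
  have hΩ1 : ∀ x, DifferentiableAt ℝ (fun q => Ω q x) q₀ := fun x =>
    (hasFDerivAt_polyForm p (hasFDerivAt_curvForm hα) x).1
  have hΩ : DifferentiableAt ℝ Ω q₀ := differentiableAt_alternating hΩ1
  have hT : AlternatingMap.alternatizeUncurryFin (fderivAlt Ω q₀) = 0 := by
    ext x
    rw [AlternatingMap.alternatizeUncurryFin_apply]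
    refine Eq.trans (Finset.sum_congr rfl fun i _ => ?_)
      (alternation_fderiv_polyForm_curvForm hp hα x)
    rw [zsmul_eq_mul]
    push_cast
    congr 1
    exact (fderiv_alternating_apply hΩ _ _).symm
  have hcartan := alternatizeUncurryFin_iterContract j k e (castDegLM hd ∘ₗ fderivAlt Ω q₀)
  rw [alternatizeUncurryFin_castDeg_eq_zero hd hT] at hcartan
  have hzero : ∀ θ : ((Fin (k + 1) → ℝ) × E) [⋀^Fin (j + (k + 1) + 1)]→ₗ[ℝ] ℝ, θ = 0 →
      iterContract (j + 1) (k + 1) e (castDeg (by omega) θ) = 0 := by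
    rintro _ rfl
    exact map_zero (iterContractLM (j + 1) (k + 1) e)
  rw [hzero _ rfl, smul_zero, add_zero] at hcartan
  have hcartan' := congrArg (fun θ : ((Fin (k + 1) → ℝ) × E) [⋀^Fin (j + 1)]→ₗ[ℝ] ℝ => θ V) hcartan
  have hda : ∀ᶠ y' in 𝓝 y, DifferentiableAt ℝ a y' :=
    ((ha.of_le (m := 1) (by simp)).eventually (by simp)).mono fun _ h =>
      h.differentiableAt (by simp)
  have hdz : ∀ᶠ y' in 𝓝 y, ∀ i, DifferentiableAt ℝ (z i) y' :=
    eventually_all.2 fun i => (((hz i).of_le (m := 1) (by simp)).eventually (by simp)).mono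
      fun _ h => h.differentiableAt (by simp)
  -- the derivatives in the directions of `E`
  have key1 : ∀ i : Fin (j + 1),
      iterContract j (k + 1) e (castDeg hd (fderivAlt Ω q₀ (V i))) (i.removeNth V) =
        fderiv ℝ (fun y' => betaRep G p (k + 1) j h' (a y') (fderiv ℝ a y') (fun i => z i y')
          (i.removeNth v)) y (v i) := by
    intro i
    let X : Fin (r * 2) → (Fin (k + 1) → ℝ) × E := fun l =>
      Sum.elim e (i.removeNth V) (contractEquiv j (k + 1) (finCongr hd l))
    have e1 : (fun y' => betaRep G p (k + 1) j h' (a y') (fderiv ℝ a y') (fun i => z i y')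
        (i.removeNth v)) =ᶠ[𝓝 y] fun y' => Ω (0, y') X := by
      filter_upwards [hda, hdz] with y' h1 h2
      have e2 := castDeg_polyForm_familyForm (G := G) p h' hd (q := ((0 : Fin (k + 1) → ℝ), y'))
        h1 h2 (a' := a y') (D' := fderiv ℝ a y') (by simp) (by simp) id (i.removeNth v)
      exact e2.symm
    have e3 : HasFDerivAt (fun y' : E => ((0 : Fin (k + 1) → ℝ), y'))
        (ContinuousLinearMap.inr ℝ (Fin (k + 1) → ℝ) E) y :=
      (ContinuousLinearMap.inr ℝ (Fin (k + 1) → ℝ) E).hasFDerivAt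
    have e4 : HasFDerivAt (fun y' => Ω (0, y') X) _ y := (hΩ1 X).hasFDerivAt.comp y e3
    rw [e1.fderiv_eq, e4.fderiv, iterContract_apply]
    exact (fderiv_alternating_apply hΩ X (V i)).symm
  -- the derivatives in the parameters
  have key2 : ∀ i : Fin (k + 1),
      iterContract (j + 1) k (fun l => e (i.succAbove l))
        (castDeg (by omega) (castDeg hd (fderivAlt Ω q₀ (e i)))) V =
      deriv (fun t : ℝ => betaRep G p k (j + 1) h (a y + t • z i y)
        (fderiv ℝ a y + t • fderiv ℝ (z i) y) (fun l => z (i.succAbove l) y) v) 0 := by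
    intro i
    let X : Fin (r * 2) → (Fin (k + 1) → ℝ) × E := fun l =>
      Sum.elim (fun l => e (i.succAbove l)) V (contractEquiv (j + 1) k (finCongr hd' l))
    have e1 : (fun t : ℝ => betaRep G p k (j + 1) h (a y + t • z i y)
        (fderiv ℝ a y + t • fderiv ℝ (z i) y) (fun l => z (i.succAbove l) y) v) =
        fun t => Ω (t • e i + q₀) X := by
      funext t
      have e2 := castDeg_polyForm_familyForm (G := G) p h hd'
        (q := ((Pi.single i t : Fin (k + 1) → ℝ), y)) hda.self_of_nhds hdz.self_of_nhds
        (a' := a y + t • z i y) (D' := fderiv ℝ a y + t • fderiv ℝ (z i) y)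
        (by simp [Pi.single_apply]) (by simp [Pi.single_apply]) i.succAbove v
      have e3 : t • e i + q₀ = ((Pi.single i t : Fin (k + 1) → ℝ), y) := by
        ext l
        · by_cases hl : l = i
          · subst hl; simp [e, hq₀]
          · simp [e, hq₀, hl]
        · simp [e, hq₀]
      rw [e3]
      exact e2.symm
    have e4 : HasDerivAt (fun t : ℝ => t • e i + q₀) (e i) 0 := by
      simpa using ((hasDerivAt_id (0 : ℝ)).smul_const (e i)).add_const q₀
    have e5 : HasDerivAt (fun t : ℝ => Ω (t • e i + q₀) X) _ 0 :=
      (hΩ1 X).hasFDerivAt.comp_hasDerivAt_of_eq 0 e4 (by simp)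
    rw [e1, e5.deriv, iterContract_apply]
    exact (fderiv_alternating_apply hΩ X (e i)).symm
  simp only [← key1, ← key2]
  have hL : AlternatingMap.alternatizeUncurryFin
      (iterContractLM j (k + 1) e ∘ₗ castDegLM hd ∘ₗ fderivAlt Ω q₀) V =
      ∑ i : Fin (j + 1), (-1 : ℝ) ^ (i : ℕ) *
        iterContract j (k + 1) e (castDeg hd (fderivAlt Ω q₀ (V i))) (i.removeNth V) := by
    rw [AlternatingMap.alternatizeUncurryFin_apply]
    refine Finset.sum_congr rfl fun i _ => ?_
    rw [zsmul_eq_mul]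
    push_cast
    rfl
  refine Eq.trans ?_ (hcartan'.symm.trans hL)
  rw [alternating_sum_apply]
  rfl

end Family

/-! ### The exterior derivative of `β` on `𝒜` -/

section ExteriorDerivative

variable {E : Type*} [NormedAddCommGroup E] [NormedSpace ℝ E]
  {M : Type*} [TopologicalSpace M] [ChartedSpace E M] [IsManifold 𝓘(ℝ, E) 1 M]

theorem rawAt_extD {j : ℕ} (θ : RawForm E M j) (x : M) :
    rawAt (extD θ) x = extDeriv (chartRep x θ) (chartAt E x x) := by
  ext v
  change extDeriv (chartRep x θ) (chartAt E x x) (fun i => mD E E (chartAt E x) x (v i)) = _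
  rw [mD_chart_self]
  rfl

theorem extD_smul {j : ℕ} (c : ℝ) (θ : RawForm E M j) : extD (c • θ) = c • extD θ := by
  refine rawForm_ext fun x v => ?_
  change _ = c * rawAt (extD θ) x v
  rw [rawAt_extD, rawAt_extD]
  have h : chartRep x (c • θ) = c • chartRep x θ := rfl
  rw [h, extDeriv_smul]
  rfl

theorem extD_zero {j : ℕ} : extD (0 : RawForm E M j) = 0 := by
  have h := extD_smul (0 : ℝ) (0 : RawForm E M j)
  rwa [zero_smul, zero_smul] at h

end ExteriorDerivative

section Vanishing

variable {E : Type*} [NormedAddCommGroup E] [NormedSpace ℝ E] [FiniteDimensional ℝ E]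
  {EG : Type*} [NormedAddCommGroup EG] [NormedSpace ℝ EG] [FiniteDimensional ℝ EG]
  {G : Type*} [TopologicalSpace G] [ChartedSpace EG G] [Group G] [LieGroup 𝓘(ℝ, EG) ∞ G]

/-- More than `r` vertical vectors annihilate `p (F)`: two of them are arguments of the same
factor `F`, and `F` vanishes on pairs of vertical vectors. -/
theorem betaRep_eq_zero {r k m : ℕ} (p : MultilinearMap ℝ (fun _ : Fin r => EG) ℝ)
    (h : m + k = 2 * r) (hk : r < k) (a : E →L[ℝ] EG) (D : E →L[ℝ] E →L[ℝ] EG)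
    (ξ : Fin k → E →L[ℝ] EG) (v : Fin m → E) : betaRep G p k m h a D ξ v = 0 := by
  rw [betaRep_apply, polyForm_apply]
  refine mul_eq_zero_of_right _ (Finset.sum_eq_zero fun σ _ => mul_eq_zero_of_right _ ?_)
  have hpair : ∃ i : Fin r, ∀ b : Fin 2, ∃ s : Fin k,
      betaIdx h (finProdFinEquiv (σ (i, b))) = Sum.inl s := by
    by_contra hcon
    push Not at hcon
    have hr : ∀ i : Fin r, ∃ (b : Fin 2) (t : Fin m),
        betaIdx h (finProdFinEquiv (σ (i, b))) = Sum.inr t := by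
      intro i
      obtain ⟨b, hb⟩ := hcon i
      rcases hs : betaIdx h (finProdFinEquiv (σ (i, b))) with s | t
      · exact absurd hs (hb s)
      · exact ⟨b, t, hs⟩
    choose b t ht using hr
    have hinj : Function.Injective t := by
      intro i i' hii
      have h1 : betaIdx h (finProdFinEquiv (σ (i, b i))) =
          betaIdx h (finProdFinEquiv (σ (i', b i'))) := by rw [ht, ht, hii]
      have h2 := σ.injective (finProdFinEquiv.injective
        ((finCongr _).injective ((contractEquiv m k).injective h1)))
      exact congrArg Prod.fst h2
    have := Fintype.card_le_of_injective t hinj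
    simp only [Fintype.card_fin] at this
    omega
  obtain ⟨i, hi⟩ := hpair
  obtain ⟨s, hs⟩ := hi 0
  obtain ⟨s', hs'⟩ := hi 1
  refine p.map_coord_zero i ?_
  rw [hs, hs']
  simp [betaArgs, univCurv_apply]

end Vanishing

section Main

variable {E : Type*} [NormedAddCommGroup E] [NormedSpace ℝ E] [FiniteDimensional ℝ E]
  {EG : Type*} [NormedAddCommGroup EG] [NormedSpace ℝ EG] [FiniteDimensional ℝ EG]
  {EP : Type*} [NormedAddCommGroup EP] [NormedSpace ℝ EP]
  {M : Type*} [TopologicalSpace M] [ChartedSpace E M] [IsManifold 𝓘(ℝ, E) ∞ M]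
  {G : Type*} [TopologicalSpace G] [ChartedSpace EG G] [Group G] [LieGroup 𝓘(ℝ, EG) ∞ G]
  {P : Type*} [TopologicalSpace P] [ChartedSpace EP P] [IsManifold 𝓘(ℝ, EP) ∞ P]
  [MulAction Gᵐᵒᵖ P]

/-- `d_𝒜 β_k = d β_{k+1}`. -/
theorem connD_beta (B : PrincipalBundle E EG EP M G P) {r k j : ℕ}
    {p : MultilinearMap ℝ (fun _ : Fin r => EG) ℝ} (hp : IsInvariantPoly G p)
    (h : j + 1 + k = 2 * r) (h' : j + (k + 1) = 2 * r) (A : Connection EG EP G P)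
    (ξ : Fin (k + 1) → AdForms EG EP G P) :
    connD (beta B p k (j + 1) h) A ξ = extD (beta B p (k + 1) j h' A ξ) := by
  have : IsManifold 𝓘(ℝ, E) 1 M := IsManifold.of_le (n := ∞) (by simp)
  refine rawForm_ext fun x v => ?_
  have hx := chart_mem_secDom B x
  have e1 := sum_deriv_betaRep hp h h' (contDiffAt_pullForm_secAt B hx A.smooth)
    (fun i => contDiffAt_pullForm_secAt B hx (ξ i).2.1) v
  have e2 : ∀ i : Fin (k + 1), rawAt (dirDeriv (fun A' => beta B p k (j + 1) h A'
      (fun l => ξ (i.succAbove l))) A (ξ i)) x v =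
      deriv (fun t : ℝ => betaRep G p k (j + 1) h
        (localExpr B x A.form (chartAt E x x) + t • localExpr B x (ξ i).1 (chartAt E x x))
        (fderiv ℝ (localExpr B x A.form) (chartAt E x x) +
          t • fderiv ℝ (localExpr B x (ξ i).1) (chartAt E x x))
        (fun l => localExpr B x (ξ (i.succAbove l)).1 (chartAt E x x)) v) 0 := fun i => by
    have h1 := dirDeriv_apply (exists_hasDirDeriv_beta B hp h A (fun l => ξ (i.succAbove l)) (ξ i))
      x v
    simp only [rawAt_beta_translate] at h1
    exact h1.deriv.symm
  have e3 : ∀ w : Fin j → E, (fun y => chartRep x (beta B p (k + 1) j h' A ξ) y w)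
      =ᶠ[𝓝 (chartAt E x x)] fun y => betaRep G p (k + 1) j h' (pullForm (secAt B x x) A.form y)
        (fderiv ℝ (pullForm (secAt B x x) A.form) y)
        (fun i => pullForm (secAt B x x) (ξ i).1 y) w := fun w => by
    filter_upwards [eventually_mem_secDom B hx] with y hy
    rw [chartRep_beta B hp h' A ξ hy]
  have hsm : DifferentiableAt ℝ (chartRep x (beta B p (k + 1) j h' A ξ)) (chartAt E x x) :=
    ((isSmoothForm_beta B hp h' A ξ x).contDiffAt
      ((chartAt E x).open_target.mem_nhds (mem_chart_target E x))).differentiableAt (by simp)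
  rw [connD, rawAt_sum_smul, rawAt_extD, extDeriv_apply hsm]
  simp only [e2, (e3 _).fderiv_eq, zsmul_eq_mul, Int.cast_pow, Int.cast_neg, Int.cast_one,
    localExpr_eq_pullForm]
  exact e1

theorem connD_const_smul_beta (B : PrincipalBundle E EG EP M G P) {r k m : ℕ}
    {p : MultilinearMap ℝ (fun _ : Fin r => EG) ℝ} (hp : IsInvariantPoly G p)
    (h : m + k = 2 * r) (c : ℝ) (A : Connection EG EP G P)
    (ξ : Fin (k + 1) → AdForms EG EP G P) :
    connD (fun A' ξ' => c • beta B p k m h A' ξ') A ξ = c • connD (beta B p k m h) A ξ := by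
  have : IsManifold 𝓘(ℝ, E) 1 M := IsManifold.of_le (n := ∞) (by simp)
  rw [connD, connD, Finset.smul_sum]
  refine Finset.sum_congr rfl fun i _ => ?_
  rw [dirDeriv_const_smul c (exists_hasDirDeriv_beta B hp h A _ _)
    (exists_hasDirDeriv_smul_beta B hp h c A _ _)]
  refine rawForm_ext fun x v => ?_
  exact mul_left_comm _ _ _

theorem beta_eq_zero (B : PrincipalBundle E EG EP M G P) {r k m : ℕ}
    (p : MultilinearMap ℝ (fun _ : Fin r => EG) ℝ) (h : m + k = 2 * r) (hk : r < k)
    (A : Connection EG EP G P) (ξ : Fin k → AdForms EG EP G P) : beta B p k m h A ξ = 0 :=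
  rawForm_ext fun x v => by
    rw [rawAt_beta]
    exact betaRep_eq_zero p h hk _ _ _ v

/-- For `r = 0` the form `β_0` is a constant function on `𝒜`. -/
theorem connD_beta_degree_zero (B : PrincipalBundle E EG EP M G P) {m k : ℕ}
    {p : MultilinearMap ℝ (fun _ : Fin 0 => EG) ℝ} (hp : IsInvariantPoly G p)
    (h : m + k = 2 * 0) (A : Connection EG EP G P) (ξ : Fin (k + 1) → AdForms EG EP G P) :
    connD (beta B p k m h) A ξ = 0 := by
  have : IsManifold 𝓘(ℝ, E) 1 M := IsManifold.of_le (n := ∞) (by simp)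
  refine rawForm_ext fun x v => ?_
  rw [connD, rawAt_sum_smul]
  refine Finset.sum_eq_zero fun i _ => mul_eq_zero_of_right _ ?_
  have h1 := dirDeriv_apply (exists_hasDirDeriv_beta B hp h A (fun l => ξ (i.succAbove l)) (ξ i))
    x v
  have h2 : ∀ t : ℝ, rawAt (beta B p k m h (A.translate (t • ξ i)) fun l => ξ (i.succAbove l)) x v =
      rawAt (beta B p k m h A fun l => ξ (i.succAbove l)) x v := fun t => by
    rw [rawAt_beta, rawAt_beta, betaRep_apply, betaRep_apply]
    exact polyForm_congr id (fun _ => congrArg p (Subsingleton.elim _ _)) fun i => i.elim0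
  simp only [h2] at h1
  exact h1.unique (hasDerivAt_const _ _)

/-- `d_𝒜 β_r = 0`. -/
theorem connD_beta_self (B : PrincipalBundle E EG EP M G P) {r m : ℕ}
    {p : MultilinearMap ℝ (fun _ : Fin r => EG) ℝ} (hp : IsInvariantPoly G p)
    (h : m + r = 2 * r) (A : Connection EG EP G P) (ξ : Fin (r + 1) → AdForms EG EP G P) :
    connD (beta B p r m h) A ξ = 0 := by
  have : IsManifold 𝓘(ℝ, E) 1 M := IsManifold.of_le (n := ∞) (by simp)
  rcases r with _ | r
  · exact connD_beta_degree_zero B hp h A ξ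
  · obtain rfl : m = r + 1 := by omega
    rw [connD_beta B hp h (by omega) A ξ, beta_eq_zero B p _ (Nat.lt_succ_self _), extD_zero]

end Main

end ConnForms

end
open ConnForms in
theorem proposition3p1
    {E : Type*} [NormedAddCommGroup E] [NormedSpace ℝ E] [FiniteDimensional ℝ E]
    {EG : Type*} [NormedAddCommGroup EG] [NormedSpace ℝ EG] [FiniteDimensional ℝ EG]
    {EP : Type*} [NormedAddCommGroup EP] [NormedSpace ℝ EP]
    {M : Type*} [TopologicalSpace M] [ChartedSpace E M] [IsManifold 𝓘(ℝ, E) ∞ M]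
    {G : Type*} [TopologicalSpace G] [ChartedSpace EG G] [Group G] [LieGroup 𝓘(ℝ, EG) ∞ G]
    {P : Type*} [TopologicalSpace P] [ChartedSpace EP P] [IsManifold 𝓘(ℝ, EP) ∞ P]
    [MulAction Gᵐᵒᵖ P]
    (B : PrincipalBundle E EG EP M G P)
    (r k : ℕ) (hk : k ≤ r)
    (p : MultilinearMap ℝ (fun _ : Fin r => EG) ℝ) (hp : IsInvariantPoly G p) :
    -- `β_k` is a form on `𝒜` with values in `Ω^m(M)`, `m = 2r - k`, and `d_𝒜 β_k` takes exact
    -- values; it vanishes for `k = r`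
    (∀ (m : ℕ) (h : m + k = 2 * r),
      IsConnForm (beta B p k m h) ∧
      (∀ A ξ, IsExactForm (connD (beta B p k m h) A ξ)) ∧
      (k = r → ∀ A ξ, connD (beta B p k m h) A ξ = 0)) ∧
    -- the identity `d_𝒜 β_k = d ∘ β_{k+1}`, where `β_{k+1}` has degree `j = 2r - k - 1` on `M`
    (∀ (j : ℕ) (h : j + 1 + k = 2 * r) (h' : j + (k + 1) = 2 * r),
      IsConnForm (beta B p (k + 1) j h') ∧
      (∀ A ξ, connD (beta B p k (j + 1) h) A ξ = extD (beta B p (k + 1) j h' A ξ)) ∧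
      -- the same identity for the normalized forms `((r-k)!/r!) β_k`
      (k < r → ∀ A ξ,
        connD (fun A' ξ' => (((r - k).factorial : ℝ) / (r.factorial : ℝ)) •
            beta B p k (j + 1) h A' ξ') A ξ =
          ((r : ℝ) - (k : ℝ)) •
            extD ((((r - (k + 1)).factorial : ℝ) / (r.factorial : ℝ)) •
              beta B p (k + 1) j h' A ξ))) := by
  have : IsManifold 𝓘(ℝ, E) 1 M := IsManifold.of_le (n := ∞) (by simp)
  refine ⟨fun m h => ⟨isConnForm_beta B hp h, fun A ξ => ?_, ?_⟩,
    fun j h h' => ⟨isConnForm_beta B hp h', fun A ξ => connD_beta B hp h h' A ξ, fun hkr A ξ => ?_⟩⟩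
  · rcases m with _ | j
    · -- `2r = k ≤ r` leaves only `r = k = 0`
      obtain rfl : r = 0 := by omega
      exact connD_beta_degree_zero B hp h A ξ
    · exact ⟨_, isSmoothForm_beta B hp (by omega) A ξ, connD_beta B hp h (by omega) A ξ⟩
  · rintro rfl A ξ
    exact connD_beta_self B hp h A ξ
  · rw [connD_const_smul_beta B hp h, connD_beta B hp h h', extD_smul, smul_smul]
    congr 1
    have h1 : r - k = r - (k + 1) + 1 := by omega
    have h2 : ((r - (k + 1) : ℕ) : ℝ) + 1 = (r : ℝ) - (k : ℝ) := by
      rw [Nat.cast_sub hkr]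
      push_cast
      ring
    rw [h1, Nat.factorial_succ, Nat.cast_mul, Nat.cast_succ, h2, mul_div_assoc]
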